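/- **Setting.** Let $\mathcal H$ be a separable complex Hilbert space. A normed ideal of $\mathcal B(\mathcal H)$ is a two-sided ideal $\mathcal I$ with a norm $\|\cdot\|_{\mathcal I}$ such that $0\le A\le B\in\mathcal I$, $A\in\mathcal I$, implies $\|A\|_{\mathcal I}\le\|B\|_{\mathcal I}$; $\|B\|\le K\|B\|_{\mathcal I}$ for some constant $K>0$ and all $B\in\mathcal I$; and $\|ABC\|_{\mathcal I}\le\|A\|\,\|B\|_{\mathcal I}\,\|C\|$ for $A,C\in\mathcal B(\mathcal H)$, $B\in\mathcal I$. Let $\mathcal I$ be a normed ideal that is complete in $\|\cdot\|_{\mathcal I}$, and let $\tau$ be a positive $\|\cdot\|_{\mathcal I}$-bounded trace on $\mathcal I$ (a linear functional with $\tau(AB)=\tau(BA)$ for $A\in\mathcal I$, $B\in\mathcal B(\mathcal H)$). Assume that $\mathcal I^{1/2}=\{A\in\mathcal B(\mathcal H):|A|^2\in\mathcal I\}$ is a normed ideal with a norm satisfying $\|AB\|_{\mathcal I}\le\|A\|_{\mathcal I^{1/2}}\|B\|_{\mathcal I^{1/2}}$ for $A,B\in\mathcal I^{1/2}$. Let $\mathbf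 A_n=(A_1,\dots,A_n)$ and $\mathbf B_n=(B_1,\dots,B_n)$ be tuples of pairwise commuting contractions on $\mathcal H$, put $V_j=B_j-A_j$, $X_j(s)=A_j+sV_j$, $\mathbf X_n(s)=(X_1(s),\dots,X_n(s))$, and assume that $V_j\in\mathcal I^{1/2}$ for all $j$ and $[V_i,V_j]=0$ for all $i,j$. Assume moreover that for every $t\in[0,1]$ the tuple $\mathbf X_n(t)$ consists of pairwise commuting contractions and has a commuting contractive normal dilation: there are a Hilbert space $\mathcal K\supset\mathcal H$ and pairwise commuting normal contractions $U_1,\dots,U_n$ on $\mathcal K$ with $X_{j_1}(t)\cdots X_{j_l}(t)=P_{\mathcal H}U_{j_1}\cdots U_{j_l}|_{\mathcal H}$ for all $l$ and $j_1,\dots,j_l$. For $f(z)=\sum_k c_kz_1^{k_1}\cdots z_n^{k_n}$ converging absolutely on a polydisc $\{|z_j|<1+\varepsilon,\ 1\le j\le n\}$, $\varepsilon>0$, put $f(\mathbf X)=\sum_k c_kX_1^{k_1}\cdots X_n^{k_n}$, and $$R_f=f(\mathbf B_n)-f(\mathbf A_n)-\tfrac{d}{ds}\big|_{s=0}f(\mathbf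 X_n(s)),$$ with the derivative in the operator norm. **Theorem.** (1) Let $\Omega=\mathbb T$ be the unit circle. There are finite complex measures $\nu_{ij}$, $1\le i\le j\le n$, on $\Omega^n$ such that $$\|\nu_{ij}\|\le\tfrac12\,\tau(|V_i|^2)^{1/2}\,\tau(|V_j|^2)^{1/2},\qquad \nu_{ij}(\Omega^n)=\tfrac12\,\tau(V_iV_j),$$ and, for every $\varepsilon>0$ and every such $f$, the derivative exists, $R_f\in\mathcal I$, and $$\tau(R_f)=\sum_{j}\int_{\Omega^n}\frac{\partial^2f}{\partial z_j^2}\,d\nu_{jj}+2\sum_{i<j}\int_{\Omega^n}\frac{\partial^2f}{\partial z_i\partial z_j}\,d\nu_{ij}.$$ Moreover, for every $1\le j\le n$, there exists a complex measure $\nu$ on $\mathbb T$ such that $\|\nu\|\le\frac12\tau(|V_j|^2)$ and $$\tau\Big(h(B_j)-h(A_j)-\tfrac{d}{ds}\big|_{s=0}h(A_j+sV_j)\Big)=\int_{\mathbb T}h''\,d\nu$$ for every $h$ analytic on a disc $\{|z|<1+\varepsilon\}$, $\varepsilon>0$; and every such $\nu$ satisfies $$\int_{\Omega^n}g(z_j)\,d\nu_{jj}(z_1,\dots,z_n)=\int_{\mathbb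 T}g\,d\nu$$ for every $g$ analytic on a disc $\{|z|<1+\varepsilon\}$, $\varepsilon>0$. (2) If, in addition, all $A_j$ and $B_j$ are self-adjoint, then there are finite real-valued measures $\nu_{ij}$, $1\le i\le j\le n$, on $\Omega^n$ with $\Omega=[-1,1]$ for which the norm bound, the formula for $\nu_{ij}(\Omega^n)$, and the trace formula of (1) hold, the latter for every $f$ given by a power series (with complex coefficients) that converges absolutely on $(-1-\varepsilon,1+\varepsilon)^n$ for some $\varepsilon>0$. -/

import Mathlib

open MeasureTheory

noncomputable section

/-- Points of the unit circle `𝕋`, with the Borel structure inherited from `ℂ`. -/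
abbrev UnitCirc : Type := Metric.sphere (0 : ℂ) 1

/-- Points of the interval `[-1, 1]`. -/
abbrev UnitIcc : Type := Set.Icc (-1 : ℝ) 1

section Ideals

variable {H : Type*} [NormedAddCommGroup H] [InnerProductSpace ℂ H] [CompleteSpace H]

/-- A normed ideal of `B(H)`: a two-sided ideal with an ideal norm (the seminorm `nrm` is a norm
by `bound`). Completeness is the separate predicate `NormedIdeal.IsComplete`. -/
structure NormedIdeal (H : Type*) [NormedAddCommGroup H] [InnerProductSpace ℂ H]
    [CompleteSpace H] where
  carrier : Submodule ℂ (H →L[ℂ] H)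
  mul_mem_left : ∀ (A : H →L[ℂ] H) {B : H →L[ℂ] H}, B ∈ carrier → A * B ∈ carrier
  mul_mem_right : ∀ {B : H →L[ℂ] H} (C : H →L[ℂ] H), B ∈ carrier → B * C ∈ carrier
  nrm : Seminorm ℂ carrier
  mono : ∀ A B : carrier, 0 ≤ (A : H →L[ℂ] H) → (A : H →L[ℂ] H) ≤ B → nrm A ≤ nrm B
  bound : ∃ K : ℝ, 0 < K ∧ ∀ B : carrier, ‖(B : H →L[ℂ] H)‖ ≤ K * nrm B
  ideal_le : ∀ (A C : H →L[ℂ] H) (B : carrier),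
    nrm ⟨A * B * C, mul_mem_right C (mul_mem_left A B.2)⟩ ≤ ‖A‖ * nrm B * ‖C‖

/-- Every sequence that is Cauchy for the ideal norm converges for the ideal norm. -/
def NormedIdeal.IsComplete (I : NormedIdeal H) : Prop :=
  ∀ u : ℕ → I.carrier,
    (∀ δ : ℝ, 0 < δ → ∃ N : ℕ, ∀ m ≥ N, ∀ k ≥ N, I.nrm (u m - u k) < δ) →
    ∃ a : I.carrier, Filter.Tendsto (fun m => I.nrm (u m - a)) Filter.atTop (nhds 0)

/-- `J` is the ideal `I^{1/2} = {A : |A|² ∈ I}`, where `|A|² = A* A`, with an ideal norm such that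
`‖A B‖_I ≤ ‖A‖_J ‖B‖_J`. -/
structure NormedIdeal.IsSqrtOf (J I : NormedIdeal H) : Prop where
  mem_iff : ∀ A : H →L[ℂ] H, A ∈ J.carrier ↔ star A * A ∈ I.carrier
  nrm_mul_le : ∀ (A B : J.carrier) (h : (A : H →L[ℂ] H) * B ∈ I.carrier),
    I.nrm ⟨(A : H →L[ℂ] H) * B, h⟩ ≤ J.nrm A * J.nrm B

/-- A positive trace on `I` that is bounded for the ideal norm. -/
structure NormedIdeal.IsPosBddTrace (I : NormedIdeal H) (τ : I.carrier →ₗ[ℂ] ℂ) : Prop where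
  cyclic : ∀ (A : I.carrier) (B : H →L[ℂ] H),
    τ ⟨A * B, I.mul_mem_right B A.2⟩ = τ ⟨B * A, I.mul_mem_left B A.2⟩
  pos : ∀ A : I.carrier, 0 ≤ (A : H →L[ℂ] H) → 0 ≤ (τ A).re ∧ (τ A).im = 0
  bdd : ∃ M : ℝ, 0 < M ∧ ∀ A : I.carrier, ‖τ A‖ ≤ M * I.nrm A

open Classical in
/-- `τ(A)` for `A ∈ I`, and `0` outside of `I`. -/
def NormedIdeal.tr (I : NormedIdeal H) (τ : I.carrier →ₗ[ℂ] ℂ) (A : H →L[ℂ] H) : ℂ :=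
  if h : A ∈ I.carrier then τ ⟨A, h⟩ else 0

/-- `τ(|A|²)` as a real number. -/
def NormedIdeal.trSq (I : NormedIdeal H) (τ : I.carrier →ₗ[ℂ] ℂ) (A : H →L[ℂ] H) : ℝ :=
  (I.tr τ (star A * A)).re

end Ideals

section Tuples

/-- A tuple of pairwise commuting contractions. -/
structure IsCommContr {n : ℕ} {H : Type*} [NormedAddCommGroup H] [InnerProductSpace ℂ H]
    (X : Fin n → H →L[ℂ] H) : Prop where
  norm_le : ∀ j, ‖X j‖ ≤ 1
  comm : ∀ i j, Commute (X i) (X j)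

/-- `X` has a dilation to a tuple `U` of commuting normal contractions on a Hilbert space `K`
containing `H` (through the isometry `ι`, so that `P_H` is the adjoint of `ι`):
`X_{j₁} ⋯ X_{jₗ} = P_H U_{j₁} ⋯ U_{jₗ} |_H` for every word `j₁, …, jₗ`. -/
def HasNormalDilation.{u} {n : ℕ} {H : Type u} [NormedAddCommGroup H] [InnerProductSpace ℂ H]
    [CompleteSpace H] (X : Fin n → H →L[ℂ] H) : Prop :=
  ∃ (K : Type u) (_ : NormedAddCommGroup K) (_ : InnerProductSpace ℂ K) (_ : CompleteSpace K)
    (ι : H →ₗᵢ[ℂ] K) (U : Fin n → K →L[ℂ] K),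
    IsCommContr U ∧ (∀ j, IsStarNormal (U j)) ∧
    ∀ w : List (Fin n), (w.map X).prod =
      (ContinuousLinearMap.adjoint ι.toContinuousLinearMap) ∘L (w.map U).prod ∘L
        ι.toContinuousLinearMap

variable {n : ℕ} {H : Type*} [NormedAddCommGroup H] [InnerProductSpace ℂ H] [CompleteSpace H]

/-- The linear path `X_j(s) = A_j + s (B_j - A_j)`. -/
def linPath (A B : Fin n → H →L[ℂ] H) (s : ℝ) : Fin n → H →L[ℂ] H :=
  fun j => A j + s • (B j - A j)

/-- The linear path joining `A` and `B` consists of tuples of commuting contractions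
that admit a commuting contractive normal dilation. -/
def IsDilatablePath (A B : Fin n → H →L[ℂ] H) : Prop :=
  ∀ t ∈ Set.Icc (0 : ℝ) 1, IsCommContr (linPath A B t) ∧ HasNormalDilation (linPath A B t)

/-- `f(z) = ∑ c_k z_1^{k_1} ⋯ z_n^{k_n}`, absolutely convergent on the polydisc of radius `r`. -/
def IsPolydiscSeries (c : (Fin n → ℕ) → ℂ) (r : ℝ) (f : (Fin n → ℂ) → ℂ) : Prop :=
  ∀ z : Fin n → ℂ, (∀ j, ‖z j‖ < r) → HasSum (fun k => c k * ∏ j, z j ^ k j) (f z)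

/-- `f(x) = ∑ c_k x_1^{k_1} ⋯ x_n^{k_n}`, absolutely convergent on the cube `(-r, r)^n`. -/
def IsCubeSeries (c : (Fin n → ℕ) → ℂ) (r : ℝ) (f : (Fin n → ℝ) → ℂ) : Prop :=
  ∀ x : Fin n → ℝ, (∀ j, |x j| < r) → HasSum (fun k => c k * ∏ j, (x j : ℂ) ^ k j) (f x)

/-- `f(z) = ∑ c_k z^k` on the disc of radius `r`. -/
def IsDiscSeries (c : ℕ → ℂ) (r : ℝ) (f : ℂ → ℂ) : Prop :=
  ∀ z : ℂ, ‖z‖ < r → HasSum (fun k => c k * z ^ k) (f z)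

/-- `f(X) = ∑ c_k X_1^{k_1} ⋯ X_n^{k_n}`, with the product in this order. -/
def opSeries (c : (Fin n → ℕ) → ℂ) (X : Fin n → H →L[ℂ] H) : H →L[ℂ] H :=
  ∑' k : Fin n → ℕ, c k • (List.ofFn fun j => X j ^ k j).prod

/-- `f(X) = ∑ c_k X^k`. -/
def opSeriesOne (c : ℕ → ℂ) (X : H →L[ℂ] H) : H →L[ℂ] H :=
  ∑' k : ℕ, c k • X ^ k

/-- For a path `F` of operators: `F'(0)` exists in the operator norm, the Taylor remainder
`F(1) - F(0) - F'(0)` belongs to `I`, and its trace is `t`. -/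
def RemainderTraceEq (I : NormedIdeal H) (τ : I.carrier →ₗ[ℂ] ℂ) (F : ℝ → H →L[ℂ] H) (t : ℂ) :
    Prop :=
  ∃ D : H →L[ℂ] H, HasDerivAt F D 0 ∧ F 1 - F 0 - D ∈ I.carrier ∧ I.tr τ (F 1 - F 0 - D) = t

/-- The second partial derivative `∂²f / ∂z_i ∂z_j` over `𝕜 = ℝ` or `ℂ`. -/
def pderivTwo (𝕜 : Type*) [NontriviallyNormedField 𝕜] [NormedSpace 𝕜 ℂ] (i j : Fin n)
    (f : (Fin n → 𝕜) → ℂ) (z : Fin n → 𝕜) : ℂ :=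
  lineDeriv 𝕜 (fun w => lineDeriv 𝕜 f w (Pi.single j 1)) z (Pi.single i 1)

/-- Integral of a complex function against a complex measure. -/
def cintegral {X : Type*} [MeasurableSpace X] (ν : ComplexMeasure X) (g : X → ℂ) : ℂ :=
  VectorMeasure.integral ν g (ContinuousLinearMap.mul ℝ ℂ)

/-- Integral of a complex function against a signed measure. -/
def sintegral {X : Type*} [MeasurableSpace X] (ν : SignedMeasure X) (g : X → ℂ) : ℂ :=
  VectorMeasure.integral ν g (ContinuousLinearMap.lsmul ℝ ℝ).flip

/-- `ν` is a second-order trace formula measure on `𝕋` for the pair of contractions `(A, B)`: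
`‖ν‖ ≤ ½ τ(|V|²)` and `τ(f(B) - f(A) - d/ds|₀ f(A + sV)) = ∫ f'' dν`, with `V = B - A`,
for every `f` analytic on a disc of radius greater than one. -/
def IsPairMeasure (I : NormedIdeal H) (τ : I.carrier →ₗ[ℂ] ℂ) (A B : H →L[ℂ] H)
    (ν : ComplexMeasure UnitCirc) : Prop :=
  ν.variation Set.univ ≤ ENNReal.ofReal (1 / 2 * I.trSq τ (B - A)) ∧
  ∀ ε : ℝ, 0 < ε → ∀ (c : ℕ → ℂ) (f : ℂ → ℂ), IsDiscSeries c (1 + ε) f →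
    RemainderTraceEq I τ (fun s => opSeriesOne c (A + s • (B - A)))
      (cintegral ν fun z => deriv (deriv f) z)

end Tuples

end

/-! Let `T` be a linear extension of `τ` to all of `B(H)`, write `‖V‖₂² = T(V* V)`, and let `Av F
(λ, μ) = ∫₀¹ F(μ + t(λ - μ)) dt`. A polynomial in `(λ, μ)` acts on an operator `V` by letting `λ`
multiply on the left and `μ` on the right (`biAeval`); write `Θ_s(φ)V` when both tuples are `X(s)`.
The fundamental theorem of calculus on a segment gives `f(X) - f(Y) = ∑ᵢ (Av ∂ᵢf)(Xᵢ - Yᵢ)`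
(`commAeval_sub`), so the derivative of `f(X(s))` is `∑ⱼ Θ_s(Av ∂ⱼf)Vⱼ`. On differentiating its
trace, cyclicity lets the left and right factors merge (`hasDerivAt_T_biAeval`); since `Av F`
restricts to `F` on the diagonal, the second derivative is `∑ T(Vⱼ Θ_s(Av ∂ᵢ∂ⱼf)Vᵢ)`. Taylor's
formula turns the trace of the remainder into `∑ Lᵢⱼ(∂ᵢ∂ⱼf)`, where `Lᵢⱼ(F) = ∫₀¹ (1 - s) T(Vⱼ
Θ_s(Av F)Vᵢ) ds` (`taylorFunctional`).

The crux is `|Lᵢⱼ(F)| ≤ ½ ‖Vᵢ‖₂ ‖Vⱼ‖₂ sup |F|`. A normal dilation together with Gelfand theory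
approximates `p(X(s))` by `∑ p(x_r) P_r`, with `P_r ≥ 0`, `∑ P_r = 1` and nodes `x_r` in the
polydisc. Then `T(Vⱼ Θ_s(φ)Vᵢ)` is close to `∑ φ(x_r, x_q) T(Vⱼ P_r Vᵢ P_q)`, and two applications
of Cauchy-Schwarz bound the sum of the `|T(Vⱼ P_r Vᵢ P_q)|` by `‖Vᵢ‖₂ ‖Vⱼ‖₂`
(`sum_norm_T_sandwich_le`). Convexity shows that averaging does not increase the supremum, the
maximum principle moves it to the torus, and `½` is `∫₀¹ (1 - s) ds`. Hahn-Banach and Riesz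
representation then produce the measures; the total mass is `Lᵢⱼ(1)`. For self-adjoint tuples the
nodes are real and `Lᵢⱼ` is real on real polynomials, so real measures on the cube suffice.

Power series are summed term by term: the remainder of a word of length `m` lies in the ideal with
norm `O(m²)` (`word_remainder_mem`), and the ideal is complete. For the diagonal statement, every
`g` analytic on the disc is some `h''`, so `ν_jj` and any one-variable measure `ν` integrate `g` to
the same trace. -/

set_option linter.unusedSectionVars false

noncomputable section

/-! ### The total variation of a functional on `C(K, ℂ)`, and Hahn-Banach. -/

section Riesz

open scoped NNReal ENNReal

variable {K : Type*} [TopologicalSpace K] [CompactSpace K]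

/-- The absolute value `|L|(f) = sup {|L g| : |g| ≤ f}` of a functional on `C(K, ℂ)`. -/
def functionalAbs (L : C(K, ℂ) →L[ℂ] ℂ) (f : C(K, ℝ≥0)) : ℝ≥0 :=
  sSup ((fun g : C(K, ℂ) => ‖L g‖₊) '' {g | ∀ x, ‖g x‖₊ ≤ f x})

theorem functionalAbs_bddAbove (L : C(K, ℂ) →L[ℂ] ℂ) (f : C(K, ℝ≥0)) :
    BddAbove ((fun g : C(K, ℂ) => ‖L g‖₊) '' {g | ∀ x, ‖g x‖₊ ≤ f x}) := by
  obtain ⟨C, hC⟩ := (isCompact_range f.continuous).bddAbove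
  refine ⟨‖L‖₊ * C, ?_⟩
  rintro _ ⟨g, hg, rfl⟩
  refine (L.le_opNNNorm g).trans ?_
  gcongr
  have : ‖g‖ ≤ C := (ContinuousMap.norm_le _ C.2).2 fun x =>
    (NNReal.coe_le_coe.2 ((hg x).trans (hC ⟨x, rfl⟩)))
  exact_mod_cast this

theorem nnnorm_le_functionalAbs (L : C(K, ℂ) →L[ℂ] ℂ) {f : C(K, ℝ≥0)} {g : C(K, ℂ)}
    (h : ∀ x, ‖g x‖₊ ≤ f x) : ‖L g‖₊ ≤ functionalAbs L f :=
  le_csSup (functionalAbs_bddAbove L f) ⟨g, h, rfl⟩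

theorem functionalAbs_le (L : C(K, ℂ) →L[ℂ] ℂ) {f : C(K, ℝ≥0)} {c : ℝ≥0}
    (h : ∀ g : C(K, ℂ), (∀ x, ‖g x‖₊ ≤ f x) → ‖L g‖₊ ≤ c) : functionalAbs L f ≤ c :=
  csSup_le ⟨_, 0, fun x => by simp, rfl⟩ (by rintro _ ⟨g, hg, rfl⟩; exact h g hg)

theorem functionalAbs_smul_le (L : C(K, ℂ) →L[ℂ] ℂ) (c : ℝ≥0) (hc : c ≠ 0) (f : C(K, ℝ≥0)) :
    c * functionalAbs L f ≤ functionalAbs L (c • f) := by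
  rw [← le_inv_mul_iff₀ (pos_of_ne_zero hc)]
  refine functionalAbs_le L fun g hg => ?_
  rw [le_inv_mul_iff₀ (pos_of_ne_zero hc)]
  have := nnnorm_le_functionalAbs L (f := c • f) (g := (c : ℂ) • g) (fun x => by
    simpa using mul_le_mul_right (hg x) c)
  simpa using this

theorem functionalAbs_smul (L : C(K, ℂ) →L[ℂ] ℂ) (c : ℝ≥0) (f : C(K, ℝ≥0)) :
    functionalAbs L (c • f) = c * functionalAbs L f := by
  rcases eq_or_ne c 0 with rfl | hc
  · refine le_antisymm (functionalAbs_le L fun g hg => ?_) (by simp)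
    have : g = 0 := by
      ext x
      simpa using hg x
    simp [this]
  · refine le_antisymm ?_ (functionalAbs_smul_le L c hc f)
    have := functionalAbs_smul_le L c⁻¹ (inv_ne_zero hc) (c • f)
    rw [smul_smul, inv_mul_cancel₀ hc, one_smul] at this
    rwa [inv_mul_le_iff₀ (pos_of_ne_zero hc)] at this

theorem exists_phase (z : ℂ) : ∃ c : ℂ, ‖c‖ ≤ 1 ∧ c * z = ‖z‖ := by
  rcases eq_or_ne z 0 with rfl | hz
  · exact ⟨0, by simp, by simp⟩
  · refine ⟨(starRingEnd ℂ z) / ‖z‖, ?_, ?_⟩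
    · simp [hz]
    · have : (‖z‖ : ℂ) ≠ 0 := by simpa using hz
      field_simp
      rw [Complex.conj_mul']

/-- Subadditivity: split `g` in the proportions `f₁/(f₁ + f₂)` and `f₂/(f₁ + f₂)`. Superadditivity:
rotate `g₁` and `g₂` by phases so that both values of `L` are nonnegative and add up without
cancellation. -/
theorem functionalAbs_add (L : C(K, ℂ) →L[ℂ] ℂ) (f₁ f₂ : C(K, ℝ≥0)) :
    functionalAbs L (f₁ + f₂) = functionalAbs L f₁ + functionalAbs L f₂ := by
  apply le_antisymm
  · refine functionalAbs_le L fun g hg => ?_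
    have key : ∀ f f' : C(K, ℝ≥0), (∀ x, ‖g x‖₊ ≤ f x + f' x) →
        Continuous fun x => g x * (((f x / (f x + f' x) : ℝ≥0) : ℝ) : ℂ) := by
      intro f f' hg
      rw [continuous_iff_continuousAt]
      intro x
      by_cases hx : f x + f' x = 0
      -- Where `f + f'` vanishes so does `g`, and the quotient never exceeds 1, so the product is
      -- squeezed to 0.
      · have h0 : g x = 0 := by simpa [hx] using hg x
        have : Filter.Tendsto (fun y => g y * (((f y / (f y + f' y) : ℝ≥0) : ℝ) : ℂ))
            (nhds x) (nhds 0) := by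
          refine squeeze_zero_norm (a := fun y => ‖g y‖) (fun y => ?_) ?_
          · rw [norm_mul]
            refine mul_le_of_le_one_right (norm_nonneg _) ?_
            rw [Complex.norm_real, NNReal.norm_eq]
            exact_mod_cast div_le_one_of_le₀ (by simp) (by simp)
          · simpa [h0] using g.continuous.norm.tendsto x
        simpa [ContinuousAt, h0] using this
      · refine ContinuousAt.mul g.continuous.continuousAt ?_
        refine Complex.continuous_ofReal.continuousAt.comp
          (NNReal.continuous_coe.continuousAt.comp ?_)
        exact ContinuousAt.div₀ f.continuous.continuousAt
          (f.continuous.add f'.continuous).continuousAt hx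
    have bound : ∀ (f f' : C(K, ℝ≥0)), (∀ x, ‖g x‖₊ ≤ f x + f' x) → ∀ x,
        ‖g x * (((f x / (f x + f' x) : ℝ≥0) : ℝ) : ℂ)‖₊ ≤ f x := by
      intro f f' hg x
      rw [nnnorm_mul, Complex.nnnorm_real, NNReal.nnnorm_eq]
      by_cases hx : f x + f' x = 0
      · simp [hx]
      · calc _ ≤ (f x + f' x) * (f x / (f x + f' x)) := by gcongr; exact hg x
          _ = f x := mul_div_cancel₀ _ hx
    have h1 : ∀ x, ‖g x‖₊ ≤ f₁ x + f₂ x := hg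
    have h2 : ∀ x, ‖g x‖₊ ≤ f₂ x + f₁ x := fun x => by rw [add_comm]; exact hg x
    let g₁ : C(K, ℂ) := ⟨_, key f₁ f₂ h1⟩
    let g₂ : C(K, ℂ) := ⟨_, key f₂ f₁ h2⟩
    have hsum : g = g₁ + g₂ := by
      ext x
      simp only [ContinuousMap.add_apply, ContinuousMap.coe_mk, g₁, g₂]
      by_cases hx : f₁ x + f₂ x = 0
      · have : g x = 0 := by simpa [hx] using h1 x
        simp [this]
      · rw [← mul_add, ← Complex.ofReal_add, ← NNReal.coe_add, add_comm (f₂ x), ← add_div,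
          div_self hx]
        simp
    rw [hsum, map_add]
    refine (nnnorm_add_le _ _).trans (add_le_add ?_ ?_)
    · exact nnnorm_le_functionalAbs L (bound f₁ f₂ h1)
    · exact nnnorm_le_functionalAbs L (bound f₂ f₁ h2)
  · have key : ∀ g₁ g₂ : C(K, ℂ), (∀ x, ‖g₁ x‖₊ ≤ f₁ x) → (∀ x, ‖g₂ x‖₊ ≤ f₂ x) →
        ‖L g₁‖₊ + ‖L g₂‖₊ ≤ functionalAbs L (f₁ + f₂) := by
      intro g₁ g₂ h₁ h₂
      obtain ⟨c₁, hc₁, e₁⟩ := exists_phase (L g₁)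
      obtain ⟨c₂, hc₂, e₂⟩ := exists_phase (L g₂)
      have := nnnorm_le_functionalAbs L (f := f₁ + f₂) (g := c₁ • g₁ + c₂ • g₂) (fun x => by
        refine (nnnorm_add_le _ _).trans (add_le_add ?_ ?_)
        · refine le_trans ?_ (h₁ x)
          simpa using mul_le_of_le_one_left (by simp) (by exact_mod_cast hc₁)
        · refine le_trans ?_ (h₂ x)
          simpa using mul_le_of_le_one_left (by simp) (by exact_mod_cast hc₂))
      rw [map_add, map_smul, map_smul, smul_eq_mul, smul_eq_mul, e₁, e₂] at this
      rw [← NNReal.coe_le_coe] at this ⊢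
      rw [coe_nnnorm, ← Complex.ofReal_add, Complex.norm_real, Real.norm_of_nonneg (by positivity)]
        at this
      simpa using this
    have h2 : functionalAbs L f₂ ≤ functionalAbs L (f₁ + f₂) :=
      functionalAbs_le L fun g hg => by simpa using key 0 g (by simp) hg
    refine add_le_of_le_tsub_right_of_le h2 (functionalAbs_le L fun g₁ h₁ => ?_)
    refine le_tsub_of_add_le_right (add_le_of_le_tsub_left_of_le ?_ ?_)
    · simpa using key g₁ 0 h₁ (by simp)
    · exact functionalAbs_le L fun g₂ h₂ => le_tsub_of_add_le_left (key g₁ g₂ h₁ h₂)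

/-- A bounded functional on `C(K, ℂ)` is dominated by a finite positive measure of mass at most
its norm. -/
theorem exists_dominating_measure [T2Space K] [MeasurableSpace K] [BorelSpace K]
    (L : C(K, ℂ) →L[ℂ] ℂ) :
    ∃ μ : Measure K, IsFiniteMeasure μ ∧ μ.Regular ∧ μ Set.univ ≤ ENNReal.ofReal ‖L‖ ∧
      ∀ g : C(K, ℂ), ‖L g‖ ≤ ∫ x, ‖g x‖ ∂μ := by
  let Λ : CompactlySupportedContinuousMap K ℝ≥0 →ₗ[ℝ≥0] ℝ≥0 :=
    { toFun := fun f => functionalAbs L f.toContinuousMap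
      map_add' := fun f g => functionalAbs_add L _ _
      map_smul' := fun c f => functionalAbs_smul L c _ }
  have huniv : NNRealRMK.rieszMeasure Λ Set.univ ≤ ENNReal.ofReal ‖L‖ := by
    have := NNRealRMK.lintegral_rieszMeasure Λ
      (CompactlySupportedContinuousMap.continuousMapEquiv 1)
    simp only [CompactlySupportedContinuousMap.continuousMapEquiv_apply_toFun,
      ContinuousMap.one_apply, ENNReal.coe_one, lintegral_one] at this
    rw [this, ← ENNReal.ofReal_coe_nnreal]
    apply ENNReal.ofReal_le_ofReal
    have h : functionalAbs L 1 ≤ ‖L‖₊ := functionalAbs_le L fun g hg => by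
      refine (L.le_opNNNorm g).trans (mul_le_of_le_one_right (by simp) ?_)
      have : ‖g‖ ≤ 1 := (ContinuousMap.norm_le _ zero_le_one).2 fun x => by exact_mod_cast hg x
      exact_mod_cast this
    exact_mod_cast h
  refine ⟨NNRealRMK.rieszMeasure Λ, ⟨huniv.trans_lt (by simp)⟩, inferInstance, huniv,
    fun g => ?_⟩
  have := NNRealRMK.integral_rieszMeasure Λ
    (CompactlySupportedContinuousMap.continuousMapEquiv ⟨fun x => ‖g x‖₊, by fun_prop⟩)
  simp only [CompactlySupportedContinuousMap.continuousMapEquiv_apply_toFun,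
    ContinuousMap.coe_mk, coe_nnnorm] at this
  rw [this]
  exact_mod_cast nnnorm_le_functionalAbs L (g := g) fun x => le_rfl

/-- A linear functional dominated by the norm of a linear map factors through it by a bounded
functional. -/
theorem exists_dual_factor {V E : Type*} [AddCommGroup V] [Module ℂ V] [NormedAddCommGroup E]
    [NormedSpace ℂ E] (T : V →ₗ[ℂ] E) (ℓ : V →ₗ[ℂ] ℂ) (M : ℝ) (hM : 0 ≤ M)
    (h : ∀ v, ‖ℓ v‖ ≤ M * ‖T v‖) : ∃ L : E →L[ℂ] ℂ, ‖L‖ ≤ M ∧ ∀ v, L (T v) = ℓ v := by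
  have hker : LinearMap.ker T ≤ LinearMap.ker ℓ := fun v hv => by
    rw [LinearMap.mem_ker] at hv ⊢
    simpa [hv] using h v
  let f₀ : LinearMap.range T →ₗ[ℂ] ℂ :=
    ((LinearMap.ker T).liftQ ℓ hker).comp T.quotKerEquivRange.symm.toLinearMap
  have hf₀ : ∀ v, f₀ ⟨T v, ⟨v, rfl⟩⟩ = ℓ v := fun v => by
    have : T.quotKerEquivRange.symm ⟨T v, ⟨v, rfl⟩⟩ = (LinearMap.ker T).mkQ v := by
      rw [LinearEquiv.symm_apply_eq]; rfl
    simp [f₀, this]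
  let f : LinearMap.range T →L[ℂ] ℂ := f₀.mkContinuous M (by
    rintro ⟨_, v, rfl⟩
    rw [hf₀]
    exact h v)
  obtain ⟨L, hL, hn⟩ := exists_extension_norm_eq _ f
  refine ⟨L, hn.le.trans (LinearMap.mkContinuous_norm_le _ hM _), fun v => ?_⟩
  exact (hL ⟨T v, ⟨v, rfl⟩⟩).trans (hf₀ v)

end Riesz

/-! ### Densities with respect to the dominating measure. -/

section RieszDensity

open scoped NNReal ENNReal

variable {K : Type*}

theorem integral_norm_le_mul_norm_L2 [MeasurableSpace K] (μ : Measure K) [IsFiniteMeasure μ]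
    (u : Lp ℂ 2 μ) : ∫ x, ‖u x‖ ∂μ ≤ (μ Set.univ ^ (1 / 2 : ℝ)).toReal * ‖u‖ := by
  rw [integral_norm_eq_lintegral_enorm (Lp.aestronglyMeasurable u), Lp.norm_def,
    ← ENNReal.toReal_mul]
  refine ENNReal.toReal_mono ?_ ?_
  · exact ENNReal.mul_ne_top (by simp [ENNReal.rpow_eq_top_iff]) (Lp.eLpNorm_ne_top u)
  · rw [← eLpNorm_one_eq_lintegral_enorm, mul_comm]
    refine (eLpNorm_le_eLpNorm_mul_rpow_measure_univ (p := 1) (q := 2) (by norm_num)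
      (Lp.aestronglyMeasurable u)).trans_eq ?_
    norm_num

theorem integrable_of_L2 [MeasurableSpace K] (μ : Measure K) [IsFiniteMeasure μ]
    (u : Lp ℂ 2 μ) : Integrable u μ :=
  (Lp.memLp u).integrable (by norm_num)

theorem continuous_integral_norm_L2 [MeasurableSpace K] (μ : Measure K) [IsFiniteMeasure μ] :
    Continuous fun u : Lp ℂ 2 μ => ∫ x, ‖u x‖ ∂μ := by
  refine (LipschitzWith.of_dist_le_mul
    (K := (μ Set.univ ^ (1 / 2 : ℝ)).toNNReal) fun u v => ?_).continuous
  rw [dist_eq_norm u v]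
  refine le_trans ?_ (integral_norm_le_mul_norm_L2 μ (u - v))
  rw [Real.dist_eq, ← integral_sub (integrable_of_L2 μ u).norm (integrable_of_L2 μ v).norm]
  refine abs_integral_le_integral_abs.trans ?_
  refine integral_mono_ae ((integrable_of_L2 μ u).norm.sub (integrable_of_L2 μ v).norm).abs
    (integrable_of_L2 μ _).norm ?_
  filter_upwards [Lp.coeFn_sub u v] with x hx
  rw [hx]
  exact abs_norm_sub_norm_le _ _

/-- Testing against the phase `k/|k|` on `S = {|k| > 1}` gives `∫_S |k| ≤ μ(S)`, which is impossible
unless `S` is null. -/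
theorem ae_norm_le_one_of_inner_le [MeasurableSpace K] (μ : Measure K) [IsFiniteMeasure μ]
    (k : Lp ℂ 2 μ) (hk : ∀ u : Lp ℂ 2 μ, ‖(inner ℂ k u : ℂ)‖ ≤ ∫ x, ‖u x‖ ∂μ) :
    ∀ᵐ x ∂μ, ‖k x‖ ≤ 1 := by
  set S : Set K := {x | 1 < ‖k x‖} with hS
  have hkm : StronglyMeasurable k := Lp.stronglyMeasurable k
  have hSm : MeasurableSet S := measurableSet_lt measurable_const hkm.norm.measurable
  have hu : MemLp (S.indicator fun x => k x / (‖k x‖ : ℂ)) 2 μ := by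
    refine MemLp.of_bound (C := 1) ?_ ?_
    · refine (StronglyMeasurable.indicator ?_ hSm).aestronglyMeasurable
      exact (hkm.measurable.div
        (Complex.measurable_ofReal.comp hkm.norm.measurable)).stronglyMeasurable
    · refine Filter.Eventually.of_forall fun x => ?_
      by_cases hx : x ∈ S
      · simp only [hx, Set.indicator_of_mem, norm_div, Complex.norm_real, norm_norm]
        exact div_self_le_one _
      · simp [hx]
  have h1 : (inner ℂ k (hu.toLp _) : ℂ) = ((∫ x in S, ‖k x‖ ∂μ : ℝ) : ℂ) := by
    rw [L2.inner_def, ← integral_indicator hSm, ← integral_complex_ofReal]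
    refine integral_congr_ae ?_
    filter_upwards [hu.coeFn_toLp] with x hx
    rw [hx]
    by_cases hxS : x ∈ S
    · have hne : (‖k x‖ : ℂ) ≠ 0 := by
        have : (1 : ℝ) < ‖k x‖ := hxS
        exact_mod_cast (by linarith : (0 : ℝ) < ‖k x‖).ne'
      simp only [hxS, Set.indicator_of_mem, RCLike.inner_apply]
      rw [div_mul_eq_mul_div, Complex.mul_conj', div_eq_iff hne, sq]
    · simp [hxS]
  have h2 : ∫ x, ‖(hu.toLp _) x‖ ∂μ = μ.real S := by
    rw [← integral_indicator_one hSm]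
    refine integral_congr_ae ?_
    filter_upwards [hu.coeFn_toLp] with x hx
    rw [hx]
    by_cases hxS : x ∈ S
    · have : (1 : ℝ) < ‖k x‖ := hxS
      have hne : ‖k x‖ ≠ 0 := by linarith
      simp [hxS, hne]
    · simp [hxS]
  have h3 := hk (hu.toLp _)
  rw [h1, h2, Complex.norm_real, Real.norm_of_nonneg (integral_nonneg fun x => norm_nonneg _)] at h3
  have h0 : μ S = 0 := by
    by_contra h
    have := setIntegral_gt_gt (f := fun x => ‖k x‖) (μ := μ) zero_le_one
      (integrable_of_L2 μ k).norm.integrableOn h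
    rw [mul_one] at this
    exact absurd this (not_lt.2 h3)
  rw [ae_iff]
  simpa [hS] using h0

variable [TopologicalSpace K] [CompactSpace K]

/-- A functional on `C(K, ℂ)` dominated by the `L¹`-norm of a finite measure has a density. -/
theorem exists_density [T2Space K] [MeasurableSpace K] [BorelSpace K]
    (L : C(K, ℂ) →L[ℂ] ℂ) (μ : Measure K) [IsFiniteMeasure μ] [μ.Regular]
    (hL : ∀ g : C(K, ℂ), ‖L g‖ ≤ ∫ x, ‖g x‖ ∂μ) :
    ∃ h : K → ℂ, Measurable h ∧ (∀ x, ‖h x‖ ≤ 1) ∧ ∀ g : C(K, ℂ), L g = ∫ x, g x * h x ∂μ := by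
  let T : C(K, ℂ) →L[ℂ] Lp ℂ 2 μ := ContinuousMap.toLp 2 μ ℂ
  have hT : ∀ g : C(K, ℂ), T g =ᵐ[μ] g := fun g => ContinuousMap.coeFn_toLp μ g
  have hLT : ∀ g, ‖L g‖ ≤ ∫ x, ‖T g x‖ ∂μ := fun g => (hL g).trans_eq (integral_congr_ae (by
    filter_upwards [hT g] with x hx
    rw [hx]))
  -- The `L¹` bound implies an `L²` bound because `μ` is finite. Thus `L` factors through `L²(μ)`,
  -- where the Hilbert space form of Riesz representation applies.
  obtain ⟨L₂, -, hL₂⟩ := exists_dual_factor T.toLinearMap L.toLinearMap _ ENNReal.toReal_nonneg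
    fun g => (hLT g).trans (integral_norm_le_mul_norm_L2 μ (T g))
  have hbound : ∀ u : Lp ℂ 2 μ, ‖L₂ u‖ ≤ ∫ x, ‖u x‖ ∂μ := by
    have hcl : IsClosed {u : Lp ℂ 2 μ | ‖L₂ u‖ ≤ ∫ x, ‖u x‖ ∂μ} :=
      isClosed_le L₂.continuous.norm (continuous_integral_norm_L2 μ)
    have hd : DenseRange T := ContinuousMap.toLp_denseRange ℂ μ ℂ (by norm_num)
    exact fun u => hd.induction_on u hcl fun g => by
      have := hLT g
      rwa [← ContinuousLinearMap.coe_coe L, ← hL₂ g] at this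
  set k := (InnerProductSpace.toDual ℂ (Lp ℂ 2 μ)).symm L₂ with hk
  have hkL : ∀ u, (inner ℂ k u : ℂ) = L₂ u := fun u => InnerProductSpace.toDual_symm_apply
  have hk1 := ae_norm_le_one_of_inner_le μ k fun u => by rw [hkL]; exact hbound u
  have hkm : StronglyMeasurable k := Lp.stronglyMeasurable k
  have hSm : MeasurableSet {x | ‖k x‖ ≤ 1} := measurableSet_le hkm.norm.measurable measurable_const
  -- The inner product is conjugate-linear in its first slot, hence the conjugate; cutting off on a
  -- null set makes the bound hold everywhere.
  refine ⟨{x | ‖k x‖ ≤ 1}.indicator fun x => starRingEnd ℂ (k x), ?_, fun x => ?_, fun g => ?_⟩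
  · exact Measurable.indicator (Complex.continuous_conj.measurable.comp hkm.measurable) hSm
  · by_cases hx : ‖k x‖ ≤ 1 <;> simp [hx]
  · have : L g = L₂ (T g) := (hL₂ g).symm
    rw [this, ← hkL, L2.inner_def]
    refine integral_congr_ae ?_
    filter_upwards [hT g, hk1] with x hx hx1
    simp [hx, hx1, RCLike.inner_apply]

/-- Since `|h| ≤ 1`, the variation is at most `μ`, so both sides are continuous in `g ∈ L¹(μ)`; they
agree on indicators. -/
theorem integral_withDensity_of_bounded [MeasurableSpace K] (μ : Measure K) [IsFiniteMeasure μ]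
    {F : Type*} [NormedAddCommGroup F] [NormedSpace ℝ F] [CompleteSpace F]
    (B : ℂ →L[ℝ] F →L[ℝ] ℂ)
    {h : K → F} (hm : StronglyMeasurable h) (h1 : ∀ x, ‖h x‖ ≤ 1) {g : K → ℂ}
    (hg : Integrable g μ) :
    (μ.withDensityᵥ h).integral g B = ∫ x, B (g x) (h x) ∂μ := by
  have hint : Integrable h μ := Integrable.of_bound hm.aestronglyMeasurable 1
    (Filter.Eventually.of_forall h1)
  have hvar : (μ.withDensityᵥ h).variation ≤ (1 : ℝ≥0∞) • μ := by
    rw [Measure.variation_withDensityᵥ hint, one_smul]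
    refine (withDensity_mono (g := fun _ => 1) (Filter.Eventually.of_forall fun x => ?_)).trans_eq
      (by simp)
    simpa [← ofReal_norm] using h1 x
  have hD : DominatedFinMeasAdditive μ ((μ.withDensityᵥ h).transpose B) ‖B‖ := by
    refine ⟨fun s t hs ht _ _ hst => cbmApplyMeasure_union _ B hs ht hst, fun s hs hsf => ?_⟩
    refine (norm_cbmApplyMeasure_le _ B s).trans ?_
    gcongr
    rw [withDensityᵥ_apply hint hs]
    simpa using norm_setIntegral_le_of_norm_le_const (C := 1) hsf (fun x _ => h1 x)
  have hbil : ∀ f : K → ℂ, Integrable f μ → Integrable (fun x => B (f x) (h x)) μ := by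
    intro f hf
    refine (hf.norm.const_mul ‖B‖).mono'
      (B.aestronglyMeasurable_comp₂ hf.aestronglyMeasurable hm.aestronglyMeasurable) ?_
    refine Filter.Eventually.of_forall fun x => (B.le_opNorm₂ _ _).trans ?_
    exact mul_le_of_le_one_right (by positivity) (h1 x)
  rw [VectorMeasure.integral_eq_setToFun,
    ← setToFun_congr_measure_of_integrable 1 (by simp) hvar hD _ g hg]
  refine Integrable.induction (P := fun g => setToFun μ _ hD g = ∫ x, B (g x) (h x) ∂μ)
    ?_ ?_ ?_ ?_ hg
  · intro c s hs hsf
    rw [setToFun_indicator_const hD hs hsf.ne]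
    change B c (μ.withDensityᵥ h s) = _
    rw [withDensityᵥ_apply hint hs, ← ContinuousLinearMap.integral_comp_comm _ hint.integrableOn,
      ← integral_indicator hs]
    congr 1
    ext x
    by_cases hx : x ∈ s <;> simp [hx]
  · intro f f' _ hf hf' e e'
    have h2 : setToFun μ _ hD (f + f') = _ := setToFun_add hD hf hf'
    rw [h2, e, e', ← integral_add (hbil f hf) (hbil f' hf')]
    simp
  · refine isClosed_eq (continuous_setToFun hD) ?_
    refine (LipschitzWith.of_dist_le_mul (K := ‖B‖₊) fun u v => ?_).continuous
    rw [dist_eq_norm, ← integral_sub (hbil _ (L1.integrable_coeFn u))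
      (hbil _ (L1.integrable_coeFn v)), dist_eq_norm, L1.norm_eq_integral_norm, coe_nnnorm,
      ← integral_const_mul]
    refine norm_integral_le_of_norm_le ((L1.integrable_coeFn (u - v)).norm.const_mul _) ?_
    filter_upwards [Lp.coeFn_sub u v] with x hx
    rw [hx, Pi.sub_apply, ← sub_apply, ← map_sub]
    refine (B.le_opNorm₂ _ _).trans ?_
    exact mul_le_of_le_one_right (by positivity) (h1 x)
  · intro f f' hff hf e
    rw [← setToFun_congr_ae hD hff, e]
    refine integral_congr_ae ?_
    filter_upwards [hff] with x hx
    rw [hx]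

end RieszDensity

/-! ### Complex and signed representing measures. -/

section RieszMeasures

open scoped NNReal ENNReal

variable {K : Type*}

theorem variation_withDensityᵥ_univ_le [MeasurableSpace K] (μ : Measure K) [IsFiniteMeasure μ]
    {F : Type*} [NormedAddCommGroup F] [NormedSpace ℝ F] [CompleteSpace F]
    {h : K → F} (hm : StronglyMeasurable h) (h1 : ∀ x, ‖h x‖ ≤ 1) :
    (μ.withDensityᵥ h).variation Set.univ ≤ μ Set.univ := by
  have hint : Integrable h μ := Integrable.of_bound hm.aestronglyMeasurable 1
    (Filter.Eventually.of_forall h1)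
  rw [Measure.variation_withDensityᵥ hint]
  refine (withDensity_mono (g := fun _ => 1)
    (Filter.Eventually.of_forall fun x => ?_) Set.univ).trans_eq (by simp)
  simpa [← ofReal_norm] using h1 x

theorem hasSum_vectorMeasure_integral [MeasurableSpace K] {F : Type*} [NormedAddCommGroup F]
    [NormedSpace ℝ F] (ν : VectorMeasure K F) (hν : ν.variation Set.univ ≠ ∞)
    (B : ℂ →L[ℝ] F →L[ℝ] ℂ) {ι : Type*} [Countable ι] {g : ι → K → ℂ} {g₀ : K → ℂ} {u : ι → ℝ}
    (hu : Summable u) (hm : ∀ k, StronglyMeasurable (g k)) (hb : ∀ k x, ‖g k x‖ ≤ u k)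
    (hs : ∀ x, HasSum (fun k => g k x) (g₀ x)) :
    HasSum (fun k => ν.integral (g k) B) (ν.integral g₀ B) := by
  have : IsFiniteMeasure ν.variation := ⟨lt_top_iff_ne_top.2 hν⟩
  exact VectorMeasure.hasSum_integral_of_dominated_convergence (fun k _ => u k)
    (fun k => (hm k).aestronglyMeasurable) (fun k => Filter.Eventually.of_forall (hb k))
    (Filter.Eventually.of_forall fun _ => hu) (integrable_const _)
    (Filter.Eventually.of_forall hs)

theorem vectorMeasure_integral_const_mul [MeasurableSpace K] {F : Type*} [NormedAddCommGroup F]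
    [NormedSpace ℝ F] (ν : VectorMeasure K F) (B : ℂ →L[ℝ] F →L[ℝ] ℂ)
    (hB : ∀ c x y, B (c * x) y = c * B x y) (c : ℂ) (g : K → ℂ) :
    ν.integral (fun x => c * g x) B = c * ν.integral g B :=
  setToFun_smul _ (fun c s x => hB c x (ν s)) c g

theorem sintegral_const_mul [MeasurableSpace K] (ν : SignedMeasure K) (c : ℂ) (g : K → ℂ) :
    sintegral ν (fun x => c * g x) = c * sintegral ν g :=
  vectorMeasure_integral_const_mul ν _ (fun c x y => by simp; ring) c g

theorem cintegral_one [MeasurableSpace K] (ν : ComplexMeasure K)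
    (hν : ν.variation Set.univ ≠ ∞) : cintegral ν (fun _ => 1) = ν Set.univ := by
  have : IsFiniteMeasure ν.variation := ⟨lt_top_iff_ne_top.2 hν⟩
  rw [cintegral, VectorMeasure.integral_const]
  simp

theorem sintegral_one [MeasurableSpace K] (ν : SignedMeasure K)
    (hν : ν.variation Set.univ ≠ ∞) : sintegral ν (fun _ => 1) = ν Set.univ := by
  have : IsFiniteMeasure ν.variation := ⟨lt_top_iff_ne_top.2 hν⟩
  rw [sintegral, VectorMeasure.integral_const]
  simp

variable [TopologicalSpace K] [CompactSpace K] [T2Space K] [MeasurableSpace K] [BorelSpace K]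

theorem exists_measure_density {V : Type*} [AddCommGroup V] [Module ℂ V] (T : V →ₗ[ℂ] C(K, ℂ))
    (ℓ : V →ₗ[ℂ] ℂ) (M : ℝ) (hM : 0 ≤ M) (h : ∀ v, ‖ℓ v‖ ≤ M * ‖T v‖) :
    ∃ (μ : Measure K) (_ : IsFiniteMeasure μ) (h : K → ℂ), μ Set.univ ≤ ENNReal.ofReal M ∧
      Measurable h ∧ (∀ x, ‖h x‖ ≤ 1) ∧ ∀ v, ℓ v = ∫ x, T v x * h x ∂μ := by
  obtain ⟨L, hLM, hL⟩ := exists_dual_factor T ℓ M hM h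
  obtain ⟨μ, _, _, hμ, hd⟩ := exists_dominating_measure L
  obtain ⟨h, hm, h1, hh⟩ := exists_density L μ hd
  exact ⟨μ, inferInstance, h, hμ.trans (ENNReal.ofReal_le_ofReal hLM), hm, h1,
    fun v => by rw [← hL, hh]⟩

/-- Riesz representation of a bounded functional by a complex measure. -/
theorem exists_complexMeasure {V : Type*} [AddCommGroup V] [Module ℂ V] (T : V →ₗ[ℂ] C(K, ℂ))
    (ℓ : V →ₗ[ℂ] ℂ) (M : ℝ) (hM : 0 ≤ M) (h : ∀ v, ‖ℓ v‖ ≤ M * ‖T v‖) :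
    ∃ ν : ComplexMeasure K, ν.variation Set.univ ≤ ENNReal.ofReal M ∧
      ∀ v, cintegral ν (T v) = ℓ v := by
  obtain ⟨μ, _, h, hμ, hm, h1, hh⟩ := exists_measure_density T ℓ M hM h
  refine ⟨μ.withDensityᵥ h, (variation_withDensityᵥ_univ_le μ hm.stronglyMeasurable h1).trans hμ,
    fun v => ?_⟩
  have hi : Integrable (T v) μ := Integrable.of_bound
    (T v).continuous.aestronglyMeasurable ‖T v‖
    (Filter.Eventually.of_forall fun x => (T v).norm_coe_le_norm x)
  rw [cintegral, integral_withDensity_of_bounded μ _ hm.stronglyMeasurable h1 hi, hh]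
  rfl

/-- Riesz representation by a signed measure, on the elements on which the functional is real. -/
theorem exists_signedMeasure {V : Type*} [AddCommGroup V] [Module ℂ V] (T : V →ₗ[ℂ] C(K, ℂ))
    (ℓ : V →ₗ[ℂ] ℂ) (M : ℝ) (hM : 0 ≤ M) (h : ∀ v, ‖ℓ v‖ ≤ M * ‖T v‖) :
    ∃ ν : SignedMeasure K, ν.variation Set.univ ≤ ENNReal.ofReal M ∧
      ∀ v, (∀ x, (T v x).im = 0) → (ℓ v).im = 0 → sintegral ν (T v) = ℓ v := by
  obtain ⟨μ, _, h, hμ, hm, h1, hh⟩ := exists_measure_density T ℓ M hM h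
  have hm' : StronglyMeasurable fun x => (h x).re :=
    (Complex.measurable_re.comp hm).stronglyMeasurable
  have h1' : ∀ x, ‖(h x).re‖ ≤ 1 := fun x => (Complex.abs_re_le_norm _).trans (h1 x)
  -- Replacing `h` by its real part does not increase the variation bound, and it preserves the
  -- integrals of those real functions on which the functional takes real values.
  refine ⟨μ.withDensityᵥ fun x => (h x).re,
    (variation_withDensityᵥ_univ_le μ hm' h1').trans hμ, fun v hv hℓ => ?_⟩
  have hi : Integrable (T v) μ := Integrable.of_bound
    (T v).continuous.aestronglyMeasurable ‖T v‖
    (Filter.Eventually.of_forall fun x => (T v).norm_coe_le_norm x)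
  rw [sintegral, integral_withDensity_of_bounded μ _ hm' h1' hi]
  have hi2 : Integrable (fun x => T v x * h x) μ :=
    hi.mul_bdd (c := 1) hm.aestronglyMeasurable (Filter.Eventually.of_forall h1)
  have hre : ∀ x, (ContinuousLinearMap.lsmul ℝ ℝ).flip (T v x) (h x).re
      = (((T v x * h x).re : ℝ) : ℂ) := by
    intro x
    apply Complex.ext <;> simp [Complex.mul_re, hv x, mul_comm]
  simp_rw [hre]
  rw [integral_complex_ofReal]
  have : ∫ x, (T v x * h x).re ∂μ = (∫ x, T v x * h x ∂μ).re := integral_re hi2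
  rw [this, ← hh]
  exact Complex.ext (by simp) (by simp [hℓ])

end RieszMeasures

/-! ### Polar decomposition and the Hilbert-Schmidt structure on the square-root ideal. -/

section HilbertSchmidt

variable {H : Type*} [NormedAddCommGroup H] [InnerProductSpace ℂ H] [CompleteSpace H]

/-- If `‖S x‖ = ‖V x‖` for all `x` then `V = C S` and `S = C* V` for some bounded `C`. -/
theorem exists_factor_of_norm_eq (V S : H →L[ℂ] H) (h : ∀ x, ‖S x‖ = ‖V x‖) :
    ∃ C : H →L[ℂ] H, V = C * S ∧ star C * V = S := by
  let R := LinearMap.range S.toLinearMap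
  have hker : LinearMap.ker S.toLinearMap ≤ LinearMap.ker V.toLinearMap := fun x hx => by
    have h1 : S x = 0 := hx
    have h2 : V x = 0 := norm_eq_zero.1 (by rw [← h, h1, norm_zero])
    exact h2
  let f₀ : R →ₗ[ℂ] H := ((LinearMap.ker S.toLinearMap).liftQ V.toLinearMap hker).comp
    S.toLinearMap.quotKerEquivRange.symm.toLinearMap
  have hf₀ : ∀ x (hx : S x ∈ R), f₀ ⟨S x, hx⟩ = V x := fun x hx => by
    have : S.toLinearMap.quotKerEquivRange.symm ⟨S x, hx⟩
        = (LinearMap.ker S.toLinearMap).mkQ x := by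
      rw [LinearEquiv.symm_apply_eq]; rfl
    simp [f₀, this]
  have hnorm : ∀ y, ‖f₀ y‖ = ‖y‖ := by
    rintro ⟨_, x, rfl⟩
    exact (congrArg norm (hf₀ x ⟨x, rfl⟩)).trans (h x).symm
  let f : R →L[ℂ] H := f₀.mkContinuous 1 fun y => by rw [hnorm, one_mul]
  let e : R →L[ℂ] R.topologicalClosure :=
    (Submodule.inclusion R.le_topologicalClosure).mkContinuous 1 fun y => by
      rw [one_mul]; exact le_rfl
  have he : DenseRange e := (denseRange_inclusion_iff R.le_topologicalClosure).2 (by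
    simp [Submodule.topologicalClosure_coe])
  have hei : IsUniformInducing e := Isometry.isUniformInducing
    (AddMonoidHomClass.isometry_of_norm e fun y => rfl)
  -- The isometry `S x ↦ V x` extends to the closure of the range of `S`. Precomposed with the
  -- orthogonal projection it is the partial isometry of the polar decomposition.
  let F : R.topologicalClosure →L[ℂ] H := f.extend e
  have hF : ∀ y, F (e y) = f y := fun y => f.extend_eq he hei y
  have hFn : ∀ y, ‖F y‖ = ‖y‖ := fun y => he.induction_on y
    (isClosed_eq F.continuous.norm continuous_norm) fun z => by
      rw [hF]; exact hnorm z
  let Fi : R.topologicalClosure →ₗᵢ[ℂ] H := ⟨F.toLinearMap, hFn⟩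
  have : CompleteSpace R.topologicalClosure :=
    R.isClosed_topologicalClosure.completeSpace_coe
  let P := R.topologicalClosure.orthogonalProjectionOnto
  have hmem : ∀ x, S x ∈ R.topologicalClosure := fun x =>
    R.le_topologicalClosure ⟨x, rfl⟩
  have hPS : ∀ x, P (S x) = ⟨S x, hmem x⟩ := fun x =>
    Submodule.orthogonalProjectionOnto_mem_subspace_eq_self (K := R.topologicalClosure) ⟨S x, hmem x⟩
  have hFS : ∀ x, F ⟨S x, hmem x⟩ = V x := fun x => (hF ⟨S x, ⟨x, rfl⟩⟩).trans (hf₀ x ⟨x, rfl⟩)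
  refine ⟨F.comp P, ?_, ?_⟩
  · ext x
    change V x = F (P (S x))
    rw [hPS, hFS]
  · ext x
    refine ext_inner_right ℂ fun y => ?_
    change inner ℂ ((ContinuousLinearMap.adjoint (F.comp P)) (V x)) y = _
    rw [ContinuousLinearMap.adjoint_inner_left]
    change inner ℂ (V x) (F (P y)) = _
    rw [← hFS]
    have := Fi.inner_map_map ⟨S x, hmem x⟩ (P y)
    exact this.trans (Submodule.inner_orthogonalProjectionOnto_eq_of_mem_left
      (K := R.topologicalClosure) ⟨S x, hmem x⟩ y)

theorem polarization_star_mul {R : Type*} [Ring R] [StarRing R] [Algebra ℂ R] [StarModule ℂ R]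
    (Z W : R) :
    (4 : ℂ) • (star Z * W) = star (W + Z) * (W + Z) - star (W - Z) * (W - Z)
      + Complex.I • (star (W + Complex.I • Z) * (W + Complex.I • Z))
      - Complex.I • (star (W - Complex.I • Z) * (W - Complex.I • Z)) := by
  simp only [star_add, star_sub, star_smul, add_mul, mul_add, sub_mul, mul_sub, smul_add, smul_sub,
    smul_mul_assoc, mul_smul_comm, smul_smul, RCLike.star_def, Complex.conj_I]
  simp only [mul_neg, Complex.I_mul_I, neg_neg]
  module

theorem polarization_mul_star {R : Type*} [Ring R] [StarRing R] [Algebra ℂ R] [StarModule ℂ R]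
    (Z W : R) :
    (4 : ℂ) • (W * star Z) = (W + Z) * star (W + Z) - (W - Z) * star (W - Z)
      + Complex.I • ((W + Complex.I • Z) * star (W + Complex.I • Z))
      - Complex.I • ((W - Complex.I • Z) * star (W - Complex.I • Z)) := by
  simp only [star_add, star_sub, star_smul, add_mul, mul_add, sub_mul, mul_sub, smul_add, smul_sub,
    smul_mul_assoc, mul_smul_comm, smul_smul, RCLike.star_def, Complex.conj_I]
  simp only [mul_neg, Complex.I_mul_I, neg_neg]
  module

/-- A two-sided *-ideal `J` of `B(H)` together with a linear functional which is a positive trace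
on products of two elements of `J`. -/
structure HilbertSchmidtTrace (H : Type*) [NormedAddCommGroup H] [InnerProductSpace ℂ H]
    [CompleteSpace H] where
  J : Submodule ℂ (H →L[ℂ] H)
  mul_mem_left : ∀ (A : H →L[ℂ] H) {B : H →L[ℂ] H}, B ∈ J → A * B ∈ J
  mul_mem_right : ∀ {B : H →L[ℂ] H} (C : H →L[ℂ] H), B ∈ J → B * C ∈ J
  star_mem : ∀ {B : H →L[ℂ] H}, B ∈ J → star B ∈ J
  T : (H →L[ℂ] H) →ₗ[ℂ] ℂ
  comm : ∀ {V W : H →L[ℂ] H}, V ∈ J → W ∈ J → T (V * W) = T (W * V)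
  pos : ∀ {V : H →L[ℂ] H}, V ∈ J → 0 ≤ (T (star V * V)).re ∧ (T (star V * V)).im = 0
  bdd : ∀ {V W : H →L[ℂ] H}, V ∈ J → W ∈ J → ∃ C : ℝ, 0 ≤ C ∧
    ∀ E Y : H →L[ℂ] H, ‖T (W * (E * V * Y))‖ ≤ C * ‖E‖ * ‖Y‖

namespace NormedIdeal

variable {I J : NormedIdeal H}

/-- Polar decomposition with `S = |V|`. Membership in `J` depends on `V* V` only, so it passes from
`V` to `S`. -/
theorem IsSqrtOf.exists_abs (hJ : J.IsSqrtOf I) {V : H →L[ℂ] H} (hV : V ∈ J.carrier) :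
    ∃ S C : H →L[ℂ] H, S ∈ J.carrier ∧ star S = S ∧ S * S = star V * V ∧ V = C * S ∧
      star C * V = S := by
  have hs : star (CFC.abs V) = CFC.abs V := (CFC.abs_nonneg V).isSelfAdjoint
  have hm : CFC.abs V * CFC.abs V = star V * V := CFC.abs_mul_abs V
  obtain ⟨C, h1, h2⟩ := exists_factor_of_norm_eq V (CFC.abs V) fun x => by
    have e : ∀ A : H →L[ℂ] H, (‖A x‖ ^ 2 : ℝ) = (inner ℂ ((star A * A) x) x : ℂ).re := by
      intro A
      change _ = (inner ℂ ((ContinuousLinearMap.adjoint A) (A x)) x : ℂ).re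
      rw [ContinuousLinearMap.adjoint_inner_left, inner_self_eq_norm_sq_to_K]
      norm_cast
    have : ‖CFC.abs V x‖ ^ 2 = ‖V x‖ ^ 2 := by rw [e, e, hs, hm]
    exact (sq_eq_sq₀ (norm_nonneg _) (norm_nonneg _)).1 this
  refine ⟨CFC.abs V, C, ?_, hs, hm, h1, h2⟩
  rw [hJ.mem_iff, hs, hm, ← hJ.mem_iff]
  exact hV

/-- The condition defining `J` involves `V* V` and not `V V*`; writing `V* = S C*` with `S ∈ J`
restores the symmetry. -/
theorem IsSqrtOf.star_mem (hJ : J.IsSqrtOf I) {V : H →L[ℂ] H} (hV : V ∈ J.carrier) :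
    star V ∈ J.carrier := by
  obtain ⟨S, C, hS, hs, -, h1, -⟩ := hJ.exists_abs hV
  rw [h1, star_mul, hs]
  exact J.mul_mem_right _ hS

theorem IsSqrtOf.mul_mem (hJ : J.IsSqrtOf I) {V W : H →L[ℂ] H} (hV : V ∈ J.carrier)
    (hW : W ∈ J.carrier) : V * W ∈ I.carrier := by
  have hZ := hJ.star_mem hV
  have h4 : (4 : ℂ) • (V * W) ∈ I.carrier := by
    have := polarization_star_mul (star V) W
    rw [star_star] at this
    rw [this]
    refine I.carrier.sub_mem (I.carrier.add_mem (I.carrier.sub_mem ?_ ?_)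
      (I.carrier.smul_mem _ ?_)) (I.carrier.smul_mem _ ?_)
    · exact (hJ.mem_iff _).1 (J.carrier.add_mem hW hZ)
    · exact (hJ.mem_iff _).1 (J.carrier.sub_mem hW hZ)
    · exact (hJ.mem_iff _).1 (J.carrier.add_mem hW (J.carrier.smul_mem _ hZ))
    · exact (hJ.mem_iff _).1 (J.carrier.sub_mem hW (J.carrier.smul_mem _ hZ))
  exact (I.carrier.smul_mem_iff (by norm_num)).1 h4

/-- The functional on `B(H)` obtained by extending `τ` linearly turns `I^{1/2}` into a
Hilbert-Schmidt ideal. -/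
theorem IsSqrtOf.exists_hilbertSchmidtTrace (hJ : J.IsSqrtOf I) {τ : I.carrier →ₗ[ℂ] ℂ}
    (hτ : I.IsPosBddTrace τ) :
    ∃ S : HilbertSchmidtTrace H, S.J = J.carrier ∧ ∀ A : I.carrier, S.T A = τ A := by
  -- A purely algebraic extension: `T` can be applied to any operator, without membership proofs,
  -- but it carries no continuity on `B(H)`.
  obtain ⟨T, hT⟩ := τ.exists_extend
  have hT' : ∀ A (hA : A ∈ I.carrier), T A = τ ⟨A, hA⟩ := fun A hA => by
    rw [← hT]; rfl
  have hcyc : ∀ A B, A ∈ I.carrier → T (A * B) = T (B * A) := fun A B hA => by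
    rw [hT' _ (I.mul_mem_right B hA), hT' _ (I.mul_mem_left B hA)]
    exact hτ.cyclic ⟨A, hA⟩ B
  -- With `V = C S`, the operator `V V* = C S² C*` has the trace of `C* C S²`, and `C* C S = C* V =
  -- S`. Here `S² ∈ I`, so cyclicity of `τ` is enough; polarization then yields the trace property
  -- on `J · J`.
  have hdiag : ∀ V ∈ J.carrier, T (star V * V) = T (V * star V) := by
    intro V hV
    obtain ⟨S, C, hS, hs, hSS, h1, h2⟩ := hJ.exists_abs hV
    have e1 : V * star V = C * (S * S) * star C := by
      conv_lhs => rw [h1]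
      rw [star_mul, hs]
      simp only [mul_assoc]
    have e2 : star C * (C * (S * S)) = S * S := by
      conv_rhs => rw [← h2, h2]
      conv_rhs => lhs; rw [← h2, h1]
      simp only [mul_assoc]
    rw [e1, hcyc _ _ (I.mul_mem_left _ (hJ.mul_mem hS hS)), e2, hSS]
  have hcomm : ∀ Z W, Z ∈ J.carrier → W ∈ J.carrier → T (star Z * W) = T (W * star Z) := by
    intro Z W hZ hW
    have e : (4 : ℂ) • T (star Z * W) = (4 : ℂ) • T (W * star Z) := by
      rw [← map_smul, ← map_smul, polarization_star_mul, polarization_mul_star]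
      simp only [map_add, map_sub, map_smul]
      rw [hdiag _ (J.carrier.add_mem hW hZ), hdiag _ (J.carrier.sub_mem hW hZ),
        hdiag _ (J.carrier.add_mem hW (J.carrier.smul_mem _ hZ)),
        hdiag _ (J.carrier.sub_mem hW (J.carrier.smul_mem _ hZ))]
    exact smul_right_injective ℂ (by norm_num : (4 : ℂ) ≠ 0) e
  refine ⟨⟨J.carrier, J.mul_mem_left, J.mul_mem_right, hJ.star_mem, T, ?_, ?_, ?_⟩, rfl,
    fun A => hT' _ A.2⟩
  · intro V W hV hW
    have := hcomm (star V) W (hJ.star_mem hV) hW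
    rwa [star_star] at this
  · intro V hV
    rw [hT' _ ((hJ.mem_iff V).1 hV)]
    exact hτ.pos _ (star_mul_self_nonneg V)
  · intro V W hV hW
    obtain ⟨M, hM, hb⟩ := hτ.bdd
    refine ⟨M * (J.nrm ⟨W, hW⟩ * J.nrm ⟨V, hV⟩), by positivity, fun E Y => ?_⟩
    have hm := J.mul_mem_right Y (J.mul_mem_left E hV)
    rw [hT' _ (hJ.mul_mem hW hm)]
    refine (hb _).trans ?_
    have h1 := hJ.nrm_mul_le ⟨W, hW⟩ ⟨E * V * Y, hm⟩ (hJ.mul_mem hW hm)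
    have h2 := J.ideal_le E Y ⟨V, hV⟩
    calc _ ≤ M * (J.nrm ⟨W, hW⟩ * (‖E‖ * J.nrm ⟨V, hV⟩ * ‖Y‖)) := by
          gcongr
          exact h1.trans (by gcongr)
      _ = _ := by ring

end NormedIdeal

end HilbertSchmidt

/-! ### Cauchy-Schwarz estimates for the trace. -/

namespace HilbertSchmidtTrace

variable {H : Type*} [NormedAddCommGroup H] [InnerProductSpace ℂ H] [CompleteSpace H]
  (S : HilbertSchmidtTrace H)

/-- The square of the Hilbert-Schmidt seminorm, `T(V* V)`. -/
def sq (V : H →L[ℂ] H) : ℝ := (S.T (star V * V)).re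

theorem sq_nonneg {V : H →L[ℂ] H} (hV : V ∈ S.J) : 0 ≤ S.sq V := (S.pos hV).1

theorem sq_star {V : H →L[ℂ] H} (hV : V ∈ S.J) : S.sq (star V) = S.sq V := by
  rw [sq, star_star, S.comm hV (S.star_mem hV), sq]

/-- Polarization: `T` is real on `|V + W|²` and on `|V + iW|²`, which gives the real and imaginary
parts of the symmetry. -/
theorem conj_T_star_mul {V W : H →L[ℂ] H} (hV : V ∈ S.J) (hW : W ∈ S.J) :
    starRingEnd ℂ (S.T (star V * W)) = S.T (star W * V) := by
  have h1 := (S.pos (S.J.add_mem hV hW)).2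
  have h2 := (S.pos (S.J.add_mem hV (S.J.smul_mem Complex.I hW))).2
  simp only [star_add, star_smul, add_mul, mul_add, smul_mul_assoc, mul_smul_comm, map_add,
    map_smul, RCLike.star_def, Complex.conj_I, Complex.add_im, (S.pos hV).2, (S.pos hW).2,
    smul_eq_mul, Complex.mul_im, Complex.neg_re, Complex.neg_im, Complex.I_re,
    Complex.I_im, Complex.mul_re] at h1 h2
  apply Complex.ext
  · simp only [Complex.conj_re]; linarith
  · simp only [Complex.conj_im]; linarith

theorem conj_T_mul {V W : H →L[ℂ] H} (hV : V ∈ S.J) (hW : W ∈ S.J) :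
    starRingEnd ℂ (S.T (V * W)) = S.T (star W * star V) := by
  have := S.conj_T_star_mul (S.star_mem hV) hW
  rwa [star_star] at this

/-- The semi-inner product `⟨V, W⟩ = T(V* W)`. -/
abbrev core : PreInnerProductSpace.Core ℂ S.J where
  inner V W := S.T (star (V : H →L[ℂ] H) * W)
  conj_inner_symm V W := S.conj_T_star_mul W.2 V.2
  re_inner_nonneg V := (S.pos V.2).1
  add_left V W Z := by simp [add_mul]
  smul_left V W c := by simp

theorem norm_T_mul_le {V W : H →L[ℂ] H} (hV : V ∈ S.J) (hW : W ∈ S.J) :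
    ‖S.T (V * W)‖ ≤ √(S.sq (star V)) * √(S.sq W) := by
  have h := InnerProductSpace.Core.inner_mul_inner_self_le (c := S.core)
    ⟨star V, S.star_mem hV⟩ ⟨W, hW⟩
  change ‖S.T (star (star V) * W)‖ * ‖S.T (star W * star V)‖ ≤ S.sq (star V) * S.sq W at h
  rw [star_star, ← S.conj_T_mul hV hW, RCLike.norm_conj, ← _root_.sq] at h
  rw [← Real.sqrt_mul (S.sq_nonneg (S.star_mem hV))]
  exact Real.le_sqrt_of_sq_le h

/-- `T` is cyclic only for products of two elements of `J`, so each move keeps one of `A`, `B` in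
each of the two factors. -/
theorem T_conj_eq {A B : H →L[ℂ] H} (hA : A ∈ S.J) (hB : B ∈ S.J) (p Q : H →L[ℂ] H) :
    S.T (p * A * Q * (B * p)) = S.T (A * Q * B * (p * p)) := by
  have h1 : p * A * Q * (B * p) = (p * A) * (Q * B * p) := by simp only [mul_assoc]
  have h2 : A * Q * B * (p * p) = A * (Q * B * (p * p)) := by simp only [mul_assoc]
  rw [h1, h2, S.comm (S.mul_mem_left _ hA) (S.mul_mem_right _ (S.mul_mem_left _ hB)),
    S.comm hA (S.mul_mem_right _ (S.mul_mem_left _ hB))]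
  simp only [mul_assoc]

/-- With `P = p²` and `Q = q²`, cyclicity rearranges the trace into that of `(p V q)(q W p)`, a
product of two elements of `J` to which Cauchy-Schwarz applies. -/
theorem norm_T_sandwich_le {V W P Q : H →L[ℂ] H} (hV : V ∈ S.J) (hW : W ∈ S.J) (hP : 0 ≤ P)
    (hQ : 0 ≤ Q) :
    ‖S.T (W * (P * V * Q))‖ ≤
      √(S.T (V * Q * star V * P)).re * √(S.T (star W * Q * W * P)).re := by
  obtain ⟨p, hp, hpP⟩ : ∃ p : H →L[ℂ] H, star p = p ∧ P = p * p :=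
    ⟨CFC.sqrt P, (CFC.sqrt_nonneg P).isSelfAdjoint, (CFC.sqrt_mul_sqrt_self P).symm⟩
  obtain ⟨q, hq, hqQ⟩ : ∃ q : H →L[ℂ] H, star q = q ∧ Q = q * q :=
    ⟨CFC.sqrt Q, (CFC.sqrt_nonneg Q).isSelfAdjoint, (CFC.sqrt_mul_sqrt_self Q).symm⟩
  have hX : p * V * q ∈ S.J := S.mul_mem_right _ (S.mul_mem_left _ hV)
  have hY : q * W * p ∈ S.J := S.mul_mem_right _ (S.mul_mem_left _ hW)
  have e1 : S.T (W * (P * V * Q)) = S.T (p * V * q * (q * W * p)) := by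
    have : W * (P * V * Q) = (W * p) * (p * V * q * q) := by
      rw [hpP, hqQ]; simp only [mul_assoc]
    rw [this, S.comm (S.mul_mem_right _ hW) (S.mul_mem_right _ hX)]
    simp only [mul_assoc]
  have e2 : S.sq (star (p * V * q)) = (S.T (V * Q * star V * P)).re := by
    rw [sq, star_star, star_mul, star_mul, hp, hq, hpP, hqQ,
      ← S.T_conj_eq hV (S.star_mem hV)]
    simp only [mul_assoc]
  have e3 : S.sq (q * W * p) = (S.T (star W * Q * W * P)).re := by
    rw [sq, star_mul, star_mul, hp, hq, hpP, hqQ, ← S.T_conj_eq (S.star_mem hW) hW]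
    simp only [mul_assoc]
  rw [e1, ← e2, ← e3]
  exact S.norm_T_mul_le hX hY

/-- A second Cauchy-Schwarz, over the pairs `(r, s)`; the two sums of squares collapse by `∑ P r =
1`. The `P r` need not be projections, and the bound does not depend on their number. -/
theorem sum_norm_T_sandwich_le {V W : H →L[ℂ] H} (hV : V ∈ S.J) (hW : W ∈ S.J)
    {ι : Type*} [Fintype ι] (P : ι → H →L[ℂ] H) (hP : ∀ r, 0 ≤ P r) (h1 : ∑ r, P r = 1) :
    ∑ r, ∑ s, ‖S.T (W * (P r * V * P s))‖ ≤ √(S.sq V) * √(S.sq W) := by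
  have key : ∀ {A : H →L[ℂ] H}, A ∈ S.J →
      ∑ x : ι × ι, (S.T (A * P x.2 * star A * P x.1)).re = S.sq A := by
    intro A hA
    rw [← S.sq_star hA, sq, star_star, Fintype.sum_prod_type]
    simp only [← Complex.re_sum, ← map_sum, ← Finset.mul_sum, ← Finset.sum_mul, h1, mul_one]
  have nonneg : ∀ {A : H →L[ℂ] H}, A ∈ S.J → ∀ x : ι × ι,
      0 ≤ (S.T (A * P x.2 * star A * P x.1)).re := by
    intro A hA x
    have hp : star (CFC.sqrt (P x.1)) = CFC.sqrt (P x.1) := (CFC.sqrt_nonneg _).isSelfAdjoint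
    have hq : star (CFC.sqrt (P x.2)) = CFC.sqrt (P x.2) := (CFC.sqrt_nonneg _).isSelfAdjoint
    have h := S.sq_nonneg (S.star_mem
      (S.mul_mem_right (CFC.sqrt (P x.2)) (S.mul_mem_left (CFC.sqrt (P x.1)) hA)))
    rw [sq, star_star, star_mul, star_mul, hp, hq] at h
    rw [← CFC.sqrt_mul_sqrt_self (P x.1) (hP _), ← S.T_conj_eq hA (S.star_mem hA),
      ← CFC.sqrt_mul_sqrt_self (P x.2) (hP _)]
    simpa only [mul_assoc] using h
  rw [← Fintype.sum_prod_type' (f := fun r s => ‖S.T (W * (P r * V * P s))‖)]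
  calc ∑ x : ι × ι, ‖S.T (W * (P x.1 * V * P x.2))‖
      ≤ ∑ x : ι × ι, √(S.T (V * P x.2 * star V * P x.1)).re *
          √(S.T (star W * P x.2 * star (star W) * P x.1)).re :=
        Finset.sum_le_sum fun x _ => by
          rw [star_star]
          exact S.norm_T_sandwich_le hV hW (hP _) (hP _)
    _ ≤ √(∑ x : ι × ι, (S.T (V * P x.2 * star V * P x.1)).re) *
          √(∑ x : ι × ι, (S.T (star W * P x.2 * star (star W) * P x.1)).re) :=
        Real.sum_sqrt_mul_sqrt_le _ (nonneg hV) (nonneg (S.star_mem hW))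
    _ = √(S.sq V) * √(S.sq W) := by rw [key hV, key (S.star_mem hW), S.sq_star hW]

end HilbertSchmidtTrace

/-! ### Polynomial calculus for commuting tuples. -/

section CommAeval

variable {σ R : Type*} [Ring R] [Algebra ℂ R]

open scoped IsMulCommutative in
/-- Evaluation of polynomials at a tuple of commuting elements of a (noncommutative) algebra. -/
def commAeval (x : σ → R) (h : ∀ i j, Commute (x i) (x j)) : MvPolynomial σ ℂ →ₐ[ℂ] R :=
  have : IsMulCommutative (Algebra.adjoin ℂ (Set.range x)) :=
    Algebra.isMulCommutative_adjoin ℂ (by rintro _ ⟨i, rfl⟩ _ ⟨j, rfl⟩; exact h i j)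
  (Algebra.adjoin ℂ (Set.range x)).val.comp
    (MvPolynomial.aeval fun i =>
      (⟨x i, Algebra.subset_adjoin ⟨i, rfl⟩⟩ : Algebra.adjoin ℂ (Set.range x)))

@[simp]
theorem commAeval_X (x : σ → R) (h : ∀ i j, Commute (x i) (x j)) (i : σ) :
    commAeval x h (MvPolynomial.X i) = x i := by
  simp [commAeval]

theorem commAeval_word (x : σ → R) (h : ∀ i j, Commute (x i) (x j)) (w : List σ) :
    commAeval x h (w.map MvPolynomial.X).prod = (w.map x).prod := by
  rw [map_list_prod, List.map_map]
  congr 2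
  ext i
  simp

theorem MvPolynomial.span_words_eq_top :
    Submodule.span ℂ (Set.range fun w : List σ => (w.map (MvPolynomial.X (R := ℂ))).prod) = ⊤ := by
  rw [eq_top_iff]
  rintro p -
  induction p using MvPolynomial.induction_on with
  | C a =>
    have : (MvPolynomial.C a : MvPolynomial σ ℂ) = a • (([] : List σ).map MvPolynomial.X).prod := by
      simp [MvPolynomial.C_eq_smul_one]
    rw [this]
    exact Submodule.smul_mem _ _ (Submodule.subset_span ⟨[], rfl⟩)
  | add p q hp hq => exact Submodule.add_mem _ hp hq
  | mul_X p i hp =>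
    induction hp using Submodule.span_induction with
    | mem p hp =>
      obtain ⟨w, rfl⟩ := hp
      exact Submodule.subset_span ⟨i :: w, by simp [mul_comm]⟩
    | zero => simp
    | add p q _ _ hp hq => rw [add_mul]; exact Submodule.add_mem _ hp hq
    | smul a p _ hp => rw [smul_mul_assoc]; exact Submodule.smul_mem _ _ hp

/-- Compression of a dilation is linear but not multiplicative, so the dilation identity has to be
checked on words rather than on generators. -/
theorem MvPolynomial.linearMap_ext_words {M : Type*} [AddCommMonoid M] [Module ℂ M]
    {f g : MvPolynomial σ ℂ →ₗ[ℂ] M}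
    (h : ∀ w : List σ, f (w.map MvPolynomial.X).prod = g (w.map MvPolynomial.X).prod) : f = g :=
  LinearMap.ext_on_range MvPolynomial.span_words_eq_top h

end CommAeval

/-! ### Approximate joint diagonalization by Gelfand theory. -/

section SpectralApprox

variable {n : ℕ}

open WeakDual MvPolynomial

/-- Approximate simultaneous diagonalization in a commutative C*-algebra. -/
theorem exists_partition_approx {A : Type*} [CommCStarAlgebra A] (u : Fin n → A)
    (S : Finset (MvPolynomial (Fin n) ℂ)) {δ : ℝ} (hδ : 0 < δ) :
    ∃ (N : ℕ) (Q : Fin N → A) (φ : Fin N → characterSpace ℂ A),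
      ∑ r, star (Q r) * Q r = 1 ∧
      ∀ p ∈ S, ‖aeval u p - ∑ r, (eval (fun j => φ r (u j)) p) • (star (Q r) * Q r)‖ ≤ δ := by
  let G := gelfandStarTransform A
  have hG : ∀ (a : A) φ, G a φ = φ a := fun a φ => rfl
  have hGn : ∀ a, ‖G a‖ = ‖a‖ := (gelfandTransform_isometry A).norm_map_of_map_zero (map_zero G)
  have heval : ∀ (φ : characterSpace ℂ A) p, φ (aeval u p) = eval (fun j => φ (u j)) p := by
    intro φ p
    have : (CharacterSpace.toAlgHom φ).comp (aeval u)
        = (aeval (fun j => φ (u j)) : MvPolynomial (Fin n) ℂ →ₐ[ℂ] ℂ) := by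
      ext j; simp
    have := DFunLike.congr_fun this p
    simpa [MvPolynomial.aeval_eq_eval] using this
  -- Sets of characters on which every polynomial of `S` oscillates by less than `δ`; a partition of
  -- unity subordinate to a finite subcover supplies the positive weights.
  let U : characterSpace ℂ A → Set (characterSpace ℂ A) := fun φ =>
    {ψ | ∀ p ∈ S, ‖ψ (aeval u p) - φ (aeval u p)‖ < δ}
  have hUo : ∀ φ, IsOpen (U φ) := fun φ => by
    have : U φ = ⋂ p ∈ S, {ψ | ‖G (aeval u p) ψ - φ (aeval u p)‖ < δ} := by
      ext ψ; simp [U, hG]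
    rw [this]
    refine isOpen_biInter_finset fun p _ => isOpen_lt ?_ continuous_const
    exact ((G (aeval u p)).continuous.sub continuous_const).norm
  obtain ⟨t, ht⟩ := isCompact_univ.elim_finite_subcover U hUo
    (fun φ _ => Set.mem_iUnion.2 ⟨φ, fun p _ => by simpa using hδ⟩)
  let e := t.equivFin.symm
  obtain ⟨ρ, hρ⟩ := PartitionOfUnity.exists_isSubordinate isClosed_univ
    (fun r : Fin t.card => U (e r)) (fun r => hUo _) (fun φ hφ => by
      obtain ⟨ψ, hψt, hψ⟩ := Set.mem_iUnion₂.1 (ht hφ)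
      exact Set.mem_iUnion.2 ⟨t.equivFin ⟨ψ, hψt⟩, by simpa [e] using hψ⟩)
  have hsum : ∀ ψ, ∑ r, ρ r ψ = 1 := fun ψ => by
    rw [← finsum_eq_sum_of_fintype]; exact ρ.sum_eq_one (Set.mem_univ ψ)
  -- Square roots of the weights, so that positivity is visible as `Q* Q` and survives the passage
  -- to a larger algebra and compression.
  let q : Fin t.card → C(characterSpace ℂ A, ℂ) := fun r =>
    ⟨fun ψ => ((√(ρ r ψ) : ℝ) : ℂ), by fun_prop⟩
  have hq : ∀ r ψ, star (q r ψ) * q r ψ = (ρ r ψ : ℂ) := fun r ψ => by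
    simp only [q, ContinuousMap.coe_mk, RCLike.star_def, Complex.conj_ofReal]
    rw [← Complex.ofReal_mul, Real.mul_self_sqrt (ρ.nonneg r ψ)]
  have hP : ∀ r ψ, G (star (G.symm (q r)) * G.symm (q r)) ψ = (ρ r ψ : ℂ) := fun r ψ => by
    rw [map_mul, map_star, StarAlgEquiv.apply_symm_apply]
    exact hq r ψ
  refine ⟨t.card, fun r => G.symm (q r), fun r => e r, ?_, fun p hp => ?_⟩
  · apply EquivLike.injective G
    ext ψ
    rw [map_sum, ContinuousMap.sum_apply]
    rw [Finset.sum_congr rfl fun r _ => hP r ψ, ← Complex.ofReal_sum, hsum]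
    simp
  · rw [← hGn, ContinuousMap.norm_le _ hδ.le]
    intro ψ
    have : G (aeval u p - ∑ r, (eval (fun j => (e r : characterSpace ℂ A) (u j)) p) •
        (star (G.symm (q r)) * G.symm (q r))) ψ
        = ∑ r, (ρ r ψ : ℂ) * (ψ (aeval u p) - (e r : characterSpace ℂ A) (aeval u p)) := by
      simp only [mul_sub, Finset.sum_sub_distrib, ← Finset.sum_mul, ← Complex.ofReal_sum, hsum]
      rw [map_sub, ContinuousMap.sub_apply, map_sum, ContinuousMap.sum_apply, hG]
      simp only [Complex.ofReal_one, one_mul, heval (e _)]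
      congr 1
      refine Finset.sum_congr rfl fun r _ => ?_
      rw [map_smul, ContinuousMap.smul_apply, hP, smul_eq_mul, mul_comm]
    rw [this]
    calc _ ≤ ∑ r, ρ r ψ * δ := by
          refine norm_sum_le_of_le _ fun r _ => ?_
          rw [norm_mul, Complex.norm_real, Real.norm_of_nonneg (ρ.nonneg r ψ)]
          by_cases h0 : ρ r ψ = 0
          · simp [h0]
          · have := hρ r (subset_tsupport _ h0)
            exact mul_le_mul_of_nonneg_left (this p hp).le (ρ.nonneg r ψ)
      _ = δ := by rw [← Finset.sum_mul, hsum, one_mul]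

/-- Approximate simultaneous diagonalization of commuting normal elements of a C*-algebra. -/
theorem exists_partition_approx_of_normal {A : Type*} [CStarAlgebra A] (u : Fin n → A)
    (hu : ∀ j, IsStarNormal (u j)) (hc : ∀ i j, Commute (u i) (u j))
    (S : Finset (MvPolynomial (Fin n) ℂ)) {δ : ℝ} (hδ : 0 < δ) :
    ∃ (N : ℕ) (Q : Fin N → A) (x : Fin N → Fin n → ℂ),
      ∑ r, star (Q r) * Q r = 1 ∧ (∀ r j, ‖x r j‖ ≤ ‖u j‖) ∧
      (∀ j, IsSelfAdjoint (u j) → ∀ r, (x r j).im = 0) ∧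
      ∀ p ∈ S, ‖commAeval u hc p - ∑ r, (eval (x r) p) • (star (Q r) * Q r)‖ ≤ δ := by
  -- By Fuglede's theorem the adjoints of the `u j` commute with the tuple as well, so the
  -- C*-algebra it generates is commutative.
  have hadj : ∀ x y : StarAlgebra.adjoin ℂ (Set.range u), x * y = y * x := by
    have : IsMulCommutative (StarAlgebra.adjoin ℂ (Set.range u)) :=
      StarAlgebra.isMulCommutative_adjoin ℂ
        (by rintro _ ⟨i, rfl⟩ _ ⟨j, rfl⟩; exact hc i j)
        (by rintro _ ⟨i, rfl⟩ _ ⟨j, rfl⟩; exact (hu j).commute_star_right (hc i j))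
    exact this.is_comm.comm
  let B : StarSubalgebra ℂ A := (StarAlgebra.adjoin ℂ (Set.range u)).topologicalClosure
  have hB : IsClosed (B : Set A) := StarSubalgebra.isClosed_topologicalClosure _
  let _ : CommRing B := StarSubalgebra.commRingTopologicalClosure _ hadj
  have : CompleteSpace B := hB.completeSpace_coe
  let _ : CommCStarAlgebra B := { mul_comm := mul_comm }
  let v : Fin n → B := fun j => ⟨u j, StarSubalgebra.le_topologicalClosure _
    (StarAlgebra.subset_adjoin ℂ _ ⟨j, rfl⟩)⟩
  obtain ⟨N, Q, φ, h1, h2⟩ := exists_partition_approx v S hδ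
  have hval : ∀ p, ((aeval v p : B) : A) = commAeval u hc p := by
    intro p
    have : (B.subtype.toAlgHom.comp (aeval v)) = commAeval u hc := by
      ext j
      simp [v]
    exact DFunLike.congr_fun this p
  refine ⟨N, fun r => Q r, fun r j => φ r (v j), ?_, fun r j => ?_, fun j hj r => ?_, fun p hp => ?_⟩
  · have := congrArg (B.subtype) h1
    simpa using this
  · have := (gelfandStarTransform B (v j)).norm_coe_le_norm (φ r)
    refine this.trans_eq ((gelfandTransform_isometry B).norm_map_of_map_zero (map_zero _) (v j))
  · have hs : star (v j) = v j := Subtype.ext hj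
    have : gelfandStarTransform B (star (v j)) (φ r) = star (gelfandStarTransform B (v j) (φ r)) := by
      rw [map_star]; rfl
    rw [hs] at this
    exact Complex.conj_eq_iff_im.1 this.symm
  · have e : B.subtype (aeval v p - ∑ r, (eval (fun j => φ r (v j)) p) • (star (Q r) * Q r))
        = commAeval u hc p - ∑ r, (eval (fun j => φ r (v j)) p) • (star (Q r : A) * Q r) := by
      rw [map_sub, map_sum, ← hval]
      rfl
    rw [← e]
    exact h2 p hp

end SpectralApprox

/-! ### Positive operator partitions on `H` obtained from dilations. -/

section Dilation

variable {n : ℕ}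

open MvPolynomial

/-- Polynomials in the commuting tuple `X` are approximated by combinations
`∑ p(x_r) P_r` with `P_r ≥ 0`, `∑ P_r = 1` and nodes `x_r ∈ Ω`. -/
def HasSpectralApprox {H : Type*} [NormedAddCommGroup H] [InnerProductSpace ℂ H] [CompleteSpace H]
    (Ω : Set (Fin n → ℂ)) (X : Fin n → H →L[ℂ] H) (hX : ∀ i j, Commute (X i) (X j)) : Prop :=
  ∀ (S : Finset (MvPolynomial (Fin n) ℂ)) (δ : ℝ), 0 < δ →
    ∃ (N : ℕ) (P : Fin N → H →L[ℂ] H) (x : Fin N → Fin n → ℂ),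
      (∀ r, 0 ≤ P r) ∧ ∑ r, P r = 1 ∧ (∀ r, x r ∈ Ω) ∧
      ∀ p ∈ S, ‖commAeval X hX p - ∑ r, (eval (x r) p) • P r‖ ≤ δ

/-- The closed unit polydisc. -/
def closedPolydisc (n : ℕ) : Set (Fin n → ℂ) := {z | ∀ j, ‖z j‖ ≤ 1}

/-- The cube `[-1, 1]^n` in `ℂ^n`. -/
def realCube (n : ℕ) : Set (Fin n → ℂ) := {z | ∀ j, ‖z j‖ ≤ 1 ∧ (z j).im = 0}

/-- Compression to `H` is a positive, unital contraction, so it sends the partition of the normal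
dilation to one on `H` with the same nodes and the same error. -/
theorem HasNormalDilation.hasSpectralApprox {H : Type*} [NormedAddCommGroup H]
    [InnerProductSpace ℂ H] [CompleteSpace H] {X : Fin n → H →L[ℂ] H} (h : HasNormalDilation X)
    (hX : ∀ i j, Commute (X i) (X j)) : HasSpectralApprox (closedPolydisc n) X hX := by
  obtain ⟨K, _, _, _, ι, U, hU, hUn, hw⟩ := h
  intro S δ hδ
  obtain ⟨N, Q, x, h1, hx, -, happ⟩ := exists_partition_approx_of_normal U hUn hU.comm S hδ
  set j : H →L[ℂ] K := ι.toContinuousLinearMap with hj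
  -- The dilation identity for the empty word.
  have hjj : ContinuousLinearMap.adjoint j ∘L j = 1 := by
    exact (hw []).symm
  have hjn : ‖j‖ ≤ 1 := ι.norm_toContinuousLinearMap_le
  let Φ : (K →L[ℂ] K) →ₗ[ℂ] (H →L[ℂ] H) :=
    { toFun := fun a => ContinuousLinearMap.adjoint j ∘L a ∘L j
      map_add' := fun a b => by simp
      map_smul' := fun c a => by simp }
  have hΦ : ∀ a, Φ a = ContinuousLinearMap.adjoint j ∘L a ∘L j := fun a => rfl
  have hΦn : ∀ a, ‖Φ a‖ ≤ ‖a‖ := fun a => by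
    calc ‖Φ a‖ ≤ ‖ContinuousLinearMap.adjoint j‖ * (‖a‖ * ‖j‖) :=
          (ContinuousLinearMap.opNorm_comp_le _ _).trans (by
            gcongr; exact ContinuousLinearMap.opNorm_comp_le _ _)
      _ ≤ 1 * (‖a‖ * 1) := by
          gcongr
          rwa [LinearIsometryEquiv.norm_map]
      _ = ‖a‖ := by ring
  have hcomp : Φ.comp (commAeval U hU.comm).toLinearMap = (commAeval X hX).toLinearMap := by
    refine MvPolynomial.linearMap_ext_words fun w => ?_
    simp only [LinearMap.comp_apply, AlgHom.toLinearMap_apply, commAeval_word, hw w]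
    rfl
  refine ⟨N, fun r => Φ (star (Q r) * Q r), x, fun r => ?_, ?_, fun r l => (hx r l).trans
    (hU.norm_le l), fun p hp => ?_⟩
  · have : Φ (star (Q r) * Q r) = ContinuousLinearMap.adjoint (Q r ∘L j) ∘L (Q r ∘L j) := by
      rw [hΦ, ContinuousLinearMap.adjoint_comp]
      rfl
    change 0 ≤ Φ (star (Q r) * Q r)
    rw [this, ContinuousLinearMap.nonneg_iff_isPositive]
    exact ContinuousLinearMap.isPositive_adjoint_comp_self _
  · rw [← map_sum, h1, hΦ, ← hjj]
    rfl
  · have := DFunLike.congr_fun hcomp p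
    simp only [LinearMap.comp_apply, AlgHom.toLinearMap_apply] at this
    rw [← this]
    simp only [← map_smul, ← map_sum, ← map_sub]
    exact (hΦn _).trans (happ p hp)

theorem hasSpectralApprox_of_isSelfAdjoint {H : Type*} [NormedAddCommGroup H]
    [InnerProductSpace ℂ H] [CompleteSpace H] {X : Fin n → H →L[ℂ] H}
    (hX : ∀ i j, Commute (X i) (X j)) (hs : ∀ j, IsSelfAdjoint (X j)) (hn : ∀ j, ‖X j‖ ≤ 1) :
    HasSpectralApprox (realCube n) X hX := by
  intro S δ hδ
  obtain ⟨N, Q, x, h1, hx, him, happ⟩ :=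
    exists_partition_approx_of_normal X (fun j => (hs j).isStarNormal) hX S hδ
  exact ⟨N, fun r => star (Q r) * Q r, x, fun r => star_mul_self_nonneg _, h1,
    fun r j => ⟨(hx r j).trans (hn j), him j (hs j) r⟩, happ⟩

end Dilation

/-! ### Averages of polynomials along segments. -/

section Segment

open MvPolynomial

variable {n : ℕ}

/-- The polynomial `F(μ + t (λ - μ))` in `t`, with coefficients in `ℂ[λ, μ]`. -/
def segmentPoly (n : ℕ) :
    MvPolynomial (Fin n) ℂ →ₐ[ℂ] Polynomial (MvPolynomial (Fin n ⊕ Fin n) ℂ) :=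
  aeval fun i => Polynomial.C (X (Sum.inr i)) +
    Polynomial.C (X (Sum.inl i) - X (Sum.inr i)) * Polynomial.X

/-- The average `∫₀¹ F(μ + t (λ - μ)) dt` as a polynomial in `(λ, μ)`. -/
def segmentAvg (F : MvPolynomial (Fin n) ℂ) : MvPolynomial (Fin n ⊕ Fin n) ℂ :=
  (segmentPoly n F).sum fun m a => ((m : ℂ) + 1)⁻¹ • a

theorem eval_segmentPoly (x y : Fin n → ℂ) (F : MvPolynomial (Fin n) ℂ) (t : ℂ) :
    ((segmentPoly n F).map (eval (Sum.elim x y))).eval t = eval (fun i => y i + t * (x i - y i)) F := by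
  have : ((Polynomial.evalRingHom t).comp
      ((Polynomial.mapRingHom (eval (Sum.elim x y))).comp (segmentPoly n).toRingHom))
      = eval (fun i => y i + t * (x i - y i)) := by
    apply MvPolynomial.ringHom_ext
    · intro c
      simp [segmentPoly]
    · intro i
      simp [segmentPoly, mul_comm]
  exact DFunLike.congr_fun this F

theorem eval_segmentAvg (x y : Fin n → ℂ) (F : MvPolynomial (Fin n) ℂ) :
    eval (Sum.elim x y) (segmentAvg F)
      = ∫ t in (0 : ℝ)..1, eval (fun i => y i + t * (x i - y i)) F := by
  have h : ∀ t : ℝ, eval (fun i => y i + t * (x i - y i)) F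
      = ∑ m ∈ (segmentPoly n F).support, eval (Sum.elim x y) ((segmentPoly n F).coeff m) *
          ((t ^ m : ℝ) : ℂ) := by
    intro t
    rw [← eval_segmentPoly, Polynomial.eval_map, Polynomial.eval₂_eq_sum, Polynomial.sum_def]
    simp
  simp_rw [h]
  rw [intervalIntegral.integral_finsetSum]
  · rw [segmentAvg, Polynomial.sum_def, map_sum]
    refine Finset.sum_congr rfl fun m _ => ?_
    rw [intervalIntegral.integral_const_mul, intervalIntegral.integral_ofReal, integral_pow,
      MvPolynomial.smul_eval]
    simp [mul_comm]
  · intro m _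
    exact Continuous.intervalIntegrable (by fun_prop) _ _

theorem continuous_eval_segment (x y : Fin n → ℂ) (F : MvPolynomial (Fin n) ℂ) :
    Continuous fun t : ℝ => eval (fun i => y i + t * (x i - y i)) F := by
  have : ∀ t : ℝ, eval (fun i => y i + t * (x i - y i)) F
      = ((segmentPoly n F).map (eval (Sum.elim x y))).eval (t : ℂ) := fun t =>
    (eval_segmentPoly x y F t).symm
  simp_rw [this]
  exact (Polynomial.continuous _).comp Complex.continuous_ofReal

theorem segmentAvg_ext {p q : MvPolynomial (Fin n ⊕ Fin n) ℂ}
    (h : ∀ x y, eval (Sum.elim x y) p = eval (Sum.elim x y) q) : p = q :=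
  MvPolynomial.funext fun z => by
    have := h (z ∘ Sum.inl) (z ∘ Sum.inr)
    rwa [Sum.elim_comp_inl_inr] at this

/-- `segmentAvg` as a linear map. -/
def segmentAvgₗ (n : ℕ) : MvPolynomial (Fin n) ℂ →ₗ[ℂ] MvPolynomial (Fin n ⊕ Fin n) ℂ where
  toFun := segmentAvg
  map_add' F G := segmentAvg_ext fun x y => by
    rw [map_add, eval_segmentAvg, eval_segmentAvg, eval_segmentAvg,
      ← intervalIntegral.integral_add ((continuous_eval_segment x y F).intervalIntegrable _ _)
        ((continuous_eval_segment x y G).intervalIntegrable _ _)]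
    simp
  map_smul' c F := segmentAvg_ext fun x y => by
    rw [RingHom.id_apply, MvPolynomial.smul_eval, eval_segmentAvg, eval_segmentAvg,
      ← intervalIntegral.integral_const_mul]
    simp [MvPolynomial.smul_eval]

@[simp]
theorem segmentAvgₗ_apply (F : MvPolynomial (Fin n) ℂ) : segmentAvgₗ n F = segmentAvg F := rfl

/-- The average only uses values of `F` on the segment from `y` to `x`, which stays in the convex
set `Ω`. -/
theorem norm_eval_segmentAvg_le {Ω : Set (Fin n → ℂ)} (hΩ : Convex ℝ Ω)
    {F : MvPolynomial (Fin n) ℂ} {M : ℝ} (hM : ∀ z ∈ Ω, ‖eval z F‖ ≤ M) {x y : Fin n → ℂ}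
    (hx : x ∈ Ω) (hy : y ∈ Ω) : ‖eval (Sum.elim x y) (segmentAvg F)‖ ≤ M := by
  rw [eval_segmentAvg]
  refine (intervalIntegral.norm_integral_le_of_norm_le_const (C := M) fun t ht => ?_).trans_eq
    (by simp)
  rw [Set.uIoc_of_le zero_le_one] at ht
  refine hM _ ?_
  have := hΩ.add_smul_sub_mem hy hx ⟨ht.1.le, ht.2⟩
  convert this using 1
  ext i
  simp

theorem eval_segmentAvg_diag (x : Fin n → ℂ) (F : MvPolynomial (Fin n) ℂ) :
    eval (Sum.elim x x) (segmentAvg F) = eval x F := by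
  rw [eval_segmentAvg]
  simp

/-- The substitution `t ↦ 1 - t`. This symmetry is behind both the symmetry in `(i, j)` and the
reality of the functionals. -/
theorem rename_swap_segmentAvg (F : MvPolynomial (Fin n) ℂ) :
    rename Sum.swap (segmentAvg F) = segmentAvg F := by
  refine segmentAvg_ext fun x y => ?_
  have : Sum.elim x y ∘ Sum.swap = Sum.elim y x := by
    ext i; rcases i with i | i <;> rfl
  rw [eval_rename, this, eval_segmentAvg, eval_segmentAvg]
  have := intervalIntegral.integral_comp_sub_left (a := 0) (b := 1)
    (fun t : ℝ => eval (fun i => y i + t * (x i - y i)) F) 1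
  simp only [sub_zero, sub_self] at this
  rw [← this]
  congr 1
  ext t
  congr 2
  ext i
  push_cast
  ring

theorem map_conj_segmentAvg (F : MvPolynomial (Fin n) ℂ) (hF : map (starRingEnd ℂ) F = F) :
    map (starRingEnd ℂ) (segmentAvg F) = segmentAvg F := by
  have key : ∀ {σ : Type} (z : σ → ℂ) (p : MvPolynomial σ ℂ),
      eval z (map (starRingEnd ℂ) p) = starRingEnd ℂ (eval (fun i => starRingEnd ℂ (z i)) p) := by
    intro σ z p
    have : (eval z).comp (map (starRingEnd ℂ))
        = (starRingEnd ℂ).comp (eval (fun i => starRingEnd ℂ (z i))) := by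
      apply MvPolynomial.ringHom_ext <;> simp
    exact DFunLike.congr_fun this p
  refine segmentAvg_ext fun x y => ?_
  have e : (fun i => starRingEnd ℂ (Sum.elim x y i))
      = Sum.elim (fun i => starRingEnd ℂ (x i)) (fun i => starRingEnd ℂ (y i)) := by
    ext i; rcases i with i | i <;> rfl
  rw [key, e, eval_segmentAvg, eval_segmentAvg, intervalIntegral.integral_of_le zero_le_one,
    intervalIntegral.integral_of_le zero_le_one, ← integral_conj]
  congr 1
  ext t
  conv_rhs => rw [← hF, key]
  simp

theorem hasDerivAt_eval_mvPolynomial {σ 𝕜 : Type*} [Fintype σ] [NontriviallyNormedField 𝕜]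
    [NormedAlgebra 𝕜 ℂ] {c : 𝕜 → σ → ℂ} {c' : σ → ℂ} {t : 𝕜}
    (hc : ∀ i, HasDerivAt (fun s => c s i) (c' i) t) (F : MvPolynomial σ ℂ) :
    HasDerivAt (fun s => eval (c s) F) (∑ i, eval (c t) (pderiv i F) * c' i) t := by
  classical
  induction F using MvPolynomial.induction_on with
  | C a => simpa using hasDerivAt_const t a
  | add p q hp hq =>
    have := hp.add hq
    simp only [map_add, add_mul, Finset.sum_add_distrib]
    exact this
  | mul_X p i hp =>
    have := hp.mul (hc i)
    simp only [map_mul, eval_X, Derivation.leibniz, smul_eq_mul, map_add, pderiv_X, add_mul,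
      Finset.sum_add_distrib]
    refine (show HasDerivAt (fun s => eval (c s) p * c s i) _ t from this).congr_deriv ?_
    rw [add_comm]
    congr 1
    · rw [Finset.sum_eq_single i]
      · simp
      · intro j _ hj
        simp [hj.symm]
      · simp
    · rw [Finset.sum_mul]
      exact Finset.sum_congr rfl fun j _ => by ring

/-- The fundamental theorem of calculus on the segment from `y` to `x`. It writes `f(λ) - f(μ)` with
coefficients controlled by the gradient of `f`. -/
theorem segmentAvg_pderiv (F : MvPolynomial (Fin n) ℂ) :
    ∑ i, segmentAvg (pderiv i F) * (X (Sum.inl i) - X (Sum.inr i))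
      = rename Sum.inl F - rename Sum.inr F := by
  refine segmentAvg_ext fun x y => ?_
  have e1 : Sum.elim x y ∘ Sum.inl = x := rfl
  have e2 : Sum.elim x y ∘ Sum.inr = y := rfl
  rw [map_sub, eval_rename, eval_rename, e1, e2, map_sum]
  simp only [map_mul, map_sub, eval_X, Sum.elim_inl, Sum.elim_inr, eval_segmentAvg]
  have hd : ∀ t : ℝ, HasDerivAt (fun s : ℝ => eval (fun i => y i + s * (x i - y i)) F)
      (∑ i, eval (fun i => y i + t * (x i - y i)) (pderiv i F) * (x i - y i)) t := by
    intro t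
    refine hasDerivAt_eval_mvPolynomial (c := fun (s : ℝ) i => y i + s * (x i - y i)) (fun i => ?_) F
    simpa using ((Complex.ofRealCLM.hasDerivAt (x := t)).mul_const (x i - y i)).const_add (y i)
  have hc : ∀ i, Continuous fun t : ℝ => eval (fun i => y i + t * (x i - y i)) (pderiv i F) :=
    fun i => continuous_eval_segment x y _
  have := intervalIntegral.integral_eq_sub_of_hasDerivAt (fun t _ => hd t)
    (Continuous.intervalIntegrable (by fun_prop) 0 1)
  rw [intervalIntegral.integral_finsetSum
    (fun i _ => Continuous.intervalIntegrable (by fun_prop) 0 1)] at this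
  simp only [intervalIntegral.integral_mul_const] at this
  rw [this]
  simp

end Segment

/-! ### Two-sided functional calculus. -/

section BiAeval

open MvPolynomial

variable {n : ℕ} {R : Type*} [Ring R] [Algebra ℂ R]

/-- Evaluation of polynomials in `(λ, μ)` with `λ` acting by left multiplication by `X` and `μ` by
right multiplication by `Y`. -/
def biAeval (X Y : Fin n → R) (hX : ∀ i j, Commute (X i) (X j)) (hY : ∀ i j, Commute (Y i) (Y j)) :
    MvPolynomial (Fin n ⊕ Fin n) ℂ →ₐ[ℂ] Module.End ℂ R :=
  commAeval (Sum.elim (fun i => LinearMap.mulLeft ℂ (X i)) fun i => LinearMap.mulRight ℂ (Y i)) (by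
    rintro (i | i) (j | j)
    · ext V
      simp only [Sum.elim_inl, Module.End.mul_apply, LinearMap.mulLeft_apply]
      rw [← mul_assoc, (hX i j).eq, mul_assoc]
    · exact LinearMap.commute_mulLeft_right _ _
    · exact (LinearMap.commute_mulLeft_right _ _).symm
    · ext V
      simp only [Sum.elim_inr, Module.End.mul_apply, LinearMap.mulRight_apply]
      rw [mul_assoc, (hY j i).eq, mul_assoc])

variable {X Y : Fin n → R} {hX : ∀ i j, Commute (X i) (X j)} {hY : ∀ i j, Commute (Y i) (Y j)}

theorem biAeval_X_inl (i : Fin n) (V : R) :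
    biAeval X Y hX hY (MvPolynomial.X (Sum.inl i)) V = X i * V := by
  simp [biAeval]

theorem biAeval_X_inr (i : Fin n) (V : R) :
    biAeval X Y hX hY (MvPolynomial.X (Sum.inr i)) V = V * Y i := by
  simp [biAeval]

theorem biAeval_rename_inl (p : MvPolynomial (Fin n) ℂ) (V : R) :
    biAeval X Y hX hY (rename Sum.inl p) V = commAeval X hX p * V := by
  induction p using MvPolynomial.induction_on generalizing V with
  | C a =>
    rw [rename_C, ← algebraMap_eq, ← algebraMap_eq, AlgHom.commutes, AlgHom.commutes,
      Module.algebraMap_end_apply, Algebra.smul_def]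
  | add p q hp hq => simp [hp, hq, add_mul]
  | mul_X p i hp => simp [hp, biAeval_X_inl, mul_assoc]

theorem biAeval_rename_inr (p : MvPolynomial (Fin n) ℂ) (V : R) :
    biAeval X Y hX hY (rename Sum.inr p) V = V * commAeval Y hY p := by
  induction p using MvPolynomial.induction_on generalizing V with
  | C a =>
    rw [rename_C, ← algebraMap_eq, ← algebraMap_eq, AlgHom.commutes, AlgHom.commutes,
      Module.algebraMap_end_apply, Algebra.smul_def, Algebra.commutes]
  | add p q hp hq => simp [hp, hq, mul_add]
  | mul_X p i hp =>
    rw [map_mul, map_mul, rename_X, Module.End.mul_apply, biAeval_X_inr, hp, mul_comm p, map_mul,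
      commAeval_X, mul_assoc]

theorem biAeval_rename_mul (p q : MvPolynomial (Fin n) ℂ) (V : R) :
    biAeval X Y hX hY (rename Sum.inl p * rename Sum.inr q) V
      = commAeval X hX p * V * commAeval Y hY q := by
  rw [map_mul, Module.End.mul_apply, biAeval_rename_inl, biAeval_rename_inr, mul_assoc]

/-- Every polynomial in `(λ, μ)` is a sum of products `p(λ) q(μ)`, whose action is `V ↦ p(X) V
q(Y)`; identities for `biAeval` reduce to these. -/
theorem MvPolynomial.induction_on_rename_mul {P : MvPolynomial (Fin n ⊕ Fin n) ℂ → Prop}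
    (φ : MvPolynomial (Fin n ⊕ Fin n) ℂ)
    (add : ∀ φ ψ, P φ → P ψ → P (φ + ψ))
    (mul : ∀ p q : MvPolynomial (Fin n) ℂ, P (rename Sum.inl p * rename Sum.inr q)) : P φ := by
  have key : φ ∈ AddSubmonoid.closure {ψ : MvPolynomial (Fin n ⊕ Fin n) ℂ |
      ∃ p q : MvPolynomial (Fin n) ℂ, rename Sum.inl p * rename Sum.inr q = ψ} := by
    induction φ using MvPolynomial.induction_on with
    | C a => exact AddSubmonoid.subset_closure ⟨C a, 1, by simp⟩
    | add p q hp hq => exact add_mem hp hq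
    | mul_X p i hp =>
      induction hp using AddSubmonoid.closure_induction with
      | mem ψ hψ =>
        obtain ⟨p, q, rfl⟩ := hψ
        rcases i with i | i
        · exact AddSubmonoid.subset_closure ⟨p * MvPolynomial.X i, q, by simp; ring⟩
        · exact AddSubmonoid.subset_closure ⟨p, q * MvPolynomial.X i, by simp; ring⟩
      | zero => simp
      | add φ ψ _ _ hφ hψ => rw [add_mul]; exact add_mem hφ hψ
  induction key using AddSubmonoid.closure_induction with
  | mem ψ hψ =>
    obtain ⟨p, q, rfl⟩ := hψ
    exact mul p q
  | zero => simpa using mul 0 0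
  | add φ ψ _ _ hφ hψ => exact add _ _ hφ hψ

/-- Difference quotient formula for polynomials in commuting tuples. -/
theorem commAeval_sub (f : MvPolynomial (Fin n) ℂ) :
    commAeval X hX f - commAeval Y hY f
      = ∑ i, biAeval X Y hX hY (segmentAvg (pderiv i f)) (X i - Y i) := by
  have h := congrArg (fun φ => biAeval X Y hX hY φ 1) (segmentAvg_pderiv f)
  simp only [map_sum, map_mul, map_sub, LinearMap.sum_apply, LinearMap.sub_apply,
    Module.End.mul_apply, biAeval_rename_inl, biAeval_rename_inr, biAeval_X_inl, biAeval_X_inr,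
    mul_one, one_mul] at h
  simpa only [map_sub] using h.symm

theorem rename_diag_segmentAvg (F : MvPolynomial (Fin n) ℂ) :
    rename (Sum.elim id id) (segmentAvg F) = F := by
  refine MvPolynomial.funext fun x => ?_
  rw [eval_rename, ← eval_segmentAvg_diag x F]
  congr 2
  ext i; rcases i with i | i <;> rfl

end BiAeval

/-! ### Calculus for the possibly discontinuous trace functional. -/

section FinDimValued

variable {R : Type*} [NormedRing R] [NormedAlgebra ℂ R]

/-- Functions with values in a finite-dimensional subspace. -/
def FinDimValued (F : ℝ → R) : Prop := ∃ W : Submodule ℂ R, W.FG ∧ ∀ s, F s ∈ W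

theorem FinDimValued.const (c : R) : FinDimValued fun _ : ℝ => c :=
  ⟨Submodule.span ℂ {c}, Submodule.fg_span_singleton c, fun _ => Submodule.mem_span_singleton_self c⟩

theorem FinDimValued.add {F G : ℝ → R} (hF : FinDimValued F) (hG : FinDimValued G) :
    FinDimValued fun s => F s + G s := by
  obtain ⟨W, hW, hFW⟩ := hF
  obtain ⟨W', hW', hGW⟩ := hG
  exact ⟨W ⊔ W', hW.sup hW', fun s => Submodule.add_mem_sup (hFW s) (hGW s)⟩

theorem FinDimValued.mul {F G : ℝ → R} (hF : FinDimValued F) (hG : FinDimValued G) :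
    FinDimValued fun s => F s * G s := by
  obtain ⟨W, hW, hFW⟩ := hF
  obtain ⟨W', hW', hGW⟩ := hG
  exact ⟨W * W', hW.mul hW', fun s => Submodule.mul_mem_mul (hFW s) (hGW s)⟩

theorem exists_clm_eq_on (T : R →ₗ[ℂ] ℂ) (W : Submodule ℂ R) (hW : W.FG) :
    ∃ T' : R →L[ℂ] ℂ, ∀ w ∈ W, T' w = T w := by
  have : FiniteDimensional ℂ W := Module.Finite.iff_fg.2 hW
  obtain ⟨T', hT', -⟩ := exists_extension_norm_eq W (LinearMap.toContinuousLinearMap (T.domRestrict W))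
  exact ⟨T', fun w hw => hT' ⟨w, hw⟩⟩

/-- On the finite-dimensional span of the values and of `D`, any linear functional agrees with a
continuous one, which may be moved through the derivative. -/
theorem FinDimValued.hasDerivAt_comp {F : ℝ → R} (hF : FinDimValued F) (T : R →ₗ[ℂ] ℂ) {D : R}
    {s : ℝ} (h : HasDerivAt F D s) : HasDerivAt (fun s => T (F s)) (T D) s := by
  obtain ⟨W, hW, hFW⟩ := hF
  obtain ⟨T', hT'⟩ := exists_clm_eq_on T (W ⊔ Submodule.span ℂ {D})
    (hW.sup (Submodule.fg_span_singleton D))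
  have e : (fun s => T (F s)) = fun s => T' (F s) :=
    funext fun s => (hT' _ (Submodule.mem_sup_left (hFW s))).symm
  rw [e, ← hT' D (Submodule.mem_sup_right (Submodule.mem_span_singleton_self D))]
  exact (T'.restrictScalars ℝ).hasFDerivAt.comp_hasDerivAt s h

theorem FinDimValued.continuous_comp {F : ℝ → R} (hF : FinDimValued F) (T : R →ₗ[ℂ] ℂ)
    (h : Continuous F) : Continuous fun s => T (F s) := by
  obtain ⟨W, hW, hFW⟩ := hF
  obtain ⟨T', hT'⟩ := exists_clm_eq_on T W hW
  have e : (fun s => T (F s)) = fun s => T' (F s) := funext fun s => (hT' _ (hFW s)).symm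
  rw [e]
  exact T'.continuous.comp h

end FinDimValued

/-! ### Derivatives of polynomials along the linear path. -/

section Path

open MvPolynomial

variable {n : ℕ} {H : Type*} [NormedAddCommGroup H] [InnerProductSpace ℂ H] [CompleteSpace H]

theorem continuous_linPath (A B : Fin n → H →L[ℂ] H) (j : Fin n) :
    Continuous fun s => linPath A B s j := by
  unfold linPath
  fun_prop

theorem finDimValued_linPath (A B : Fin n → H →L[ℂ] H) (j : Fin n) :
    FinDimValued fun s => linPath A B s j := by
  refine ⟨Submodule.span ℂ {A j} ⊔ Submodule.span ℂ {B j - A j},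
    (Submodule.fg_span_singleton _).sup (Submodule.fg_span_singleton _), fun s => ?_⟩
  refine Submodule.add_mem_sup (Submodule.mem_span_singleton_self _) ?_
  rw [← Complex.coe_smul]
  exact Submodule.smul_mem _ _ (Submodule.mem_span_singleton_self _)

theorem linPath_sub (A B : Fin n → H →L[ℂ] H) (s t : ℝ) (j : Fin n) :
    linPath A B s j - linPath A B t j = ((s - t : ℝ) : ℂ) • (B j - A j) := by
  rw [Complex.coe_smul, linPath, linPath, sub_smul]
  abel

/-- If the tuples at the parameters `0` and `1` commute and so do the increments, then all tuples on
the line commute. -/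
theorem commute_linPath {A B : Fin n → H →L[ℂ] H} (hA : ∀ i j, Commute (A i) (A j))
    (hB : ∀ i j, Commute (B i) (B j)) (hV : ∀ i j, Commute (B i - A i) (B j - A j)) (s : ℝ)
    (i j : Fin n) : Commute (linPath A B s i) (linPath A B s j) := by
  have h1 := (hA i j).eq
  have h2 := (hB i j).eq
  have h3 := (hV i j).eq
  -- The part linear in `s` of the commutator, obtained from `[Bᵢ, Bⱼ] = 0` after removing `[Aᵢ,
  -- Aⱼ]` and `[Vᵢ, Vⱼ]`.
  have key : A i * (B j - A j) + (B i - A i) * A j = A j * (B i - A i) + (B j - A j) * A i := by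
    linear_combination (norm := noncomm_ring) h2 - h1 - h3
  unfold Commute SemiconjBy linPath
  simp only [mul_add, add_mul, smul_mul_assoc, mul_smul_comm, h1, h3]
  have h5 : s • (A i * (B j - A j)) + s • ((B i - A i) * A j)
      = s • (A j * (B i - A i)) + s • ((B j - A j) * A i) := by
    rw [← smul_add, ← smul_add, key]
  calc _ = A j * A i + (s • (A i * (B j - A j)) + s • ((B i - A i) * A j))
        + s • s • ((B j - A j) * (B i - A i)) := by simp only [smul_add]; abel
    _ = _ := by rw [h5]; simp only [smul_add]; abel

variable {A B : Fin n → H →L[ℂ] H}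
  (hc : ∀ (s : ℝ) (i j : Fin n), Commute (linPath A B s i) (linPath A B s j))

theorem continuous_commAeval_linPath (p : MvPolynomial (Fin n) ℂ) :
    Continuous fun s => commAeval (linPath A B s) (hc s) p := by
  induction p using MvPolynomial.induction_on with
  | C a => simpa [← algebraMap_eq] using continuous_const
  | add p q hp hq => simpa only [map_add] using! hp.add hq
  | mul_X p i hp => simpa only [map_mul, commAeval_X] using! hp.mul (continuous_linPath A B i)

theorem finDimValued_commAeval_linPath (p : MvPolynomial (Fin n) ℂ) :
    FinDimValued fun s => commAeval (linPath A B s) (hc s) p := by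
  induction p using MvPolynomial.induction_on with
  | C a => simpa [← algebraMap_eq] using FinDimValued.const _
  | add p q hp hq => simpa only [map_add] using! hp.add hq
  | mul_X p i hp => simpa only [map_mul, commAeval_X] using! hp.mul (finDimValued_linPath A B i)

theorem continuous_biAeval_linPath (φ : MvPolynomial (Fin n ⊕ Fin n) ℂ) (V : H →L[ℂ] H) (t : ℝ) :
    Continuous fun s => biAeval (linPath A B s) (linPath A B t) (hc s) (hc t) φ V := by
  induction φ using MvPolynomial.induction_on_rename_mul with
  | add φ ψ hφ hψ => simpa only [map_add, LinearMap.add_apply] using! hφ.add hψ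
  | mul p q =>
    simp only [biAeval_rename_mul]
    exact ((continuous_commAeval_linPath hc p).mul continuous_const).mul continuous_const

theorem continuous_biAeval_linPath_diag (φ : MvPolynomial (Fin n ⊕ Fin n) ℂ) (V : H →L[ℂ] H) :
    Continuous fun s => biAeval (linPath A B s) (linPath A B s) (hc s) (hc s) φ V := by
  induction φ using MvPolynomial.induction_on_rename_mul with
  | add φ ψ hφ hψ => simpa only [map_add, LinearMap.add_apply] using! hφ.add hψ
  | mul p q =>
    simp only [biAeval_rename_mul]
    exact ((continuous_commAeval_linPath hc p).mul continuous_const).mul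
      (continuous_commAeval_linPath hc q)

theorem finDimValued_biAeval_linPath_diag (φ : MvPolynomial (Fin n ⊕ Fin n) ℂ) (V : H →L[ℂ] H) :
    FinDimValued fun s => biAeval (linPath A B s) (linPath A B s) (hc s) (hc s) φ V := by
  induction φ using MvPolynomial.induction_on_rename_mul with
  | add φ ψ hφ hψ => simpa only [map_add, LinearMap.add_apply] using! hφ.add hψ
  | mul p q =>
    simp only [biAeval_rename_mul]
    exact ((finDimValued_commAeval_linPath hc p).mul (FinDimValued.const V)).mul
      (finDimValued_commAeval_linPath hc q)

/-- The derivative of `f` along the path. -/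
def pathDeriv (s : ℝ) (f : MvPolynomial (Fin n) ℂ) : H →L[ℂ] H :=
  ∑ i, biAeval (linPath A B s) (linPath A B s) (hc s) (hc s) (segmentAvg (pderiv i f)) (B i - A i)

/-- By `commAeval_sub` the slope between `s` and `t` is a two-sided expression at `(X(t), X(s))`,
which is continuous in `t` and therefore converges to its value on the diagonal. -/
theorem hasDerivAt_commAeval_linPath (s : ℝ) (f : MvPolynomial (Fin n) ℂ) :
    HasDerivAt (fun s => commAeval (linPath A B s) (hc s) f) (pathDeriv hc s f) s := by
  rw [hasDerivAt_iff_tendsto_slope]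
  have hK : Continuous fun t => ∑ i, biAeval (linPath A B t) (linPath A B s) (hc t) (hc s)
      (segmentAvg (pderiv i f)) (B i - A i) :=
    continuous_finsetSum _ fun i _ => continuous_biAeval_linPath hc _ _ _
  refine ((hK.tendsto s).mono_left nhdsWithin_le_nhds).congr' ?_
  filter_upwards [self_mem_nhdsWithin] with t ht
  have ht' : ((t - s : ℝ) : ℂ) ≠ 0 := by
    exact_mod_cast sub_ne_zero.2 ht
  rw [slope_def_module, commAeval_sub (hX := hc t) (hY := hc s)]
  simp only [linPath_sub, map_smul, ← Finset.smul_sum]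
  rw [← Complex.coe_smul, smul_smul, Complex.ofReal_inv, inv_mul_cancel₀ ht', one_smul]

theorem pathDeriv_add (s : ℝ) (f g : MvPolynomial (Fin n) ℂ) :
    pathDeriv hc s (f + g) = pathDeriv hc s f + pathDeriv hc s g :=
  (hasDerivAt_commAeval_linPath hc s (f + g)).unique (by
    simpa only [map_add] using!
      (hasDerivAt_commAeval_linPath hc s f).add (hasDerivAt_commAeval_linPath hc s g))

theorem pathDeriv_mul (s : ℝ) (f g : MvPolynomial (Fin n) ℂ) :
    pathDeriv hc s (f * g) = pathDeriv hc s f * commAeval (linPath A B s) (hc s) g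
      + commAeval (linPath A B s) (hc s) f * pathDeriv hc s g :=
  (hasDerivAt_commAeval_linPath hc s (f * g)).unique (by
    simpa only [map_mul] using!
      (hasDerivAt_commAeval_linPath hc s f).mul (hasDerivAt_commAeval_linPath hc s g))

end Path

/-! ### Second-order Taylor formula under the trace. -/

namespace HilbertSchmidtTrace

open MvPolynomial

variable {n : ℕ} {H : Type*} [NormedAddCommGroup H] [InnerProductSpace ℂ H] [CompleteSpace H]
  (S : HilbertSchmidtTrace H)

theorem biAeval_mem {X Y : Fin n → H →L[ℂ] H} {hX : ∀ i j, Commute (X i) (X j)}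
    {hY : ∀ i j, Commute (Y i) (Y j)} (φ : MvPolynomial (Fin n ⊕ Fin n) ℂ) {V : H →L[ℂ] H}
    (hV : V ∈ S.J) : biAeval X Y hX hY φ V ∈ S.J := by
  induction φ using MvPolynomial.induction_on_rename_mul with
  | add φ ψ hφ hψ => simpa only [map_add, LinearMap.add_apply] using S.J.add_mem hφ hψ
  | mul p q =>
    rw [biAeval_rename_mul]
    exact S.mul_mem_right _ (S.mul_mem_left _ hV)

variable {A B : Fin n → H →L[ℂ] H}
  (hc : ∀ (s : ℝ) (i j : Fin n), Commute (linPath A B s i) (linPath A B s j))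

theorem pathDeriv_mem (hV : ∀ j, B j - A j ∈ S.J) (s : ℝ) (f : MvPolynomial (Fin n) ℂ) :
    pathDeriv hc s f ∈ S.J :=
  S.J.sum_mem fun i _ => S.biAeval_mem _ (hV i)

/-- For `φ = p(λ) q(μ)` the derivative of `p V q` is `p' V q + p V q'`. Since `p'` and `q'` lie in
`J`, cyclicity applies to the derivative and collects it as `T(V (q p)')`; the undifferentiated `p V
q` is not known to lie in `I`. -/
theorem hasDerivAt_T_biAeval (hV : ∀ j, B j - A j ∈ S.J) {V : H →L[ℂ] H} (hVJ : V ∈ S.J) (s : ℝ)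
    (φ : MvPolynomial (Fin n ⊕ Fin n) ℂ) :
    HasDerivAt (fun s => S.T (biAeval (linPath A B s) (linPath A B s) (hc s) (hc s) φ V))
      (S.T (V * pathDeriv hc s (rename (Sum.elim id id) φ))) s := by
  induction φ using MvPolynomial.induction_on_rename_mul with
  | add φ ψ hφ hψ =>
    simp only [map_add, LinearMap.add_apply, pathDeriv_add, mul_add]
    exact hφ.add hψ
  | mul p q =>
    have hd := ((hasDerivAt_commAeval_linPath hc s p).mul_const V).mul
      (hasDerivAt_commAeval_linPath hc s q)
    have h := (((finDimValued_commAeval_linPath hc p).mul (FinDimValued.const V)).mul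
      (finDimValued_commAeval_linPath hc q)).hasDerivAt_comp S.T hd
    simp only [biAeval_rename_mul]
    refine h.congr_deriv ?_
    have hp := S.pathDeriv_mem hc hV s p
    have hq := S.pathDeriv_mem hc hV s q
    have e : rename (Sum.elim id id) (rename Sum.inl p * rename Sum.inr q) = q * p := by
      rw [map_mul, rename_rename, rename_rename, mul_comm]
      congr 1
      · exact rename_id_apply q
      · exact rename_id_apply p
    rw [e, pathDeriv_mul, mul_add, map_add, map_add, add_comm]
    congr 1
    · rw [S.comm (S.mul_mem_left _ hVJ) hq, ← mul_assoc, S.comm (S.mul_mem_right _ hq) hVJ]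
    · rw [mul_assoc, S.comm hp (S.mul_mem_right _ hVJ), mul_assoc]

/-- Second-order Taylor formula for the trace along a path of commuting tuples. -/
theorem T_taylor (hV : ∀ j, B j - A j ∈ S.J) (f : MvPolynomial (Fin n) ℂ) :
    S.T (commAeval (linPath A B 1) (hc 1) f - commAeval (linPath A B 0) (hc 0) f
        - pathDeriv hc 0 f)
      = ∑ j, ∑ i, ∫ s in (0 : ℝ)..1, (1 - s) * S.T ((B j - A j) *
          biAeval (linPath A B s) (linPath A B s) (hc s) (hc s)
            (segmentAvg (pderiv i (pderiv j f))) (B i - A i)) := by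
  set q : ℝ → ℂ := fun s => S.T (commAeval (linPath A B s) (hc s) f) with hq
  set q' : ℝ → ℂ := fun s => S.T (pathDeriv hc s f) with hq'
  set q'' : ℝ → ℂ := fun s => ∑ j, ∑ i, S.T ((B j - A j) *
          biAeval (linPath A B s) (linPath A B s) (hc s) (hc s)
            (segmentAvg (pderiv i (pderiv j f))) (B i - A i)) with hq''
  have h1 : ∀ s, HasDerivAt q (q' s) s := fun s =>
    (finDimValued_commAeval_linPath hc f).hasDerivAt_comp S.T (hasDerivAt_commAeval_linPath hc s f)
  have h2 : ∀ s, HasDerivAt q' (q'' s) s := fun s => by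
    have : HasDerivAt q' (∑ j, S.T ((B j - A j) * pathDeriv hc s (pderiv j f))) s := by
      simp only [hq', pathDeriv, map_sum]
      refine HasDerivAt.fun_sum fun j _ => ?_
      have := S.hasDerivAt_T_biAeval hc hV (hV j) s (segmentAvg (pderiv j f))
      rw [rename_diag_segmentAvg] at this
      simpa only [pathDeriv, map_sum] using this
    refine this.congr_deriv ?_
    simp only [hq'', pathDeriv, Finset.mul_sum, map_sum]
  have hcont : ∀ i j, Continuous fun s => S.T ((B j - A j) *
          biAeval (linPath A B s) (linPath A B s) (hc s) (hc s)
            (segmentAvg (pderiv i (pderiv j f))) (B i - A i)) := fun i j =>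
    ((FinDimValued.const _).mul (finDimValued_biAeval_linPath_diag hc _ _)).continuous_comp S.T
      (continuous_const.mul (continuous_biAeval_linPath_diag hc _ _))
  -- The function `(1 - s) q' + q` is an antiderivative of `(1 - s) q''`, and its increment over
  -- `[0, 1]` is `q(1) - q(0) - q'(0)`.
  have h3 : ∀ s ∈ Set.uIcc (0 : ℝ) 1, HasDerivAt (fun s : ℝ => (1 - (s : ℂ)) * q' s + q s)
      ((1 - (s : ℂ)) * q'' s) s := fun s _ => by
    have h := ((((Complex.ofRealCLM.hasDerivAt (x := s)).const_sub 1).mul (h2 s)).add (h1 s))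
    refine HasDerivAt.congr_deriv (f := fun s : ℝ => (1 - (s : ℂ)) * q' s + q s) h ?_
    simp
  have h4 := intervalIntegral.integral_eq_sub_of_hasDerivAt h3
    (Continuous.intervalIntegrable (by fun_prop) 0 1)
  simp only [hq'', Finset.mul_sum] at h4
  rw [intervalIntegral.integral_finsetSum
    (fun i _ => Continuous.intervalIntegrable (by fun_prop) 0 1), Finset.sum_congr rfl fun j _ =>
      intervalIntegral.integral_finsetSum
        (fun i _ => Continuous.intervalIntegrable (by fun_prop) 0 1)] at h4
  rw [h4]
  simp [hq, hq']
  ring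

end HilbertSchmidtTrace

/-! ### Von Neumann type inequality and symmetries of the trace form. -/

namespace HilbertSchmidtTrace

open MvPolynomial

variable {n : ℕ} {H : Type*} [NormedAddCommGroup H] [InnerProductSpace ℂ H] [CompleteSpace H]
  (S : HilbertSchmidtTrace H) {X : Fin n → H →L[ℂ] H} (hX : ∀ i j, Commute (X i) (X j))

/-- The finite set collects the factors of the terms `p(λ) q(μ)` of `φ`. For such a term the double
sum is exactly `T(W p' V q')`, with `p'`, `q'` the approximants, so the error telescopes and is
controlled by the field `bdd`. -/
theorem T_mul_biAeval_approx {V W : H →L[ℂ] H} (hV : V ∈ S.J) (hW : W ∈ S.J)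
    (φ : MvPolynomial (Fin n ⊕ Fin n) ℂ) :
    ∃ (F : Finset (MvPolynomial (Fin n) ℂ)) (C : ℝ), 0 ≤ C ∧
      ∀ (δ : ℝ), 0 < δ → δ ≤ 1 → ∀ (N : ℕ) (P : Fin N → H →L[ℂ] H) (x : Fin N → Fin n → ℂ),
        (∀ p ∈ F, ‖commAeval X hX p - ∑ r, (eval (x r) p) • P r‖ ≤ δ) →
        ‖S.T (W * biAeval X X hX hX φ V) - ∑ r, ∑ s, eval (Sum.elim (x r) (x s)) φ *
          S.T (W * (P r * V * P s))‖ ≤ C * δ := by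
  classical
  induction φ using MvPolynomial.induction_on_rename_mul with
  | add φ ψ hφ hψ =>
    obtain ⟨F, C, hC, h⟩ := hφ
    obtain ⟨F', C', hC', h'⟩ := hψ
    refine ⟨F ∪ F', C + C', add_nonneg hC hC', fun δ h0 h1 N P x hF => ?_⟩
    have e1 := h δ h0 h1 N P x fun p hp => hF p (Finset.mem_union_left _ hp)
    have e2 := h' δ h0 h1 N P x fun p hp => hF p (Finset.mem_union_right _ hp)
    refine le_trans (le_of_eq ?_) ((norm_add_le_of_le e1 e2).trans_eq (by ring))
    congr 1
    simp only [map_add, LinearMap.add_apply, mul_add, add_mul, Finset.sum_add_distrib]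
    ring
  | mul p q =>
    obtain ⟨C, hC, hb⟩ := S.bdd hV hW
    refine ⟨{p, q}, C * (‖commAeval X hX q‖ + (‖commAeval X hX p‖ + 1)), by positivity,
      fun δ h0 h1 N P x hF => ?_⟩
    have hp := hF p (by simp)
    have hq := hF q (by simp)
    set p' := ∑ r, (eval (x r) p) • P r with hp'
    set q' := ∑ r, (eval (x r) q) • P r with hq'
    -- The restriction `δ ≤ 1` serves here: it makes the constant independent of the approximation.
    have hpn : ‖p'‖ ≤ ‖commAeval X hX p‖ + 1 := by
      have := norm_le_norm_add_norm_sub (commAeval X hX p) p'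
      linarith
    have e : ∑ r, ∑ s, eval (Sum.elim (x r) (x s)) (rename Sum.inl p * rename Sum.inr q) *
          S.T (W * (P r * V * P s)) = S.T (W * (p' * V * q')) := by
      simp only [hp', hq', Finset.sum_mul, Finset.mul_sum, smul_mul_assoc, mul_smul_comm, map_sum,
        map_smul, map_mul, eval_rename, Sum.elim_comp_inl, Sum.elim_comp_inr, smul_eq_mul]
      rw [Finset.sum_comm]
      refine Finset.sum_congr rfl fun s _ => Finset.sum_congr rfl fun r _ => ?_
      ring
    rw [e, biAeval_rename_mul]
    have e2 : S.T (W * (commAeval X hX p * V * commAeval X hX q)) - S.T (W * (p' * V * q'))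
        = S.T (W * ((commAeval X hX p - p') * V * commAeval X hX q))
          + S.T (W * (p' * V * (commAeval X hX q - q'))) := by
      rw [← map_sub, ← map_add]
      congr 1
      noncomm_ring
    rw [e2]
    refine (norm_add_le_of_le (hb _ _) (hb _ _)).trans ?_
    calc _ ≤ C * δ * ‖commAeval X hX q‖ + C * (‖commAeval X hX p‖ + 1) * δ := by gcongr
      _ = _ := by ring

/-- The von Neumann type inequality for the trace. -/
theorem norm_T_mul_biAeval_le {Ω : Set (Fin n → ℂ)} (hΩ : HasSpectralApprox Ω X hX)
    {V W : H →L[ℂ] H} (hV : V ∈ S.J) (hW : W ∈ S.J)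
    (φ : MvPolynomial (Fin n ⊕ Fin n) ℂ) {M : ℝ}
    (hM : ∀ x ∈ Ω, ∀ y ∈ Ω, ‖eval (Sum.elim x y) φ‖ ≤ M) (hM0 : 0 ≤ M) :
    ‖S.T (W * biAeval X X hX hX φ V)‖ ≤ M * (√(S.sq V) * √(S.sq W)) := by
  obtain ⟨F, C, hC, h⟩ := S.T_mul_biAeval_approx hX hV hW φ
  have key : ∀ δ : ℝ, 0 < δ → δ ≤ 1 → ‖S.T (W * biAeval X X hX hX φ V)‖
      ≤ M * (√(S.sq V) * √(S.sq W)) + C * δ := by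
    intro δ h0 h1
    obtain ⟨N, P, x, hP, hP1, hx, happ⟩ := hΩ F δ h0
    have e1 := h δ h0 h1 N P x happ
    have e2 : ‖∑ r, ∑ s, eval (Sum.elim (x r) (x s)) φ * S.T (W * (P r * V * P s))‖
        ≤ M * (√(S.sq V) * √(S.sq W)) := by
      calc _ ≤ ∑ r, ∑ s, M * ‖S.T (W * (P r * V * P s))‖ := by
            refine norm_sum_le_of_le _ fun r _ => norm_sum_le_of_le _ fun s _ => ?_
            rw [norm_mul]
            exact mul_le_mul_of_nonneg_right (hM _ (hx r) _ (hx s)) (norm_nonneg _)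
        _ = M * ∑ r, ∑ s, ‖S.T (W * (P r * V * P s))‖ := by simp only [Finset.mul_sum]
        _ ≤ _ := by gcongr; exact S.sum_norm_T_sandwich_le hV hW P hP hP1
    have := norm_le_norm_add_norm_sub' (S.T (W * biAeval X X hX hX φ V))
      (∑ r, ∑ s, eval (Sum.elim (x r) (x s)) φ * S.T (W * (P r * V * P s)))
    linarith
  refine le_of_forall_pos_le_add fun ε hε => ?_
  refine (key (min 1 (ε / (C + 1))) (by positivity) (min_le_left _ _)).trans ?_
  gcongr
  calc C * min 1 (ε / (C + 1)) ≤ (C + 1) * (ε / (C + 1)) := by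
        gcongr
        · linarith
        · exact min_le_right _ _
    _ = ε := by field_simp

theorem T_mul_biAeval_swap {V W : H →L[ℂ] H} (hV : V ∈ S.J) (hW : W ∈ S.J)
    (φ : MvPolynomial (Fin n ⊕ Fin n) ℂ) :
    S.T (W * biAeval X X hX hX φ V) = S.T (V * biAeval X X hX hX (rename Sum.swap φ) W) := by
  induction φ using MvPolynomial.induction_on_rename_mul with
  | add φ ψ hφ hψ => simp only [map_add, LinearMap.add_apply, mul_add, hφ, hψ]
  | mul p q =>
    have e : rename Sum.swap (rename Sum.inl p * rename Sum.inr q)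
        = rename Sum.inl q * (rename Sum.inr p : MvPolynomial (Fin n ⊕ Fin n) ℂ) := by
      rw [map_mul, rename_rename, rename_rename, mul_comm]
      rfl
    rw [e, biAeval_rename_mul, biAeval_rename_mul]
    have e1 : W * (commAeval X hX p * V * commAeval X hX q)
        = (W * commAeval X hX p) * (V * commAeval X hX q) := by simp only [mul_assoc]
    rw [e1, S.comm (S.mul_mem_right _ hW) (S.mul_mem_right _ hV)]
    simp only [mul_assoc]

theorem star_commAeval (hs : ∀ j, IsSelfAdjoint (X j)) (p : MvPolynomial (Fin n) ℂ) :
    star (commAeval X hX p) = commAeval X hX (map (starRingEnd ℂ) p) := by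
  induction p using MvPolynomial.induction_on with
  | C a =>
    rw [map_C, ← algebraMap_eq, AlgHom.commutes, AlgHom.commutes,
      ← algebraMap_star_comm]
    rfl
  | add p q hp hq => simp [hp, hq]
  | mul_X p i hp =>
    rw [map_mul, map_mul, map_X, star_mul, hp, commAeval_X, (hs i).star_eq, ← commAeval_X X hX i,
      ← map_mul, mul_comm]

/-- Taking adjoints reverses products, which exchanges `λ` and `μ`, and conjugates the coefficients;
cyclicity returns `W` to the front. -/
theorem conj_T_mul_biAeval (hs : ∀ j, IsSelfAdjoint (X j)) {V W : H →L[ℂ] H} (hV : V ∈ S.J)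
    (hW : W ∈ S.J) (hVs : IsSelfAdjoint V) (hWs : IsSelfAdjoint W)
    (φ : MvPolynomial (Fin n ⊕ Fin n) ℂ) :
    starRingEnd ℂ (S.T (W * biAeval X X hX hX φ V))
      = S.T (W * biAeval X X hX hX (rename Sum.swap (map (starRingEnd ℂ) φ)) V) := by
  induction φ using MvPolynomial.induction_on_rename_mul with
  | add φ ψ hφ hψ => simp only [map_add, LinearMap.add_apply, mul_add, hφ, hψ]
  | mul p q =>
    have e : rename Sum.swap (map (starRingEnd ℂ) (rename Sum.inl p * rename Sum.inr q))
        = rename Sum.inl (map (starRingEnd ℂ) q) *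
          (rename Sum.inr (map (starRingEnd ℂ) p) : MvPolynomial (Fin n ⊕ Fin n) ℂ) := by
      rw [map_mul, map_mul, map_rename, map_rename, rename_rename, rename_rename, mul_comm]
      rfl
    rw [e, biAeval_rename_mul, biAeval_rename_mul, ← star_commAeval hX hs, ← star_commAeval hX hs,
      S.conj_T_mul hW (S.mul_mem_right _ (S.mul_mem_left _ hV)), star_mul, star_mul, hVs.star_eq,
      hWs.star_eq, S.comm hW]
    · simp only [mul_assoc]
    · exact S.mul_mem_right _ (S.mul_mem_left _ hV)

end HilbertSchmidtTrace

theorem isSelfAdjoint_linPath {n : ℕ} {H : Type*} [NormedAddCommGroup H] [InnerProductSpace ℂ H]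
    [CompleteSpace H] {A B : Fin n → H →L[ℂ] H} (hA : ∀ j, IsSelfAdjoint (A j))
    (hB : ∀ j, IsSelfAdjoint (B j)) (s : ℝ) (j : Fin n) : IsSelfAdjoint (linPath A B s j) := by
  change star (A j + s • (B j - A j)) = _
  rw [star_add, star_smul, star_sub, (hA j).star_eq, (hB j).star_eq, star_trivial]
  rfl

/-! ### The functionals to be represented by measures. -/

namespace HilbertSchmidtTrace

open MvPolynomial

variable {n : ℕ} {H : Type*} [NormedAddCommGroup H] [InnerProductSpace ℂ H] [CompleteSpace H]
  (S : HilbertSchmidtTrace H) {A B : Fin n → H →L[ℂ] H}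
  (hc : ∀ (s : ℝ) (i j : Fin n), Commute (linPath A B s i) (linPath A B s j))

theorem continuous_T_mul_biAeval (W V : H →L[ℂ] H) (φ : MvPolynomial (Fin n ⊕ Fin n) ℂ) :
    Continuous fun s =>
      S.T (W * biAeval (linPath A B s) (linPath A B s) (hc s) (hc s) φ V) :=
  ((FinDimValued.const _).mul (finDimValued_biAeval_linPath_diag hc _ _)).continuous_comp S.T
    (continuous_const.mul (continuous_biAeval_linPath_diag hc _ _))

/-- The trace form `F ↦ T(V_j Θ_s(Av F) V_i)` at the point `s` of the path. -/
def pathForm (i j : Fin n) (s : ℝ) : MvPolynomial (Fin n) ℂ →ₗ[ℂ] ℂ where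
  toFun F := S.T ((B j - A j) *
    biAeval (linPath A B s) (linPath A B s) (hc s) (hc s) (segmentAvg F) (B i - A i))
  map_add' F G := by
    rw [← segmentAvgₗ_apply, ← segmentAvgₗ_apply, ← segmentAvgₗ_apply, map_add, map_add,
      LinearMap.add_apply, mul_add, map_add]
  map_smul' c F := by
    rw [← segmentAvgₗ_apply, ← segmentAvgₗ_apply, map_smul, map_smul, LinearMap.smul_apply,
      mul_smul_comm, map_smul, RingHom.id_apply]

theorem continuous_pathForm (i j : Fin n) (F : MvPolynomial (Fin n) ℂ) :
    Continuous fun s : ℝ => (1 - (s : ℂ)) * S.pathForm hc i j s F :=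
  (continuous_const.sub Complex.continuous_ofReal).mul (S.continuous_T_mul_biAeval hc _ _ _)

/-- The functional whose representing measure appears in the second-order trace formula. -/
def taylorFunctional (i j : Fin n) : MvPolynomial (Fin n) ℂ →ₗ[ℂ] ℂ where
  toFun F := ∫ s in (0 : ℝ)..1, (1 - s) * S.pathForm hc i j s F
  map_add' F G := by
    rw [← intervalIntegral.integral_add ((S.continuous_pathForm hc i j F).intervalIntegrable _ _)
      ((S.continuous_pathForm hc i j G).intervalIntegrable _ _)]
    simp only [map_add, mul_add]
  map_smul' c F := by
    rw [RingHom.id_apply, smul_eq_mul, ← intervalIntegral.integral_const_mul]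
    simp only [map_smul, smul_eq_mul, mul_left_comm]

theorem taylorFunctional_apply (i j : Fin n) (F : MvPolynomial (Fin n) ℂ) :
    S.taylorFunctional hc i j F = ∫ s in (0 : ℝ)..1, (1 - s) * S.T ((B j - A j) *
      biAeval (linPath A B s) (linPath A B s) (hc s) (hc s) (segmentAvg F) (B i - A i)) := rfl

theorem T_taylor_eq_sum (hV : ∀ j, B j - A j ∈ S.J) (f : MvPolynomial (Fin n) ℂ) :
    S.T (commAeval (linPath A B 1) (hc 1) f - commAeval (linPath A B 0) (hc 0) f
        - pathDeriv hc 0 f)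
      = ∑ j, ∑ i, S.taylorFunctional hc i j (pderiv i (pderiv j f)) :=
  S.T_taylor hc hV f

/-- The trace inequality at each `s` is integrated against `(1 - s) ds`, whose mass is `1/2`. -/
theorem norm_taylorFunctional_le (hV : ∀ j, B j - A j ∈ S.J) {Ω : Set (Fin n → ℂ)}
    (hconv : Convex ℝ Ω) (hΩ : ∀ s ∈ Set.Icc (0 : ℝ) 1, HasSpectralApprox Ω (linPath A B s) (hc s))
    (i j : Fin n) (F : MvPolynomial (Fin n) ℂ) {M : ℝ} (hM : ∀ z ∈ Ω, ‖eval z F‖ ≤ M)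
    (hM0 : 0 ≤ M) :
    ‖S.taylorFunctional hc i j F‖
      ≤ 1 / 2 * √(S.sq (B i - A i)) * √(S.sq (B j - A j)) * M := by
  set C := M * (√(S.sq (B i - A i)) * √(S.sq (B j - A j))) with hC
  have hb : ∀ s ∈ Set.Ioc (0 : ℝ) 1, ‖(1 - (s : ℂ)) * S.T ((B j - A j) *
      biAeval (linPath A B s) (linPath A B s) (hc s) (hc s) (segmentAvg F) (B i - A i))‖
      ≤ (1 - s) * C := by
    intro s hs
    have h1 : ‖(1 - (s : ℂ))‖ = 1 - s := by
      rw [← Complex.ofReal_one, ← Complex.ofReal_sub, Complex.norm_real, Real.norm_of_nonneg]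
      linarith [hs.2]
    rw [norm_mul, h1]
    refine mul_le_mul_of_nonneg_left ?_ (by linarith [hs.2])
    exact S.norm_T_mul_biAeval_le (hc s) (hΩ s ⟨hs.1.le, hs.2⟩) (hV i) (hV j) _
      (fun x hx y hy => norm_eval_segmentAvg_le hconv hM hx hy) hM0
  rw [taylorFunctional_apply]
  refine (intervalIntegral.norm_integral_le_of_norm_le zero_le_one
    (g := fun s => (1 - s) * C) (Filter.Eventually.of_forall hb)
    (Continuous.intervalIntegrable (by fun_prop) _ _)).trans_eq ?_
  rw [intervalIntegral.integral_mul_const, intervalIntegral.integral_sub (by simp) (by simp)]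
  simp [hC]
  ring

theorem taylorFunctional_symm (hV : ∀ j, B j - A j ∈ S.J) (i j : Fin n)
    (F : MvPolynomial (Fin n) ℂ) :
    S.taylorFunctional hc i j F = S.taylorFunctional hc j i F := by
  rw [taylorFunctional_apply, taylorFunctional_apply]
  congr 1
  ext s
  rw [S.T_mul_biAeval_swap (hc s) (hV i) (hV j), rename_swap_segmentAvg]

theorem taylorFunctional_one (hV : ∀ j, B j - A j ∈ S.J) (i j : Fin n) :
    S.taylorFunctional hc i j 1 = 1 / 2 * S.T ((B i - A i) * (B j - A j)) := by
  have h1 : segmentAvg (1 : MvPolynomial (Fin n) ℂ) = 1 := segmentAvg_ext fun x y => by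
    rw [eval_segmentAvg]; simp
  rw [taylorFunctional_apply, h1]
  simp only [map_one, Module.End.one_apply]
  rw [intervalIntegral.integral_mul_const, S.comm (hV j) (hV i)]
  congr 1
  have : (fun s : ℝ => (1 - (s : ℂ))) = fun s : ℝ => ((1 - s : ℝ) : ℂ) := by
    ext s; simp
  rw [this, intervalIntegral.integral_ofReal, intervalIntegral.integral_sub (by simp) (by simp)]
  simp
  norm_num

/-- Conjugation replaces `Av F` by its conjugated swap, which for real `F` is `Av F` itself. -/
theorem taylorFunctional_im_eq_zero (hV : ∀ j, B j - A j ∈ S.J) (hA : ∀ j, IsSelfAdjoint (A j))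
    (hB : ∀ j, IsSelfAdjoint (B j)) (i j : Fin n) (F : MvPolynomial (Fin n) ℂ)
    (hF : map (starRingEnd ℂ) F = F) : (S.taylorFunctional hc i j F).im = 0 := by
  have hX := isSelfAdjoint_linPath hA hB
  rw [← Complex.conj_eq_iff_im, taylorFunctional_apply,
    intervalIntegral.integral_of_le zero_le_one, ← integral_conj]
  congr 1
  ext s
  rw [map_mul, S.conj_T_mul_biAeval (hc s) (hX s) (hV i) (hV j) ((hB i).sub (hA i))
    ((hB j).sub (hA j)), map_conj_segmentAvg F hF, rename_swap_segmentAvg]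
  simp

end HilbertSchmidtTrace

/-! ### The maximum principle on the polydisc. -/

section PolydiscMax

open MvPolynomial

variable {n : ℕ}

theorem convex_closedPolydisc : Convex ℝ (closedPolydisc n) := by
  have : closedPolydisc n = ⋂ j, {z : Fin n → ℂ | z j ∈ Metric.closedBall (0 : ℂ) 1} := by
    ext z; simp [closedPolydisc]
  rw [this]
  exact convex_iInter fun j => (convex_closedBall (0 : ℂ) 1).linear_preimage
    (LinearMap.proj j : (Fin n → ℂ) →ₗ[ℝ] ℂ)

theorem convex_realCube : Convex ℝ (realCube n) := by
  have : realCube n = closedPolydisc n ∩ ⋂ j, {z : Fin n → ℂ | (z j).im = 0} := by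
    ext z; simp [closedPolydisc, realCube, forall_and]
  rw [this]
  refine convex_closedPolydisc.inter (convex_iInter fun j => ?_)
  exact ((Complex.imLm.comp (LinearMap.proj j : (Fin n → ℂ) →ₗ[ℝ] ℂ)).ker).convex

/-- Maximum principle on the polydisc. -/
theorem norm_eval_le_of_forall_torus (F : MvPolynomial (Fin n) ℂ) {M : ℝ}
    (hM : ∀ z : Fin n → ℂ, (∀ j, ‖z j‖ = 1) → ‖eval z F‖ ≤ M) {z : Fin n → ℂ}
    (hz : z ∈ closedPolydisc n) : ‖eval z F‖ ≤ M := by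
  classical
  -- Induction on the set `t` of coordinates allowed inside the disc: the one-variable maximum
  -- principle pushes one more coordinate to the circle.
  have key : ∀ t : Finset (Fin n), ∀ z : Fin n → ℂ, (∀ j ∈ t, ‖z j‖ ≤ 1) →
      (∀ j ∉ t, ‖z j‖ = 1) → ‖eval z F‖ ≤ M := by
    intro t
    induction t using Finset.induction_on with
    | empty => exact fun z _ hz => hM z fun j => hz j (by simp)
    | insert i t hi ih =>
      intro z h1 h2
      have hd : Differentiable ℂ fun w : ℂ => eval (Function.update z i w) F := fun w =>
        (hasDerivAt_eval_mvPolynomial (c := fun w => Function.update z i w)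
          (c' := Pi.single i 1) (fun k => by
            by_cases hk : k = i
            · subst hk; simpa using! hasDerivAt_id w
            · simpa [hk] using hasDerivAt_const w (z k)) F).differentiableAt
      have := Complex.norm_le_of_forall_mem_frontier_norm_le (U := Metric.ball (0 : ℂ) 1)
        (f := fun w => eval (Function.update z i w) F) (C := M) Metric.isBounded_ball
        hd.diffContOnCl (fun w hw => ?_) (z := z i) ?_
      · simpa using this
      · rw [frontier_ball (0 : ℂ) one_ne_zero, mem_sphere_zero_iff_norm] at hw
        refine ih _ (fun j hj => ?_) fun j hj => ?_
        · have : j ≠ i := fun h => hi (h ▸ hj)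
          simpa [this] using h1 j (Finset.mem_insert_of_mem hj)
        · by_cases hji : j = i
          · subst hji; simpa using hw
          · simpa [hji] using h2 j (by simp [hji, hj])
      · rw [closure_ball (0 : ℂ) one_ne_zero]
        simpa using h1 i (Finset.mem_insert_self _ _)
  exact key Finset.univ z (fun j _ => hz j) (by simp)

end PolydiscMax

/-! ### Summation in the complete ideal norm. -/

section IdealSummation

variable {H : Type*} [NormedAddCommGroup H] [InnerProductSpace ℂ H] [CompleteSpace H]

/-- The ideal `I` carrying the topology of its ideal norm. -/
def NormedIdeal.Normed (I : NormedIdeal H) : Type _ := I.carrier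

namespace NormedIdeal.Normed

variable (I : NormedIdeal H)

instance : AddCommGroup I.Normed := inferInstanceAs (AddCommGroup I.carrier)

instance : SeminormedAddCommGroup I.Normed :=
  AddGroupSeminorm.toSeminormedAddCommGroup
    (E := I.Normed)
    { toFun := fun a => I.nrm a
      map_zero' := map_zero I.nrm
      add_le' := map_add_le_add I.nrm
      neg' := map_neg_eq_map I.nrm }

theorem completeSpace (hI : I.IsComplete) : CompleteSpace I.Normed := by
  refine Metric.complete_of_cauchySeq_tendsto fun u hu => ?_
  obtain ⟨a, ha⟩ := hI u fun δ hδ => by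
    obtain ⟨N, hN⟩ := Metric.cauchySeq_iff.1 hu δ hδ
    exact ⟨N, fun m hm k hk => by
      have := hN m hm k hk
      rwa [dist_eq_norm] at this⟩
  refine ⟨a, tendsto_iff_norm_sub_tendsto_zero.2 ha⟩

/-- The inclusion of the ideal into the algebra of operators. -/
def incl : I.Normed →+ (H →L[ℂ] H) := I.carrier.subtype.toAddMonoidHom

theorem continuous_incl : Continuous (incl I) := by
  obtain ⟨K, -, hK⟩ := I.bound
  exact AddMonoidHomClass.continuous_of_bound _ K fun a => hK a

/-- A linear functional on the ideal as an additive map. -/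
def functional (τ : I.carrier →ₗ[ℂ] ℂ) : I.Normed →+ ℂ := τ.toAddMonoidHom

theorem continuous_functional {τ : I.carrier →ₗ[ℂ] ℂ} (hτ : I.IsPosBddTrace τ) :
    Continuous (functional I τ) := by
  obtain ⟨M, -, hM⟩ := hτ.bdd
  exact AddMonoidHomClass.continuous_of_bound _ M fun a => hM a

end NormedIdeal.Normed

/-- A series which converges absolutely for the ideal norm can be summed under the trace. -/
theorem NormedIdeal.mem_and_tr_eq_of_hasSum {I : NormedIdeal H} (hI : I.IsComplete)
    {τ : I.carrier →ₗ[ℂ] ℂ} (hτ : I.IsPosBddTrace τ) {κ : Type*} {R : κ → I.carrier} {u : κ → ℝ}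
    (hu : Summable u) (hR : ∀ k, I.nrm (R k) ≤ u k) {Q : H →L[ℂ] H}
    (hQ : HasSum (fun k => (R k : H →L[ℂ] H)) Q) {t : ℂ} (ht : HasSum (fun k => τ (R k)) t) :
    Q ∈ I.carrier ∧ I.tr τ Q = t := by
  have := NormedIdeal.Normed.completeSpace I hI
  let R' : κ → I.Normed := R
  have hs : Summable R' := Summable.of_norm_bounded hu hR
  obtain ⟨a, ha⟩ := hs
  have h1 : (NormedIdeal.Normed.incl I a) = Q :=
    (ha.map _ (NormedIdeal.Normed.continuous_incl I)).unique hQ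
  have h2 : (NormedIdeal.Normed.functional I τ a) = t :=
    (ha.map _ (NormedIdeal.Normed.continuous_functional I hτ)).unique ht
  have h3 : Q ∈ I.carrier := h1 ▸ (show I.carrier from a).2
  refine ⟨h3, ?_⟩
  rw [NormedIdeal.tr, dif_pos h3, ← h2]
  exact congrArg τ (Subtype.ext h1.symm)

end IdealSummation

/-! ### Noncommutative words, their derivatives and their Taylor remainders. -/

section Words

variable {σ R : Type*}

/-- Derivative of a word `X_{j₁} ⋯ X_{jₗ}` in the direction `V`. -/
def wordDeriv [NonUnitalNonAssocSemiring R] [One R] (X V : σ → R) : List σ → R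
  | [] => 0
  | a :: w => V a * (w.map X).prod + X a * wordDeriv X V w

/-- The recursion that places remainders in `I`: the last term is a product of two elements of `J`
when the increments lie in `J`. -/
theorem word_remainder_cons [Ring R] (A B : σ → R) (a : σ) (w : List σ) :
    ((a :: w).map B).prod - ((a :: w).map A).prod - wordDeriv A (fun j => B j - A j) (a :: w)
      = B a * ((w.map B).prod - (w.map A).prod - wordDeriv A (fun j => B j - A j) w)
        + (B a - A a) * wordDeriv A (fun j => B j - A j) w := by
  simp only [wordDeriv, List.map_cons, List.prod_cons]
  noncomm_ring

theorem norm_word_le [NormedRing R] [NormOneClass R] {X : σ → R} {ρ : ℝ}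
    (hX : ∀ j, ‖X j‖ ≤ ρ) (w : List σ) : ‖(w.map X).prod‖ ≤ ρ ^ w.length := by
  induction w with
  | nil => simp
  | cons a w ih =>
    rw [List.map_cons, List.prod_cons, List.length_cons, pow_succ']
    exact (norm_mul_le _ _).trans (mul_le_mul (hX a) ih (norm_nonneg _)
      ((norm_nonneg _).trans (hX a)))

theorem norm_wordDeriv_le [NormedRing R] [NormOneClass R] {X V : σ → R} {ρ v : ℝ} (hρ : 1 ≤ ρ)
    (hv : 0 ≤ v) (hX : ∀ j, ‖X j‖ ≤ ρ) (hV : ∀ j, ‖V j‖ ≤ v) (w : List σ) :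
    ‖wordDeriv X V w‖ ≤ w.length * ρ ^ w.length * v := by
  induction w with
  | nil => simp [wordDeriv]
  | cons a w ih =>
    have h0 : (0 : ℝ) ≤ ρ ^ w.length := by positivity
    have h1 : ‖V a * (w.map X).prod‖ ≤ v * ρ ^ w.length := (norm_mul_le _ _).trans
      (mul_le_mul (hV a) (norm_word_le hX w) (norm_nonneg _) hv)
    have h2 : ‖X a * wordDeriv X V w‖ ≤ ρ * (w.length * ρ ^ w.length * v) :=
      (norm_mul_le _ _).trans (mul_le_mul (hX a) ih (norm_nonneg _) (by positivity))
    refine (norm_add_le_of_le h1 h2).trans ?_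
    rw [List.length_cons, pow_succ']
    push_cast
    nlinarith [mul_nonneg (mul_nonneg h0 hv) (sub_nonneg.2 hρ)]

theorem hasDerivAt_word [NormedRing R] [NormedAlgebra ℝ R] (A V : σ → R) (w : List σ) (s : ℝ) :
    HasDerivAt (fun s : ℝ => (w.map fun j => A j + s • V j).prod)
      (wordDeriv (fun j => A j + s • V j) V w) s := by
  induction w with
  | nil => simpa [wordDeriv] using hasDerivAt_const s (1 : R)
  | cons a w ih =>
    have h1 : HasDerivAt (fun s : ℝ => A a + s • V a) (V a) s := by
      simpa using! ((hasDerivAt_id s).smul_const (V a)).const_add (A a)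
    simpa only [List.map_cons, List.prod_cons, wordDeriv] using! h1.mul ih

end Words

/-! ### Ideal norm bounds for words. -/

section WordIdeal

variable {σ H : Type*} [NormedAddCommGroup H] [InnerProductSpace ℂ H] [CompleteSpace H]
  {I J : NormedIdeal H} {A B : σ → H →L[ℂ] H}

theorem NormedIdeal.nrm_mul_left_le (I : NormedIdeal H) (A : H →L[ℂ] H) (hA : ‖A‖ ≤ 1)
    {B : H →L[ℂ] H} (hB : B ∈ I.carrier) (h : A * B ∈ I.carrier) :
    I.nrm ⟨A * B, h⟩ ≤ I.nrm ⟨B, hB⟩ := by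
  have h1 := I.ideal_le A 1 ⟨B, hB⟩
  simp only [mul_one] at h1
  refine h1.trans ?_
  have h2 : ‖(1 : H →L[ℂ] H)‖ ≤ 1 := ContinuousLinearMap.norm_id_le
  have h3 := apply_nonneg I.nrm ⟨B, hB⟩
  calc ‖A‖ * I.nrm ⟨B, hB⟩ * ‖(1 : H →L[ℂ] H)‖ ≤ 1 * I.nrm ⟨B, hB⟩ * 1 := by gcongr
    _ = _ := by ring

theorem NormedIdeal.nrm_mul_right_le (I : NormedIdeal H) (A : H →L[ℂ] H) (hA : ‖A‖ ≤ 1)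
    {B : H →L[ℂ] H} (hB : B ∈ I.carrier) (h : B * A ∈ I.carrier) :
    I.nrm ⟨B * A, h⟩ ≤ I.nrm ⟨B, hB⟩ := by
  have h1 := I.ideal_le 1 A ⟨B, hB⟩
  simp only [one_mul] at h1
  refine h1.trans ?_
  have h2 : ‖(1 : H →L[ℂ] H)‖ ≤ 1 := ContinuousLinearMap.norm_id_le
  have h3 := apply_nonneg I.nrm ⟨B, hB⟩
  calc ‖(1 : H →L[ℂ] H)‖ * I.nrm ⟨B, hB⟩ * ‖A‖ ≤ 1 * I.nrm ⟨B, hB⟩ * 1 := by gcongr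
    _ = _ := by ring

theorem norm_word_le_one (hA : ∀ j, ‖A j‖ ≤ 1) (w : List σ) : ‖(w.map A).prod‖ ≤ 1 := by
  induction w with
  | nil => exact ContinuousLinearMap.norm_id_le
  | cons a w ih =>
    rw [List.map_cons, List.prod_cons]
    exact (norm_mul_le _ _).trans (mul_le_one₀ (hA a) (norm_nonneg _) ih)

theorem wordDeriv_mem_ideal (hA : ∀ j, ‖A j‖ ≤ 1) {V : σ → H →L[ℂ] H}
    (hV : ∀ j, V j ∈ J.carrier) {M : ℝ} (hM : ∀ j, J.nrm ⟨V j, hV j⟩ ≤ M) (w : List σ) :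
    ∃ h : wordDeriv A V w ∈ J.carrier, J.nrm ⟨wordDeriv A V w, h⟩ ≤ w.length * M := by
  induction w with
  | nil =>
    have e : (⟨0, J.carrier.zero_mem⟩ : J.carrier) = 0 := rfl
    exact ⟨J.carrier.zero_mem, by simp [wordDeriv, e]⟩
  | cons a w ih =>
    obtain ⟨h, ih⟩ := ih
    have h1 := J.mul_mem_right (w.map A).prod (hV a)
    have h2 := J.mul_mem_left (A a) h
    refine ⟨J.carrier.add_mem h1 h2, ?_⟩
    refine (map_add_le_add J.nrm ⟨_, h1⟩ ⟨_, h2⟩).trans ?_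
    have e1 := (J.nrm_mul_right_le _ (norm_word_le_one hA w) (hV a) h1).trans (hM a)
    have e2 := (J.nrm_mul_left_le _ (hA a) h h2).trans ih
    rw [List.length_cons]
    push_cast
    linarith

/-- The recursion adds at most `m M²` when a letter is put before a word of length `m`, and `m² + m
≤ (m + 1)²`. Growth polynomial in the length is what makes power series summable in the ideal norm.
-/
theorem word_remainder_mem (hJ : J.IsSqrtOf I) (hA : ∀ j, ‖A j‖ ≤ 1) (hB : ∀ j, ‖B j‖ ≤ 1)
    (hV : ∀ j, B j - A j ∈ J.carrier) {M : ℝ} (hM0 : 0 ≤ M)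
    (hM : ∀ j, J.nrm ⟨B j - A j, hV j⟩ ≤ M) (w : List σ) :
    ∃ h : (w.map B).prod - (w.map A).prod - wordDeriv A (fun j => B j - A j) w ∈ I.carrier,
      I.nrm ⟨_, h⟩ ≤ (w.length : ℝ) ^ 2 * M ^ 2 := by
  induction w with
  | nil =>
    have : (([] : List σ).map B).prod - ([].map A).prod
        - wordDeriv A (fun j => B j - A j) [] = 0 := by
      simp [wordDeriv]
    refine ⟨this ▸ I.carrier.zero_mem, ?_⟩
    have e : (⟨_, this ▸ I.carrier.zero_mem⟩ : I.carrier) = 0 := Subtype.ext this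
    rw [e, map_zero]
    positivity
  | cons a w ih =>
    obtain ⟨h, ih⟩ := ih
    obtain ⟨hD, hDM⟩ := wordDeriv_mem_ideal hA hV hM w
    have h1 := I.mul_mem_left (B a) h
    have h2 := hJ.mul_mem (hV a) hD
    have e := word_remainder_cons A B a w
    have hmem := e ▸ I.carrier.add_mem h1 h2
    refine ⟨hmem, ?_⟩
    have e' : (⟨_, hmem⟩ : I.carrier) = ⟨_, h1⟩ + ⟨_, h2⟩ := Subtype.ext e
    rw [e']
    refine (map_add_le_add I.nrm ⟨_, h1⟩ ⟨_, h2⟩).trans ?_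
    have e1 := (I.nrm_mul_left_le _ (hB a) h h1).trans ih
    have e2 := (hJ.nrm_mul_le ⟨_, hV a⟩ ⟨_, hD⟩ h2).trans
      (mul_le_mul (hM a) hDM (apply_nonneg _ _) hM0)
    rw [List.length_cons]
    push_cast
    nlinarith [mul_nonneg (Nat.cast_nonneg (α := ℝ) w.length) (sq_nonneg M), sq_nonneg M]

end WordIdeal

/-! ### Differentiation and trace of operator power series. -/

section WordSeries

theorem exists_pow_mul_pow_le {ρ r : ℝ} (hρ : 0 ≤ ρ) (h : ρ < r) (p : ℕ) :
    ∃ C : ℝ, ∀ m : ℕ, (m : ℝ) ^ p * ρ ^ m ≤ C * r ^ m := by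
  have hr : 0 < r := hρ.trans_lt h
  have h1 : ‖ρ / r‖ < 1 := by
    rw [Real.norm_of_nonneg (by positivity), div_lt_one hr]
    exact h
  have h2 := summable_pow_mul_geometric_of_norm_lt_one p h1
  obtain ⟨C, hC⟩ := h2.tendsto_atTop_zero.bddAbove_range
  refine ⟨C, fun m => ?_⟩
  have := hC ⟨m, rfl⟩
  simp only [div_pow, mul_div_assoc'] at this
  rwa [div_le_iff₀ (by positivity)] at this

/-- The gap between `ρ` and `r` absorbs the powers of the length produced by differentiation and by
the remainder estimate. -/
theorem summable_mul_pow_mul_pow {κ : Type*} {a : κ → ℝ} {l : κ → ℕ} {ρ r : ℝ} (hρ : 0 ≤ ρ)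
    (h : ρ < r) (ha : ∀ k, 0 ≤ a k) (hs : Summable fun k => a k * r ^ l k) (p : ℕ) :
    Summable fun k => a k * ((l k : ℝ) ^ p * ρ ^ l k) := by
  obtain ⟨C, hC⟩ := exists_pow_mul_pow_le hρ h p
  refine Summable.of_nonneg_of_le (fun k => mul_nonneg (ha k) (by positivity))
    (fun k => mul_le_mul_of_nonneg_left (hC (l k)) (ha k)) ?_
  simpa only [mul_left_comm] using hs.mul_left C

variable {n : ℕ} {H : Type*} [NormedAddCommGroup H] [InnerProductSpace ℂ H] [CompleteSpace H]

theorem hasDerivAt_tsum_word [Nontrivial H] {A B : Fin n → H →L[ℂ] H} (hA : ∀ j, ‖A j‖ ≤ 1)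
    (hB : ∀ j, ‖B j‖ ≤ 1) {κ : Type*} (w : κ → List (Fin n)) (c : κ → ℂ) {r : ℝ} (hr : 1 < r)
    (hs : Summable fun k => ‖c k‖ * r ^ (w k).length) :
    HasDerivAt (fun s => ∑' k, c k • ((w k).map (linPath A B s)).prod)
      (∑' k, c k • wordDeriv A (fun j => B j - A j) (w k)) 0 := by
  -- Chosen so that `‖X(s)‖ ≤ 1 + 2δ = ρ < r` for `|s| < δ`: the derivative at 0 is two-sided, and
  -- for `s < 0` contractivity is not assumed.
  set δ := (r - 1) / 4 with hδ
  have hδ0 : 0 < δ := by rw [hδ]; linarith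
  set ρ := (1 + r) / 2 with hρ
  have hV : ∀ j, ‖B j - A j‖ ≤ 2 := fun j => by
    linarith [norm_sub_le (B j) (A j), hA j, hB j]
  have hX : ∀ s ∈ Metric.ball (0 : ℝ) δ, ∀ j, ‖linPath A B s j‖ ≤ ρ := by
    intro s hs j
    rw [mem_ball_zero_iff] at hs
    have := norm_smul_le s (B j - A j)
    have h2 : ‖s‖ * ‖B j - A j‖ ≤ δ * 2 := mul_le_mul hs.le (hV j) (norm_nonneg _) hδ0.le
    refine (norm_add_le _ _).trans ?_
    linarith [hA j]
  have hsum := (summable_mul_pow_mul_pow (l := fun k => (w k).length) (ρ := ρ) (by linarith)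
    (by linarith) (fun k => norm_nonneg (c k)) hs 1).mul_right 2
  have h0 : (0 : ℝ) ∈ Metric.ball (0 : ℝ) δ := Metric.mem_ball_self hδ0
  have key := hasDerivAt_tsum_of_isPreconnected hsum Metric.isOpen_ball
    (convex_ball (0 : ℝ) δ).isPreconnected
    (g := fun k s => c k • ((w k).map (linPath A B s)).prod)
    (g' := fun k s => c k • wordDeriv (linPath A B s) (fun j => B j - A j) (w k))
    (fun k s _ => (hasDerivAt_word A (fun j => B j - A j) (w k) s).const_smul (c k))
    (fun k s hs => ?_) h0 ?_ h0
  · have e : linPath A B 0 = A := by ext1 j; simp [linPath]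
    simpa only [e] using key
  · rw [norm_smul, mul_assoc]
    refine mul_le_mul_of_nonneg_left ?_ (norm_nonneg _)
    simpa using norm_wordDeriv_le (by linarith) zero_le_two (hX s hs) hV (w k)
  · refine Summable.of_norm_bounded hs fun k => ?_
    rw [norm_smul]
    refine mul_le_mul_of_nonneg_left ((norm_word_le (hX 0 h0) (w k)).trans ?_) (norm_nonneg _)
    gcongr
    linarith

theorem hasSum_word {X : Fin n → H →L[ℂ] H} (hX : ∀ j, ‖X j‖ ≤ 1) {κ : Type*}
    (w : κ → List (Fin n)) (c : κ → ℂ) {r : ℝ} (hr : 1 < r)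
    (hs : Summable fun k => ‖c k‖ * r ^ (w k).length) :
    HasSum (fun k => c k • ((w k).map X).prod) (∑' k, c k • ((w k).map X).prod) := by
  refine (Summable.of_norm_bounded hs fun k => ?_).hasSum
  rw [norm_smul]
  exact mul_le_mul_of_nonneg_left ((norm_word_le_one hX (w k)).trans (one_le_pow₀ hr.le))
    (norm_nonneg _)

/-- The trace of the second-order Taylor remainder of a power series of operators is computed
term by term. -/
theorem remainderTraceEq_tsum_word {I J : NormedIdeal H} (hI : I.IsComplete) (hJ : J.IsSqrtOf I)
    {τ : I.carrier →ₗ[ℂ] ℂ} (hτ : I.IsPosBddTrace τ) {A B : Fin n → H →L[ℂ] H}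
    (hA : ∀ j, ‖A j‖ ≤ 1) (hB : ∀ j, ‖B j‖ ≤ 1) (hV : ∀ j, B j - A j ∈ J.carrier) {κ : Type*}
    (w : κ → List (Fin n)) (c : κ → ℂ) {r : ℝ} (hr : 1 < r)
    (hs : Summable fun k => ‖c k‖ * r ^ (w k).length) {t : ℂ}
    (ht : HasSum (fun k => c k * I.tr τ (((w k).map B).prod - ((w k).map A).prod
      - wordDeriv A (fun j => B j - A j) (w k))) t) :
    RemainderTraceEq I τ (fun s => ∑' k, c k • ((w k).map (linPath A B s)).prod) t := by
  have e0 : linPath A B 0 = A := by ext1 j; simp [linPath]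
  have e1 : linPath A B 1 = B := by ext1 j; simp [linPath]
  obtain ⟨M, hM⟩ : ∃ M : ℝ, ∀ j, J.nrm ⟨B j - A j, hV j⟩ ≤ M :=
    ⟨∑ j, J.nrm ⟨B j - A j, hV j⟩, fun j =>
      Finset.single_le_sum (f := fun j => J.nrm ⟨B j - A j, hV j⟩)
        (fun i _ => apply_nonneg _ _) (Finset.mem_univ j)⟩
  choose hmem hnrm using word_remainder_mem hJ hA hB hV (abs_nonneg M)
    fun j => (hM j).trans (le_abs_self M)
  have hD : Summable fun k => c k • wordDeriv A (fun j => B j - A j) (w k) := by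
    -- The zero space is separate because `‖1‖ = 1` fails there.
    rcases subsingleton_or_nontrivial H with h | h
    · exact (summable_zero (α := H →L[ℂ] H)).congr fun k => Subsingleton.elim _ _
    · refine Summable.of_norm_bounded ((summable_mul_pow_mul_pow (l := fun k => (w k).length)
        zero_le_one hr (fun k => norm_nonneg (c k)) hs 1).mul_right 2) fun k => ?_
      rw [norm_smul, mul_assoc]
      refine mul_le_mul_of_nonneg_left ?_ (norm_nonneg _)
      have hV2 : ∀ j, ‖B j - A j‖ ≤ 2 := fun j => by
        linarith [norm_sub_le (B j) (A j), hA j, hB j]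
      simpa using norm_wordDeriv_le le_rfl zero_le_two hA hV2 (w k)
  refine ⟨∑' k, c k • wordDeriv A (fun j => B j - A j) (w k), ?_, ?_⟩
  · rcases subsingleton_or_nontrivial H with h | h
    · exact (hasDerivAt_const (0 : ℝ) (0 : H →L[ℂ] H)).congr_deriv (Subsingleton.elim _ _)
        |>.congr_of_eventuallyEq (Filter.Eventually.of_forall fun _ => Subsingleton.elim _ _)
    · exact hasDerivAt_tsum_word hA hB w c hr hs
  · simp only [e0, e1]
    refine NormedIdeal.mem_and_tr_eq_of_hasSum hI hτ (R := fun k => c k • ⟨_, hmem (w k)⟩)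
      (u := fun k => ‖c k‖ * (((w k).length : ℝ) ^ 2 * 1 ^ (w k).length) * |M| ^ 2)
      ((summable_mul_pow_mul_pow zero_le_one hr (fun k => norm_nonneg (c k)) hs 2).mul_right _)
      (fun k => ?_) ?_ ?_
    · rw [map_smul_eq_mul, one_pow, mul_one, mul_assoc]
      exact mul_le_mul_of_nonneg_left (hnrm (w k)) (norm_nonneg _)
    · simpa only [← smul_sub] using!
        ((hasSum_word hB w c hr hs).sub (hasSum_word hA w c hr hs)).sub hD.hasSum
    · convert ht using 2 with k
      rw [map_smul, smul_eq_mul, NormedIdeal.tr, dif_pos (hmem (w k))]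

end WordSeries

/-! ### Termwise differentiation of scalar series. -/

section NormalSeries

open MvPolynomial

variable {n : ℕ} {κ : Type*}

/-- Normal convergence of a series of polynomials on the smaller closed polydiscs. -/
def IsNormallySummable (g : κ → MvPolynomial (Fin n) ℂ) (R : ℝ) : Prop :=
  ∀ r : ℝ, 0 ≤ r → r < R → ∃ u : κ → ℝ, Summable u ∧
    ∀ k (z : Fin n → ℂ), (∀ j, ‖z j‖ ≤ r) → ‖eval z (g k)‖ ≤ u k

theorem hasDerivAt_eval_add_smul_single {𝕜 : Type*} [RCLike 𝕜] [NormedAlgebra 𝕜 ℂ]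
    (F : MvPolynomial (Fin n) ℂ) (j : Fin n) (z : Fin n → 𝕜) (t : 𝕜) :
    HasDerivAt (fun t : 𝕜 =>
        eval (fun l => algebraMap 𝕜 ℂ ((z + t • (Pi.single j 1 : Fin n → 𝕜)) l)) F)
      (eval (fun l => algebraMap 𝕜 ℂ ((z + t • (Pi.single j 1 : Fin n → 𝕜)) l)) (pderiv j F)) t := by
  have h := hasDerivAt_eval_mvPolynomial (𝕜 := 𝕜) (t := t)
    (c := fun t l => algebraMap 𝕜 ℂ ((z + t • (Pi.single j 1 : Fin n → 𝕜)) l))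
    (c' := fun l => algebraMap 𝕜 ℂ ((Pi.single j 1 : Fin n → 𝕜) l)) (fun l => by
      have h1 : HasDerivAt (fun t : 𝕜 => z l + t * (Pi.single j 1 : Fin n → 𝕜) l)
          ((Pi.single j 1 : Fin n → 𝕜) l) t := by
        simpa using! ((hasDerivAt_id t).mul_const _).const_add (z l)
      have h2 := (Algebra.linearMap 𝕜 ℂ).toContinuousLinearMap.hasFDerivAt.comp_hasDerivAt t h1
      exact h2) F
  refine h.congr_deriv ?_
  rw [Finset.sum_eq_single j]
  · simp
  · intro i _ hij
    simp [hij]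
  · simp

/-- Cauchy's estimate on a disc of radius `(R - r)/2` in the `j`-th variable, which keeps the point
in the polydisc of radius `(r + R)/2`. -/
theorem IsNormallySummable.pderiv {g : κ → MvPolynomial (Fin n) ℂ} {R : ℝ}
    (hg : IsNormallySummable g R) (j : Fin n) :
    IsNormallySummable (fun k => MvPolynomial.pderiv j (g k)) R := by
  intro r hr hrR
  obtain ⟨u, hu, hb⟩ := hg ((r + R) / 2) (by linarith) (by linarith)
  have hδ : 0 < (R - r) / 2 := by linarith
  refine ⟨fun k => u k / ((R - r) / 2), hu.div_const _, fun k z hz => ?_⟩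
  have hd := hasDerivAt_eval_add_smul_single (𝕜 := ℂ) (g k) j z
  have hdiff : Differentiable ℂ fun t : ℂ =>
      eval (fun l => algebraMap ℂ ℂ ((z + t • (Pi.single j 1 : Fin n → ℂ)) l)) (g k) :=
    fun t => (hd t).differentiableAt
  have h1 := Complex.norm_deriv_le_of_forall_mem_sphere_norm_le (c := 0) (C := u k) hδ
    hdiff.diffContOnCl fun t ht => hb k _ fun l => ?_
  · rw [(hd 0).deriv] at h1
    simpa using! h1
  · rw [mem_sphere_zero_iff_norm] at ht
    have h2 : ‖t • (Pi.single j 1 : Fin n → ℂ) l‖ ≤ ‖t‖ := by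
      by_cases h : l = j
      · subst h; simp
      · simp [h]
    have h3 := norm_add_le_of_le (hz l) h2
    rw [ht] at h3
    exact h3.trans_eq (by ring)

/-- One proof covers real and complex variables: the bounds hold on the complex polydisc, and real
points embed isometrically. -/
theorem IsNormallySummable.hasSum_lineDeriv {𝕜 : Type*} [RCLike 𝕜] [NormedAlgebra 𝕜 ℂ]
    {g : κ → MvPolynomial (Fin n) ℂ} {R : ℝ} (hg : IsNormallySummable g R)
    {f : (Fin n → 𝕜) → ℂ} (hf : ∀ z : Fin n → 𝕜, (∀ j, ‖z j‖ < R) →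
      HasSum (fun k => eval (fun l => algebraMap 𝕜 ℂ (z l)) (g k)) (f z))
    (j : Fin n) (z : Fin n → 𝕜) (hz : ∀ l, ‖z l‖ < R) :
    HasSum (fun k => eval (fun l => algebraMap 𝕜 ℂ (z l)) (MvPolynomial.pderiv j (g k)))
      (lineDeriv 𝕜 f z (Pi.single j 1)) := by
  have hR : 0 < R := (norm_nonneg _).trans_lt (hz j)
  have hzR : ‖z‖ < R := (pi_norm_lt_iff hR).2 hz
  set δ := (R - ‖z‖) / 2 with hδ
  have hδ0 : 0 < δ := by linarith
  have hball : ∀ t ∈ Metric.ball (0 : 𝕜) δ, ∀ l,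
      ‖(z + t • (Pi.single j 1 : Fin n → 𝕜)) l‖ ≤ (R + ‖z‖) / 2 := by
    intro t ht l
    rw [mem_ball_zero_iff] at ht
    have h1 : ‖t • (Pi.single j 1 : Fin n → 𝕜) l‖ ≤ ‖t‖ := by
      by_cases h : l = j
      · subst h; simp
      · simp [h]
    have := norm_le_pi_norm z l
    refine (norm_add_le _ _).trans ?_
    linarith [show ‖(t • (Pi.single j 1 : Fin n → 𝕜)) l‖ ≤ ‖t‖ from h1]
  obtain ⟨u, hu, hb⟩ := hg.pderiv j ((R + ‖z‖) / 2) (by positivity) (by linarith)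
  have h0 : (0 : 𝕜) ∈ Metric.ball (0 : 𝕜) δ := Metric.mem_ball_self hδ0
  have hfz : ∀ t ∈ Metric.ball (0 : 𝕜) δ, HasSum (fun k =>
      eval (fun l => algebraMap 𝕜 ℂ ((z + t • (Pi.single j 1 : Fin n → 𝕜)) l)) (g k))
      (f (z + t • (Pi.single j 1 : Fin n → 𝕜))) := fun t ht =>
    hf _ fun l => (hball t ht l).trans_lt (by linarith)
  have hb' : ∀ k, ∀ t ∈ Metric.ball (0 : 𝕜) δ, ‖eval (fun l =>
      algebraMap 𝕜 ℂ ((z + t • (Pi.single j 1 : Fin n → 𝕜)) l)) (MvPolynomial.pderiv j (g k))‖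
      ≤ u k := fun k t ht => hb k _ fun l => by
    rw [norm_algebraMap']
    exact hball t ht l
  have key := hasDerivAt_tsum_of_isPreconnected hu Metric.isOpen_ball
    (convex_ball (0 : 𝕜) δ).isPreconnected
    (fun k t _ => hasDerivAt_eval_add_smul_single (g k) j z t) hb' h0 (hfz 0 h0).summable h0
  have hs := (Summable.of_norm_bounded hu fun k => hb' k 0 h0).hasSum
  have e : lineDeriv 𝕜 f z (Pi.single j 1) = _ := (key.congr_of_eventuallyEq (f₁ := fun t =>
    f (z + t • (Pi.single j 1 : Fin n → 𝕜))) (by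
      filter_upwards [Metric.isOpen_ball.mem_nhds h0] with t ht
      exact (hfz t ht).tsum_eq.symm)).deriv
  rw [e]
  simpa using hs

theorem IsNormallySummable.hasSum_pderivTwo {𝕜 : Type*} [RCLike 𝕜] [NormedAlgebra 𝕜 ℂ]
    {g : κ → MvPolynomial (Fin n) ℂ} {R : ℝ} (hg : IsNormallySummable g R)
    {f : (Fin n → 𝕜) → ℂ} (hf : ∀ z : Fin n → 𝕜, (∀ j, ‖z j‖ < R) →
      HasSum (fun k => eval (fun l => algebraMap 𝕜 ℂ (z l)) (g k)) (f z))
    (i j : Fin n) (z : Fin n → 𝕜) (hz : ∀ l, ‖z l‖ < R) :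
    HasSum (fun k => eval (fun l => algebraMap 𝕜 ℂ (z l))
        (MvPolynomial.pderiv i (MvPolynomial.pderiv j (g k))))
      (pderivTwo 𝕜 i j f z) :=
  (hg.pderiv j).hasSum_lineDeriv (fun w hw => hg.hasSum_lineDeriv hf j w hw) i z hz

theorem IsNormallySummable.of_summable {c : κ → ℂ} {w : κ → List (Fin n)} {R : ℝ}
    (h : ∀ r, 0 ≤ r → r < R → Summable fun k => ‖c k‖ * r ^ (w k).length) :
    IsNormallySummable (fun k => C (c k) * ((w k).map (X : Fin n → MvPolynomial (Fin n) ℂ)).prod)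
      R := by
  intro r hr hrR
  refine ⟨_, h r hr hrR, fun k z hz => ?_⟩
  rw [map_mul, eval_C, norm_mul, map_list_prod, List.map_map]
  refine mul_le_mul_of_nonneg_left ?_ (norm_nonneg _)
  refine norm_word_le (fun j => ?_) (w k)
  simpa using hz j

end NormalSeries

/-! ### Monomials as words. -/

section MonomialWord

open MvPolynomial

variable {n : ℕ}

/-- The word `1^{k_1} ⋯ n^{k_n}`. -/
def monomialWord (k : Fin n → ℕ) : List (Fin n) :=
  (List.ofFn fun j => List.replicate (k j) j).flatten

theorem prod_map_monomialWord {R : Type*} [Monoid R] (X : Fin n → R) (k : Fin n → ℕ) :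
    ((monomialWord k).map X).prod = (List.ofFn fun j => X j ^ k j).prod := by
  rw [monomialWord, List.map_flatten, List.prod_flatten, List.map_map, List.map_ofFn]
  congr 2
  ext j
  simp

theorem length_monomialWord (k : Fin n → ℕ) : (monomialWord k).length = ∑ j, k j := by
  rw [monomialWord, List.length_flatten, List.map_ofFn, List.sum_ofFn]
  simp

theorem prod_pow_const_eq (r : ℝ) (k : Fin n → ℕ) :
    ∏ j, r ^ k j = r ^ (monomialWord k).length := by
  rw [length_monomialWord, Finset.prod_pow_eq_pow_sum]

end MonomialWord

theorem sum_sum_eq_of_symm {n : ℕ} (g : Fin n → Fin n → ℂ) (h : ∀ i j, g i j = g j i) :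
    ∑ j, ∑ i, g i j = ∑ j, g j j + 2 * ∑ i, ∑ j ∈ Finset.Ioi i, g i j := by
  have e1 : ∀ i, ∑ j ∈ Finset.Ioi i, g i j = ∑ j, if i < j then g i j else 0 := fun i => by
    rw [← Finset.sum_filter, Finset.filter_lt_eq_Ioi]
  have e2 : ∑ i, ∑ j, (if i < j then g i j else 0) = ∑ i, ∑ j, if j < i then g i j else 0 := by
    rw [Finset.sum_comm]
    simp only [h]
  have e3 : ∑ j, g j j = ∑ i, ∑ j, if i = j then g i j else 0 := by simp
  rw [Finset.sum_comm, two_mul]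
  simp only [e1]
  nth_rewrite 2 [e2]
  rw [e3, ← Finset.sum_add_distrib, ← Finset.sum_add_distrib]
  refine Finset.sum_congr rfl fun i _ => ?_
  rw [← Finset.sum_add_distrib, ← Finset.sum_add_distrib]
  refine Finset.sum_congr rfl fun j _ => ?_
  rcases lt_trichotomy i j with hij | rfl | hij
  · simp [hij, hij.ne, hij.not_gt]
  · simp
  · simp [hij, hij.ne', hij.not_gt]

/-- The commutator of two derivations is a derivation, and this one vanishes on the variables. -/
theorem MvPolynomial.pderiv_pderiv_comm {σ R : Type*} [CommRing R] (i j : σ)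
    (F : MvPolynomial σ R) : pderiv i (pderiv j F) = pderiv j (pderiv i F) := by
  have : ⁅(pderiv i : Derivation R (MvPolynomial σ R) (MvPolynomial σ R)),
      (pderiv j : Derivation R (MvPolynomial σ R) (MvPolynomial σ R))⁆ = 0 := by
    refine MvPolynomial.derivation_ext fun k => ?_
    rw [Derivation.commutator_apply]
    classical
    simp [pderiv_X, Pi.single_apply, apply_ite]
  have h := congrArg (fun D => D F) this
  rw [Derivation.commutator_apply] at h
  exact sub_eq_zero.1 h

/-! ### The trace of the remainder in terms of the functionals. -/

section TraceFormula

open MvPolynomial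

variable {n : ℕ} {H : Type*} [NormedAddCommGroup H] [InnerProductSpace ℂ H] [CompleteSpace H]
  {A B : Fin n → H →L[ℂ] H}

theorem linPath_zero (A B : Fin n → H →L[ℂ] H) : linPath A B 0 = A := by
  ext1 j; simp [linPath]

theorem linPath_one (A B : Fin n → H →L[ℂ] H) : linPath A B 1 = B := by
  ext1 j; simp [linPath]

theorem pathDeriv_word
    (hc : ∀ (s : ℝ) (i j : Fin n), Commute (linPath A B s i) (linPath A B s j))
    (w : List (Fin n)) :
    pathDeriv hc 0 (w.map (X : Fin n → MvPolynomial (Fin n) ℂ)).prod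
      = wordDeriv A (fun j => B j - A j) w := by
  refine (hasDerivAt_commAeval_linPath hc 0 _).unique ?_
  have h := hasDerivAt_word A (fun j => B j - A j) w 0
  simp only [commAeval_word]
  simpa only [linPath, zero_smul, add_zero] using! h

namespace HilbertSchmidtTrace

variable (S : HilbertSchmidtTrace H)
  (hc : ∀ (s : ℝ) (i j : Fin n), Commute (linPath A B s i) (linPath A B s j))

theorem T_word_remainder (hV : ∀ j, B j - A j ∈ S.J) (w : List (Fin n)) :
    S.T ((w.map B).prod - (w.map A).prod - wordDeriv A (fun j => B j - A j) w)
      = ∑ j, ∑ i, S.taylorFunctional hc i j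
          (pderiv i (pderiv j (w.map (X : Fin n → MvPolynomial (Fin n) ℂ)).prod)) := by
  rw [← S.T_taylor_eq_sum hc hV, pathDeriv_word, commAeval_word, commAeval_word, linPath_one,
    linPath_zero]

variable {I J : NormedIdeal H} {τ : I.carrier →ₗ[ℂ] ℂ}

/-- If the second-order coefficients can be summed, so can the trace of the Taylor remainder. -/
theorem remainderTraceEq_of_hasSum (hI : I.IsComplete) (hJ : J.IsSqrtOf I)
    (hτ : I.IsPosBddTrace τ) (hSJ : S.J = J.carrier) (hST : ∀ A : I.carrier, S.T A = τ A)
    (hA : ∀ j, ‖A j‖ ≤ 1) (hB : ∀ j, ‖B j‖ ≤ 1) (hV : ∀ j, B j - A j ∈ J.carrier) {κ : Type*}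
    (w : κ → List (Fin n)) (c : κ → ℂ) {r : ℝ} (hr : 1 < r)
    (hs : Summable fun k => ‖c k‖ * r ^ (w k).length) {t : Fin n → Fin n → ℂ}
    (ht : ∀ i j, i ≤ j → HasSum (fun k => S.taylorFunctional hc i j
      (pderiv i (pderiv j (C (c k) * ((w k).map X).prod)))) (t i j)) :
    RemainderTraceEq I τ (fun s => ∑' k, c k • ((w k).map (linPath A B s)).prod)
      (∑ j, t j j + 2 * ∑ i, ∑ j ∈ Finset.Ioi i, t i j) := by
  have hVS : ∀ j, B j - A j ∈ S.J := fun j => hSJ ▸ hV j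
  refine remainderTraceEq_tsum_word hI hJ hτ hA hB hV w c hr hs ?_
  have h1 := (hasSum_sum (s := Finset.univ) fun j (_ : j ∈ Finset.univ) => ht j j le_rfl).add
    ((hasSum_sum (s := Finset.univ) fun i (_ : i ∈ Finset.univ) =>
      hasSum_sum fun j (hj : j ∈ Finset.Ioi i) => ht i j (Finset.mem_Ioi.1 hj).le).mul_left 2)
  convert h1 using 2 with k
  obtain ⟨hmem, -⟩ := word_remainder_mem hJ hA hB hV
    (M := ∑ j, J.nrm ⟨B j - A j, hV j⟩) (Finset.sum_nonneg fun j _ => apply_nonneg _ _)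
    (fun j => Finset.single_le_sum (f := fun j => J.nrm ⟨B j - A j, hV j⟩)
        (fun i _ => apply_nonneg _ _) (Finset.mem_univ j)) (w k)
  rw [NormedIdeal.tr, dif_pos hmem, ← hST, S.T_word_remainder hc hVS]
  rw [sum_sum_eq_of_symm]
  · have e : ∀ i j (p : MvPolynomial (Fin n) ℂ),
        S.taylorFunctional hc i j (pderiv i (pderiv j (C (c k) * p)))
          = c k * S.taylorFunctional hc i j (pderiv i (pderiv j p)) := fun i j p => by
      rw [← smul_eq_C_mul, Derivation.map_smul, Derivation.map_smul, map_smul, smul_eq_mul]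
    simp only [e, mul_add, Finset.mul_sum, mul_left_comm]
  · intro i j
    rw [S.taylorFunctional_symm hc hVS, pderiv_pderiv_comm]

theorem remainderTraceEq_opSeries (hI : I.IsComplete) (hJ : J.IsSqrtOf I)
    (hτ : I.IsPosBddTrace τ) (hSJ : S.J = J.carrier) (hST : ∀ A : I.carrier, S.T A = τ A)
    (hA : ∀ j, ‖A j‖ ≤ 1) (hB : ∀ j, ‖B j‖ ≤ 1) (hV : ∀ j, B j - A j ∈ J.carrier)
    (c : (Fin n → ℕ) → ℂ) {r : ℝ} (hr : 1 < r)
    (hs : Summable fun k => ‖c k‖ * r ^ (monomialWord k).length) {t : Fin n → Fin n → ℂ}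
    (ht : ∀ i j, i ≤ j → HasSum (fun k => S.taylorFunctional hc i j
      (pderiv i (pderiv j (C (c k) * ((monomialWord k).map X).prod)))) (t i j)) :
    RemainderTraceEq I τ (fun s => opSeries c (linPath A B s))
      (∑ j, t j j + 2 * ∑ i, ∑ j ∈ Finset.Ioi i, t i j) := by
  simpa only [opSeries, prod_map_monomialWord] using
    S.remainderTraceEq_of_hasSum hc hI hJ hτ hSJ hST hA hB hV monomialWord c hr hs ht

/-- A one-variable series is treated inside the `n`-tuple through words in the single letter `j`;
every second derivative other than `∂ⱼ∂ⱼ` vanishes on them. -/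
theorem remainderTraceEq_opSeriesOne (hI : I.IsComplete) (hJ : J.IsSqrtOf I)
    (hτ : I.IsPosBddTrace τ) (hSJ : S.J = J.carrier) (hST : ∀ A : I.carrier, S.T A = τ A)
    (hA : ∀ j, ‖A j‖ ≤ 1) (hB : ∀ j, ‖B j‖ ≤ 1) (hV : ∀ j, B j - A j ∈ J.carrier)
    (c : ℕ → ℂ) {r : ℝ} (hr : 1 < r) (hs : Summable fun k => ‖c k‖ * r ^ k) (j : Fin n) {t : ℂ}
    (ht : HasSum (fun k => S.taylorFunctional hc j j
      (pderiv j (pderiv j (C (c k) * X j ^ k)))) t) :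
    RemainderTraceEq I τ (fun s => opSeriesOne c (A j + s • (B j - A j))) t := by
  have h := S.remainderTraceEq_of_hasSum hc hI hJ hτ hSJ hST hA hB hV
    (fun k : ℕ => List.replicate k j) c hr (by simpa using hs)
    (t := fun a b => if a = j ∧ b = j then t else 0) fun a b _ => by
      split_ifs with hab
      · obtain ⟨rfl, rfl⟩ := hab
        simpa using ht
      · refine hasSum_zero.congr_fun fun k => ?_
        have hX : ∀ b, b ≠ j → pderiv b (C (c k) * X j ^ k : MvPolynomial (Fin n) ℂ) = 0 :=
          fun b hb => by
            rw [← smul_eq_C_mul, Derivation.map_smul, Derivation.leibniz_pow,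
              pderiv_X_of_ne hb.symm]
            simp
        rw [List.map_replicate, List.prod_replicate]
        by_cases hb : b = j
        · rw [pderiv_pderiv_comm, hX a fun ha => hab ⟨ha, hb⟩, map_zero, map_zero]
        · rw [hX b hb, map_zero, map_zero]
  have e : (∑ b, (if b = j ∧ b = j then t else 0)
      + 2 * ∑ a, ∑ b ∈ Finset.Ioi a, if a = j ∧ b = j then t else 0) = t := by
    have h0 : ∀ a, ∀ b ∈ Finset.Ioi a, (if a = j ∧ b = j then t else 0) = 0 := by
      intro a b hb
      refine if_neg ?_
      rintro ⟨rfl, rfl⟩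
      simp at hb
    rw [Finset.sum_eq_zero fun a _ => Finset.sum_eq_zero (h0 a)]
    simp
  rw [e] at h
  simpa [opSeriesOne, linPath] using! h

end HilbertSchmidtTrace

end TraceFormula

/-! ### Convergence of the scalar power series and of their second derivatives. -/

section ScalarSeries

open MvPolynomial

variable {n : ℕ}

/-- Evaluate at the point `(r, …, r)`; summability in `ℂ` is absolute. -/
theorem IsPolydiscSeries.summable {c : (Fin n → ℕ) → ℂ} {R : ℝ} {f : (Fin n → ℂ) → ℂ}
    (h : IsPolydiscSeries c R f) {r : ℝ} (hr : 0 ≤ r) (hrR : r < R) :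
    Summable fun k => ‖c k‖ * r ^ (monomialWord k).length := by
  have := (h (fun _ => (r : ℂ)) fun j => by simpa [abs_of_nonneg hr] using hrR).summable.norm
  refine this.congr fun k => ?_
  rw [norm_mul, norm_prod, ← prod_pow_const_eq]
  simp [abs_of_nonneg hr]

theorem IsCubeSeries.summable {c : (Fin n → ℕ) → ℂ} {R : ℝ} {f : (Fin n → ℝ) → ℂ}
    (h : IsCubeSeries c R f) {r : ℝ} (hr : 0 ≤ r) (hrR : r < R) :
    Summable fun k => ‖c k‖ * r ^ (monomialWord k).length := by
  have := (h (fun _ => r) fun j => by simpa [abs_of_nonneg hr] using hrR).summable.norm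
  refine this.congr fun k => ?_
  rw [norm_mul, norm_prod, ← prod_pow_const_eq]
  simp [abs_of_nonneg hr]

theorem IsDiscSeries.summable {c : ℕ → ℂ} {R : ℝ} {f : ℂ → ℂ}
    (h : IsDiscSeries c R f) {r : ℝ} (hr : 0 ≤ r) (hrR : r < R) :
    Summable fun k => ‖c k‖ * r ^ k := by
  have := (h r (by simpa [abs_of_nonneg hr] using hrR)).summable.norm
  refine this.congr fun k => ?_
  simp [abs_of_nonneg hr]

theorem eval_monomialWord (c : ℂ) (k : Fin n → ℕ) (z : Fin n → ℂ) :
    eval z (C c * ((monomialWord k).map X).prod) = c * ∏ j, z j ^ k j := by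
  rw [prod_map_monomialWord, List.prod_ofFn]
  simp

theorem IsPolydiscSeries.isNormallySummable {c : (Fin n → ℕ) → ℂ} {R : ℝ}
    {f : (Fin n → ℂ) → ℂ} (h : IsPolydiscSeries c R f) :
    IsNormallySummable (fun k => C (c k) * ((monomialWord k).map X).prod :
      (Fin n → ℕ) → MvPolynomial (Fin n) ℂ) R :=
  IsNormallySummable.of_summable fun _ hr hrR => h.summable hr hrR

theorem IsCubeSeries.isNormallySummable {c : (Fin n → ℕ) → ℂ} {R : ℝ}
    {f : (Fin n → ℝ) → ℂ} (h : IsCubeSeries c R f) :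
    IsNormallySummable (fun k => C (c k) * ((monomialWord k).map X).prod :
      (Fin n → ℕ) → MvPolynomial (Fin n) ℂ) R :=
  IsNormallySummable.of_summable fun _ hr hrR => h.summable hr hrR

theorem IsDiscSeries.isNormallySummable {c : ℕ → ℂ} {R : ℝ} {f : ℂ → ℂ}
    (h : IsDiscSeries c R f) (j : Fin n) :
    IsNormallySummable (fun k => C (c k) * X j ^ k : ℕ → MvPolynomial (Fin n) ℂ) R := by
  have := IsNormallySummable.of_summable (c := c) (w := fun k => List.replicate k j) (R := R)
    fun r hr hrR => by simpa using h.summable hr hrR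
  simpa using this

theorem IsPolydiscSeries.hasSum_pderivTwo {c : (Fin n → ℕ) → ℂ} {R : ℝ}
    {f : (Fin n → ℂ) → ℂ} (h : IsPolydiscSeries c R f) (i j : Fin n) {z : Fin n → ℂ}
    (hz : ∀ l, ‖z l‖ < R) :
    HasSum (fun k => eval z (pderiv i (pderiv j (C (c k) * ((monomialWord k).map X).prod))))
      (pderivTwo ℂ i j f z) :=
  h.isNormallySummable.hasSum_pderivTwo (𝕜 := ℂ)
    (fun w hw => by
      have := h w hw
      simp only [← eval_monomialWord] at this
      exact this) i j z hz

theorem IsCubeSeries.hasSum_pderivTwo {c : (Fin n → ℕ) → ℂ} {R : ℝ}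
    {f : (Fin n → ℝ) → ℂ} (h : IsCubeSeries c R f) (i j : Fin n) {z : Fin n → ℝ}
    (hz : ∀ l, |z l| < R) :
    HasSum (fun k => eval (fun l => (z l : ℂ))
        (pderiv i (pderiv j (C (c k) * ((monomialWord k).map X).prod))))
      (pderivTwo ℝ i j f z) :=
  h.isNormallySummable.hasSum_pderivTwo (𝕜 := ℝ)
    (fun w hw => by simpa only [Complex.coe_algebraMap, eval_monomialWord] using! h w hw) i j z hz

theorem IsDiscSeries.hasSum_deriv_deriv {c : ℕ → ℂ} {R : ℝ} {f : ℂ → ℂ}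
    (h : IsDiscSeries c R f) (j : Fin n) {z : Fin n → ℂ} (hz : ∀ l, ‖z l‖ < R) :
    HasSum (fun k => eval z (pderiv j (pderiv j (C (c k) * X j ^ k))))
      (deriv (deriv f) (z j)) := by
  have e1 : ∀ (g : ℂ → ℂ) (w : Fin n → ℂ),
      lineDeriv ℂ (fun w : Fin n → ℂ => g (w j)) w (Pi.single j 1) = deriv g (w j) := by
    intro g w
    simp only [lineDeriv, Pi.add_apply, Pi.smul_apply, Pi.single_eq_same, smul_eq_mul, mul_one]
    rw [deriv_comp_const_add, add_zero]
  have key := (h.isNormallySummable j).hasSum_pderivTwo (𝕜 := ℂ) (f := fun w => f (w j))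
    (fun w hw => by simpa using! h (w j) (hw j)) j j z hz
  simp only [pderivTwo, e1] at key
  exact key

end ScalarSeries

/-! ### Integration of polynomial series against the measures. -/

section Representation

open MvPolynomial

variable {n : ℕ} {K : Type*} [TopologicalSpace K]

/-- Evaluation of polynomials along a continuous map. -/
def evalAlong (φ : C(K, Fin n → ℂ)) : MvPolynomial (Fin n) ℂ →ₗ[ℂ] C(K, ℂ) where
  toFun F := ⟨fun x => eval (φ x) F, F.continuous_eval.comp φ.continuous⟩
  map_add' F G := by ext x; simp
  map_smul' c F := by ext x; simp

theorem evalAlong_apply (φ : C(K, Fin n → ℂ)) (F : MvPolynomial (Fin n) ℂ) (x : K) :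
    evalAlong φ F x = eval (φ x) F := rfl

variable [MeasurableSpace K] [BorelSpace K] {κ : Type*} [Countable κ]

theorem IsNormallySummable.hasSum_integral {E : Type*} [NormedAddCommGroup E] [NormedSpace ℝ E]
    (ν : VectorMeasure K E) (hν : ν.variation Set.univ ≠ ⊤) (L : ℂ →L[ℝ] E →L[ℝ] ℂ)
    (φ : C(K, Fin n → ℂ)) (hφ : ∀ x, φ x ∈ closedPolydisc n) {g : κ → MvPolynomial (Fin n) ℂ}
    {R : ℝ} (hR : 1 < R) (hg : IsNormallySummable g R) (i j : Fin n) {f : K → ℂ}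
    (hf : ∀ x, HasSum (fun k => eval (φ x) (MvPolynomial.pderiv i (MvPolynomial.pderiv j (g k))))
      (f x)) :
    HasSum (fun k => ν.integral
        (evalAlong φ (MvPolynomial.pderiv i (MvPolynomial.pderiv j (g k)))) L)
      (ν.integral f L) := by
  obtain ⟨u, hu, hb⟩ := (hg.pderiv j).pderiv i 1 zero_le_one hR
  exact hasSum_vectorMeasure_integral ν hν L hu
    (fun k => (ContinuousMap.continuous _).stronglyMeasurable) (fun k x => hb k _ (hφ x)) hf

theorem conj_eval_of_map_eq {F : MvPolynomial (Fin n) ℂ} (hF : map (starRingEnd ℂ) F = F)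
    {z : Fin n → ℂ} (hz : ∀ j, (z j).im = 0) : (eval z F).im = 0 := by
  have hz' : (starRingEnd ℂ) ∘ z = z := funext fun j => Complex.conj_eq_iff_im.2 (hz j)
  have h := eval₂_comp_left (starRingEnd ℂ) (RingHom.id ℂ) z F
  rw [hz', RingHom.comp_id, ← eval_map (starRingEnd ℂ), hF] at h
  exact Complex.conj_eq_iff_im.1 h

theorem map_conj_pderiv_word (i j : Fin n) (w : List (Fin n)) :
    map (starRingEnd ℂ) (MvPolynomial.pderiv i (MvPolynomial.pderiv j
        (w.map (X : Fin n → MvPolynomial (Fin n) ℂ)).prod))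
      = MvPolynomial.pderiv i (MvPolynomial.pderiv j (w.map X).prod) := by
  rw [← pderiv_map, ← pderiv_map, map_list_prod, List.map_map]
  congr 4
  ext1 k
  simp

/-- The inclusion of the torus into `ℂ^n`. -/
def torusIncl (n : ℕ) : C(Fin n → UnitCirc, Fin n → ℂ) :=
  ⟨fun z l => (z l : ℂ), by fun_prop⟩

/-- The inclusion of the diagonal circle into `ℂ^n`. -/
def circIncl (n : ℕ) : C(UnitCirc, Fin n → ℂ) := ⟨fun z _ => (z : ℂ), by fun_prop⟩

/-- The inclusion of the cube into `ℂ^n`. -/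
def cubeIncl (n : ℕ) : C(Fin n → UnitIcc, Fin n → ℂ) :=
  ⟨fun x l => ((x l : ℝ) : ℂ), by fun_prop⟩

end Representation

/-! ### Construction of the measures. -/

section Main

open MvPolynomial

variable {n : ℕ} {H : Type*} [NormedAddCommGroup H] [InnerProductSpace ℂ H] [CompleteSpace H]
  {A B : Fin n → H →L[ℂ] H} (S : HilbertSchmidtTrace H)
  (hc : ∀ (s : ℝ) (i j : Fin n), Commute (linPath A B s i) (linPath A B s j))

namespace HilbertSchmidtTrace

theorem norm_taylorFunctional_le_torus (hV : ∀ j, B j - A j ∈ S.J) (hdil : IsDilatablePath A B)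
    (i j : Fin n) (F : MvPolynomial (Fin n) ℂ) {M : ℝ} (hM0 : 0 ≤ M)
    (hM : ∀ z : Fin n → ℂ, (∀ j, ‖z j‖ = 1) → ‖eval z F‖ ≤ M) :
    ‖S.taylorFunctional hc i j F‖ ≤ 1 / 2 * √(S.sq (B i - A i)) * √(S.sq (B j - A j)) * M :=
  S.norm_taylorFunctional_le hc hV convex_closedPolydisc
    (fun s hs => (hdil s hs).2.hasSpectralApprox (hc s)) i j F
    (fun _ hz => norm_eval_le_of_forall_torus F hM hz) hM0

theorem exists_torus_measure (hV : ∀ j, B j - A j ∈ S.J) (hdil : IsDilatablePath A B)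
    (i j : Fin n) :
    ∃ ν : ComplexMeasure (Fin n → UnitCirc),
      ν.variation Set.univ ≤
        ENNReal.ofReal (1 / 2 * √(S.sq (B i - A i)) * √(S.sq (B j - A j))) ∧
      ∀ F, cintegral ν (evalAlong (torusIncl n) F) = S.taylorFunctional hc i j F := by
  refine exists_complexMeasure (evalAlong (torusIncl n)) (S.taylorFunctional hc i j) _
    (by positivity) fun F => ?_
  refine S.norm_taylorFunctional_le_torus hc hV hdil i j F (norm_nonneg _) fun z hz => ?_
  exact (evalAlong (torusIncl n) F).norm_coe_le_norm
    (fun l => ⟨z l, mem_sphere_zero_iff_norm.2 (hz l)⟩)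

/-- Polynomials in `X j` alone are parametrized by substituting `X j` for all variables, so that
restriction to the diagonal circle plays the role of restriction to the torus. -/
theorem exists_circle_measure (hV : ∀ j, B j - A j ∈ S.J) (hdil : IsDilatablePath A B)
    (j : Fin n) :
    ∃ ν : ComplexMeasure UnitCirc,
      ν.variation Set.univ ≤ ENNReal.ofReal (1 / 2 * S.sq (B j - A j)) ∧
      ∀ F : MvPolynomial (Fin n) ℂ, cintegral ν (evalAlong (circIncl n) (aeval (fun _ => X j) F))
        = S.taylorFunctional hc j j (aeval (fun _ => X j) F) := by
  have e : ∀ (z : Fin n → ℂ) (F : MvPolynomial (Fin n) ℂ),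
      eval z (aeval (fun _ => X j) F) = eval (fun _ => z j) F := by
    intro z F
    induction F using MvPolynomial.induction_on with
    | C a => simp
    | add p q hp hq => simp only [map_add, hp, hq]
    | mul_X p i hp => simp only [map_mul, aeval_X, eval_X, hp]
  have e' : ∀ F : MvPolynomial (Fin n) ℂ,
      evalAlong (circIncl n) (aeval (fun _ => X j) F) = evalAlong (circIncl n) F :=
    fun F => ContinuousMap.ext fun z => e _ F
  simp only [e']
  refine exists_complexMeasure (evalAlong (circIncl n))
    ((S.taylorFunctional hc j j).comp (aeval (fun _ : Fin n => X j)).toLinearMap) _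
    (mul_nonneg (by norm_num) (S.sq_nonneg (hV j))) fun F => ?_
  have h := S.norm_taylorFunctional_le_torus hc hV hdil j j (aeval (fun _ => X j) F)
    (norm_nonneg (evalAlong (circIncl n) F)) fun z hz => ?_
  · rwa [mul_assoc (1 / 2), Real.mul_self_sqrt (S.sq_nonneg (hV j))] at h
  · rw [e]
    exact (evalAlong (circIncl n) F).norm_coe_le_norm ⟨z j, mem_sphere_zero_iff_norm.2 (hz j)⟩

/-- For self-adjoint tuples the nodes lie in the real cube, itself convex, so the supremum there
bounds the functional directly and the maximum principle is not needed. -/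
theorem exists_cube_measure (hV : ∀ j, B j - A j ∈ S.J) (hA : ∀ j, IsSelfAdjoint (A j))
    (hB : ∀ j, IsSelfAdjoint (B j)) (hn : ∀ s ∈ Set.Icc (0 : ℝ) 1, ∀ j, ‖linPath A B s j‖ ≤ 1)
    (i j : Fin n) :
    ∃ ν : SignedMeasure (Fin n → UnitIcc),
      ν.variation Set.univ ≤
        ENNReal.ofReal (1 / 2 * √(S.sq (B i - A i)) * √(S.sq (B j - A j))) ∧
      ∀ F, map (starRingEnd ℂ) F = F →
        sintegral ν (evalAlong (cubeIncl n) F) = S.taylorFunctional hc i j F := by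
  obtain ⟨ν, hν, h⟩ := exists_signedMeasure (evalAlong (cubeIncl n)) (S.taylorFunctional hc i j)
    (1 / 2 * √(S.sq (B i - A i)) * √(S.sq (B j - A j))) (by positivity) fun F => by
      refine S.norm_taylorFunctional_le hc hV convex_realCube (fun s hs =>
        hasSpectralApprox_of_isSelfAdjoint (hc s) (isSelfAdjoint_linPath hA hB s) (hn s hs))
        i j F (fun z hz => ?_) (norm_nonneg _)
      have e : eval z F = evalAlong (cubeIncl n) F
          (fun l => ⟨(z l).re, abs_le.1 ((Complex.abs_re_le_norm _).trans (hz l).1)⟩) := by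
        rw [evalAlong_apply]
        congr 2
        ext l
        exact Complex.ext rfl (hz l).2
      rw [e]
      exact ContinuousMap.norm_coe_le_norm _ _
  refine ⟨ν, hν, fun F hF => h F (fun x => ?_)
    (S.taylorFunctional_im_eq_zero hc hV hA hB i j F hF)⟩
  exact conj_eval_of_map_eq hF fun j => rfl

end HilbertSchmidtTrace

end Main

/-! ### Assembly of the trace formulas. -/

section Assembly

open MvPolynomial

variable {n : ℕ} {H : Type*} [NormedAddCommGroup H] [InnerProductSpace ℂ H] [CompleteSpace H]
  {A B : Fin n → H →L[ℂ] H} {I J : NormedIdeal H} {τ : I.carrier →ₗ[ℂ] ℂ}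

namespace HilbertSchmidtTrace

variable (S : HilbertSchmidtTrace H)

theorem tr_eq (hST : ∀ A : I.carrier, S.T A = τ A) {V : H →L[ℂ] H} (hV : V ∈ I.carrier) :
    I.tr τ V = S.T V := by
  rw [NormedIdeal.tr, dif_pos hV, ← hST]

theorem trSq_eq (hJ : J.IsSqrtOf I) (hST : ∀ A : I.carrier, S.T A = τ A) {V : H →L[ℂ] H}
    (hV : V ∈ J.carrier) : I.trSq τ V = S.sq V := by
  rw [NormedIdeal.trSq, S.tr_eq hST ((hJ.mem_iff V).1 hV), sq]

end HilbertSchmidtTrace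

theorem RemainderTraceEq.unique {F : ℝ → H →L[ℂ] H} {t t' : ℂ} (h : RemainderTraceEq I τ F t)
    (h' : RemainderTraceEq I τ F t') : t = t' := by
  obtain ⟨D, hD, -, rfl⟩ := h
  obtain ⟨D', hD', -, rfl⟩ := h'
  rw [hD.unique hD']

/-- Every analytic function on a disc is a second derivative of an analytic function. -/
theorem IsDiscSeries.exists_deriv_deriv_eq {c : ℕ → ℂ} {R : ℝ} {g : ℂ → ℂ}
    (h : IsDiscSeries c R g) : ∃ (c' : ℕ → ℂ) (f : ℂ → ℂ), IsDiscSeries c' R f ∧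
      ∀ z : ℂ, ‖z‖ < R → deriv (deriv f) z = g z := by
  -- For `k = 0, 1` the denominator is 0, so these coefficients are 0 by convention.
  set c' : ℕ → ℂ := fun k => c (k - 2) / (k * (k - 1)) with hc'
  have hc2 : ∀ k, c' (k + 2) * ((k + 2) * (k + 1)) = c k := fun k => by
    have h1 : ((k : ℂ) + 2) ≠ 0 := by exact_mod_cast (k + 1).succ_ne_zero
    have h2 : ((k : ℂ) + 1) ≠ 0 := by exact_mod_cast k.succ_ne_zero
    simp only [hc', Nat.add_sub_cancel]
    push_cast
    rw [show (k : ℂ) + 2 - 1 = k + 1 by ring]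
    field_simp
  have hs : ∀ z : ℂ, ‖z‖ < R → Summable fun k => c' k * z ^ k := fun z hz => by
    rw [← summable_nat_add_iff 2]
    refine Summable.of_norm_bounded ((h z hz).summable.norm.mul_left (‖z‖ ^ 2)) fun k => ?_
    have hk : (1 : ℝ) ≤ ‖((k : ℂ) + 2) * (k + 1)‖ := by
      have : ((k : ℂ) + 2) * (k + 1) = (((k + 2) * (k + 1) : ℕ) : ℂ) := by push_cast; ring
      rw [this, Complex.norm_natCast]
      exact_mod_cast Nat.one_le_iff_ne_zero.2 (by positivity)
    rw [← hc2, pow_add]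
    simp only [norm_mul, norm_pow] at hk ⊢
    have h0 : 0 ≤ ‖c' (k + 2)‖ * (‖z‖ ^ k * ‖z‖ ^ 2) := by positivity
    nlinarith [mul_le_mul_of_nonneg_left hk h0]
  refine ⟨c', fun z => ∑' k, c' k * z ^ k, fun z hz => (hs z hz).hasSum, fun z hz => ?_⟩
  have hf : IsDiscSeries c' R fun z => ∑' k, c' k * z ^ k := fun z hz => (hs z hz).hasSum
  have h1 := hf.hasSum_deriv_deriv (0 : Fin 1) (z := fun _ => z) fun _ => hz
  have h2 := (hasSum_nat_add_iff' 2).2 h1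
  have e : ∀ (m : ℕ) (a : ℂ), eval (fun _ : Fin 1 => z)
      (pderiv 0 (pderiv 0 (C a * X 0 ^ m : MvPolynomial (Fin 1) ℂ)))
      = a * m * (m - 1 : ℕ) * z ^ (m - 2) := fun m a => by
    rw [C_mul_X_pow_eq_monomial, pderiv_monomial_single, pderiv_monomial_single,
      ← C_mul_X_pow_eq_monomial, Nat.sub_sub]
    simp
  have h3 : ∑ k ∈ Finset.range 2, eval (fun _ : Fin 1 => z)
      (pderiv 0 (pderiv 0 (C (c' k) * X 0 ^ k : MvPolynomial (Fin 1) ℂ))) = 0 := by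
    simp [Finset.sum_range_succ]
  rw [h3, sub_zero] at h2
  refine HasSum.unique (h2.congr_fun fun k => ?_) (h z hz)
  rw [e, ← hc2 k, show k + 2 - 1 = k + 1 by omega, Nat.add_sub_cancel]
  push_cast
  ring

theorem RemainderTraceEq.of_torus_measure (S : HilbertSchmidtTrace H)
    (hc : ∀ (s : ℝ) (i j : Fin n), Commute (linPath A B s i) (linPath A B s j))
    (hI : I.IsComplete) (hJ : J.IsSqrtOf I) (hτ : I.IsPosBddTrace τ) (hSJ : S.J = J.carrier)
    (hST : ∀ A : I.carrier, S.T A = τ A) (hA : ∀ j, ‖A j‖ ≤ 1) (hB : ∀ j, ‖B j‖ ≤ 1)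
    (hV : ∀ j, B j - A j ∈ J.carrier) {ν : Fin n → Fin n → ComplexMeasure (Fin n → UnitCirc)}
    (hν : ∀ i j, (ν i j).variation Set.univ ≠ ⊤)
    (hL : ∀ i j F, cintegral (ν i j) (evalAlong (torusIncl n) F) = S.taylorFunctional hc i j F)
    {c : (Fin n → ℕ) → ℂ} {R : ℝ} (hR : 1 < R) {f : (Fin n → ℂ) → ℂ}
    (hf : IsPolydiscSeries c R f) :
    RemainderTraceEq I τ (fun s => opSeries c (linPath A B s))
      ((∑ j, cintegral (ν j j) fun z => pderivTwo ℂ j j f fun l => (z l : ℂ)) +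
        2 * ∑ i, ∑ j ∈ Finset.Ioi i,
          cintegral (ν i j) fun z => pderivTwo ℂ i j f fun l => (z l : ℂ)) := by
  have hφ : ∀ x, torusIncl n x ∈ closedPolydisc n := fun x j =>
    (mem_sphere_zero_iff_norm.1 (x j).2).le
  obtain ⟨r, hr, hrR⟩ := exists_between hR
  refine S.remainderTraceEq_opSeries hc hI hJ hτ hSJ hST hA hB hV c hr
    (hf.summable (by linarith) hrR)
    (t := fun i j => cintegral (ν i j) fun z => pderivTwo ℂ i j f fun l => (z l : ℂ))
    fun i j _ => ?_
  simp only [← hL]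
  exact hf.isNormallySummable.hasSum_integral (ν i j) (hν i j) _ (torusIncl n) hφ hR i j
    fun x => hf.hasSum_pderivTwo i j fun l => (hφ x l).trans_lt hR

theorem RemainderTraceEq.of_cube_measure (S : HilbertSchmidtTrace H)
    (hc : ∀ (s : ℝ) (i j : Fin n), Commute (linPath A B s i) (linPath A B s j))
    (hI : I.IsComplete) (hJ : J.IsSqrtOf I) (hτ : I.IsPosBddTrace τ) (hSJ : S.J = J.carrier)
    (hST : ∀ A : I.carrier, S.T A = τ A) (hA : ∀ j, ‖A j‖ ≤ 1) (hB : ∀ j, ‖B j‖ ≤ 1)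
    (hV : ∀ j, B j - A j ∈ J.carrier) {ν : Fin n → Fin n → SignedMeasure (Fin n → UnitIcc)}
    (hν : ∀ i j, (ν i j).variation Set.univ ≠ ⊤)
    (hL : ∀ i j F, map (starRingEnd ℂ) F = F →
      sintegral (ν i j) (evalAlong (cubeIncl n) F) = S.taylorFunctional hc i j F)
    {c : (Fin n → ℕ) → ℂ} {R : ℝ} (hR : 1 < R) {f : (Fin n → ℝ) → ℂ}
    (hf : IsCubeSeries c R f) :
    RemainderTraceEq I τ (fun s => opSeries c (linPath A B s))
      ((∑ j, sintegral (ν j j) fun x => pderivTwo ℝ j j f fun l => (x l : ℝ)) +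
        2 * ∑ i, ∑ j ∈ Finset.Ioi i,
          sintegral (ν i j) fun x => pderivTwo ℝ i j f fun l => (x l : ℝ)) := by
  have hx : ∀ (x : Fin n → UnitIcc) j, |(x j : ℝ)| ≤ 1 := fun x j => abs_le.2 (x j).2
  have hφ : ∀ x, cubeIncl n x ∈ closedPolydisc n := fun x j => by
    simpa [cubeIncl] using hx x j
  obtain ⟨r, hr, hrR⟩ := exists_between hR
  refine S.remainderTraceEq_opSeries hc hI hJ hτ hSJ hST hA hB hV c hr
    (hf.summable (by linarith) hrR)
    (t := fun i j => sintegral (ν i j) fun x => pderivTwo ℝ i j f fun l => (x l : ℝ))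
    fun i j _ => ?_
  have h := hf.isNormallySummable.hasSum_integral (ν i j) (hν i j)
    (ContinuousLinearMap.lsmul ℝ ℝ).flip (cubeIncl n) hφ hR i j fun x =>
      hf.hasSum_pderivTwo i j fun l => (hx x l).trans_lt hR
  -- The signed measure represents the functional on real polynomials only. The monomial has real
  -- coefficients, so the complex `c k` is pulled out on both sides.
  refine h.congr_fun fun k => ?_
  rw [← smul_eq_C_mul, Derivation.map_smul, Derivation.map_smul, map_smul,
    map_smul, smul_eq_mul, ← hL _ _ _ (map_conj_pderiv_word i j _), ← sintegral_const_mul]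
  rfl

/-- Stated for a general map into the polydisc so as to serve both for `ν_jj` on the torus and for
the measure on the circle. -/
theorem RemainderTraceEq.of_diagonal_measure (S : HilbertSchmidtTrace H)
    (hc : ∀ (s : ℝ) (i j : Fin n), Commute (linPath A B s i) (linPath A B s j))
    (hI : I.IsComplete) (hJ : J.IsSqrtOf I) (hτ : I.IsPosBddTrace τ) (hSJ : S.J = J.carrier)
    (hST : ∀ A : I.carrier, S.T A = τ A) (hA : ∀ j, ‖A j‖ ≤ 1) (hB : ∀ j, ‖B j‖ ≤ 1)
    (hV : ∀ j, B j - A j ∈ J.carrier) (j : Fin n) {K : Type*} [TopologicalSpace K]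
    [MeasurableSpace K] [BorelSpace K] {φ : C(K, Fin n → ℂ)} (hφ : ∀ x, φ x ∈ closedPolydisc n)
    {ν : ComplexMeasure K} (hν : ν.variation Set.univ ≠ ⊤)
    (hL : ∀ F : MvPolynomial (Fin n) ℂ, cintegral ν (evalAlong φ (aeval (fun _ => X j) F))
      = S.taylorFunctional hc j j (aeval (fun _ => X j) F))
    {c : ℕ → ℂ} {R : ℝ} (hR : 1 < R) {f : ℂ → ℂ} (hf : IsDiscSeries c R f) :
    RemainderTraceEq I τ (fun s => opSeriesOne c (A j + s • (B j - A j)))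
      (cintegral ν fun x => deriv (deriv f) (φ x j)) := by
  obtain ⟨r, hr, hrR⟩ := exists_between hR
  refine S.remainderTraceEq_opSeriesOne hc hI hJ hτ hSJ hST hA hB hV c hr
    (hf.summable (by linarith) hrR) j ?_
  have e : ∀ k, pderiv j (pderiv j (C (c k) * X j ^ k : MvPolynomial (Fin n) ℂ))
      = aeval (fun _ : Fin n => (X j : MvPolynomial (Fin n) ℂ))
        (pderiv j (pderiv j (C (c k) * X j ^ k : MvPolynomial (Fin n) ℂ))) := fun k => by
    rw [C_mul_X_pow_eq_monomial, pderiv_monomial_single, pderiv_monomial_single,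
      ← C_mul_X_pow_eq_monomial]
    simp only [map_mul, map_pow, aeval_X, aeval_C, algebraMap_eq]
  have h := (hf.isNormallySummable j).hasSum_integral ν hν (ContinuousLinearMap.mul ℝ ℂ) φ hφ hR
    j j fun x => hf.hasSum_deriv_deriv j (z := φ x) fun l => (hφ x l).trans_lt hR
  refine h.congr_fun fun k => ?_
  rw [e, ← hL]
  rfl

end Assembly

end

/-! ### The theorem. -/

theorem mainTheorem2 {H : Type*} [NormedAddCommGroup H] [InnerProductSpace ℂ H]
    [CompleteSpace H] [TopologicalSpace.SeparableSpace H]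
    (I J : NormedIdeal H) (hI : I.IsComplete) (hJ : J.IsSqrtOf I)
    (τ : I.carrier →ₗ[ℂ] ℂ) (hτ : I.IsPosBddTrace τ)
    {n : ℕ} (A B : Fin n → H →L[ℂ] H) (hA : IsCommContr A) (hB : IsCommContr B)
    (hV : ∀ j, B j - A j ∈ J.carrier)
    (hcomm : ∀ i j, Commute (B i - A i) (B j - A j))
    (hdil : IsDilatablePath A B) :
    (∃ ν : Fin n → Fin n → ComplexMeasure (Fin n → UnitCirc),
      (∀ i j, i ≤ j → (ν i j).variation Set.univ ≤ ENNReal.ofReal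
        (1 / 2 * √(I.trSq τ (B i - A i)) * √(I.trSq τ (B j - A j)))) ∧
      (∀ i j, i ≤ j → (B i - A i) * (B j - A j) ∈ I.carrier ∧
        ν i j Set.univ = 1 / 2 * I.tr τ ((B i - A i) * (B j - A j))) ∧
      (∀ ε : ℝ, 0 < ε → ∀ (c : (Fin n → ℕ) → ℂ) (f : (Fin n → ℂ) → ℂ),
        IsPolydiscSeries c (1 + ε) f →
        RemainderTraceEq I τ (fun s => opSeries c (linPath A B s))
          ((∑ j, cintegral (ν j j) fun z => pderivTwo ℂ j j f fun l => (z l : ℂ)) +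
            2 * ∑ i, ∑ j ∈ Finset.Ioi i,
              cintegral (ν i j) fun z => pderivTwo ℂ i j f fun l => (z l : ℂ))) ∧
      (∀ j, (∃ ν₀, IsPairMeasure I τ (A j) (B j) ν₀) ∧
        ∀ ν₀, IsPairMeasure I τ (A j) (B j) ν₀ →
          ∀ ε : ℝ, 0 < ε → ∀ (c : ℕ → ℂ) (g : ℂ → ℂ), IsDiscSeries c (1 + ε) g →
            cintegral (ν j j) (fun z => g (z j)) = cintegral ν₀ fun z => g z)) ∧
    ((∀ j, IsSelfAdjoint (A j)) → (∀ j, IsSelfAdjoint (B j)) →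
      ∃ ν : Fin n → Fin n → SignedMeasure (Fin n → UnitIcc),
        (∀ i j, i ≤ j → (ν i j).variation Set.univ ≤ ENNReal.ofReal
          (1 / 2 * √(I.trSq τ (B i - A i)) * √(I.trSq τ (B j - A j)))) ∧
        (∀ i j, i ≤ j → (B i - A i) * (B j - A j) ∈ I.carrier ∧
          (ν i j Set.univ : ℂ) = 1 / 2 * I.tr τ ((B i - A i) * (B j - A j))) ∧
        (∀ ε : ℝ, 0 < ε → ∀ (c : (Fin n → ℕ) → ℂ) (f : (Fin n → ℝ) → ℂ),
          IsCubeSeries c (1 + ε) f →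
          RemainderTraceEq I τ (fun s => opSeries c (linPath A B s))
            ((∑ j, sintegral (ν j j) fun x => pderivTwo ℝ j j f fun l => (x l : ℝ)) +
              2 * ∑ i, ∑ j ∈ Finset.Ioi i,
                sintegral (ν i j) fun x => pderivTwo ℝ i j f fun l => (x l : ℝ)))) := by
  -- Commutation is obtained for every real `s`, beyond `[0, 1]`, so that derivatives at 0 are
  -- two-sided.
  have hc := commute_linPath hA.comm hB.comm hcomm
  obtain ⟨S, hSJ, hST⟩ := hJ.exists_hilbertSchmidtTrace hτ
  have hVS : ∀ j, B j - A j ∈ S.J := fun j => hSJ ▸ hV j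
  have hsq : ∀ j, I.trSq τ (B j - A j) = S.sq (B j - A j) := fun j => S.trSq_eq hJ hST (hV j)
  have hVV : ∀ i j, (B i - A i) * (B j - A j) ∈ I.carrier := fun i j => hJ.mul_mem (hV i) (hV j)
  simp only [IsPairMeasure, hsq]
  constructor
  · choose ν hν hL using S.exists_torus_measure hc hVS hdil
    have hfin : ∀ i j, (ν i j).variation Set.univ ≠ ⊤ := fun i j =>
      ne_top_of_le_ne_top ENNReal.ofReal_ne_top (hν i j)
    have hφ : ∀ x, torusIncl n x ∈ closedPolydisc n := fun x j =>
      (mem_sphere_zero_iff_norm.1 (x j).2).le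
    refine ⟨ν, fun i j _ => hν i j, fun i j _ => ⟨hVV i j, ?_⟩, fun ε hε c f hf =>
      RemainderTraceEq.of_torus_measure S hc hI hJ hτ hSJ hST hA.norm_le hB.norm_le hV hfin hL
        (by linarith) hf, fun j => ?_⟩
    · rw [S.tr_eq hST (hVV i j), ← S.taylorFunctional_one hc hVS, ← hL,
        ← cintegral_one _ (hfin i j)]
      congr 1
      ext z
      simp [evalAlong_apply]
    · constructor
      · obtain ⟨ν₀, hν₀, hL₀⟩ := S.exists_circle_measure hc hVS hdil j
        have hφ₀ : ∀ x, circIncl n x ∈ closedPolydisc n := fun x j =>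
          (mem_sphere_zero_iff_norm.1 x.2).le
        exact ⟨ν₀, hν₀, fun ε hε c f hf => RemainderTraceEq.of_diagonal_measure S hc hI hJ hτ hSJ
          hST hA.norm_le hB.norm_le hV j hφ₀ (ne_top_of_le_ne_top ENNReal.ofReal_ne_top hν₀)
          hL₀ (by linarith) hf⟩
      · rintro ν₀ ⟨-, hν₀⟩ ε hε c g hg
        -- With `g = f''` on the disc, `ν_jj` and `ν₀` both compute the trace of the remainder of
        -- `f`, and that trace is unique.
        obtain ⟨c', f, hf, hfg⟩ := hg.exists_deriv_deriv_eq
        have h := (RemainderTraceEq.of_diagonal_measure S hc hI hJ hτ hSJ hST hA.norm_le hB.norm_le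
          hV j hφ (hfin j j) (fun F => hL j j _) (by linarith) hf).unique (hν₀ ε hε c' f hf)
        have e1 : ∀ z : UnitCirc, deriv (deriv f) z = g z := fun z =>
          hfg z (by rw [mem_sphere_zero_iff_norm.1 z.2]; linarith)
        have e2 : ∀ z, deriv (deriv f) (torusIncl n z j) = g (z j) := fun z => e1 (z j)
        simpa only [e1, e2] using h
  · intro hAs hBs
    choose ν hν hL using S.exists_cube_measure hc hVS hAs hBs fun s hs => (hdil s hs).1.norm_le
    have hfin : ∀ i j, (ν i j).variation Set.univ ≠ ⊤ := fun i j =>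
      ne_top_of_le_ne_top ENNReal.ofReal_ne_top (hν i j)
    refine ⟨ν, fun i j _ => hν i j, fun i j _ => ⟨hVV i j, ?_⟩, fun ε hε c f hf =>
      RemainderTraceEq.of_cube_measure S hc hI hJ hτ hSJ hST hA.norm_le hB.norm_le hV hfin hL
        (by linarith) hf⟩
    rw [S.tr_eq hST (hVV i j), ← S.taylorFunctional_one hc hVS, ← hL _ _ _ (map_one _),
      ← sintegral_one _ (hfin i j)]
    congr 1
    ext z
    simp [evalAlong_apply]
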